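/- Let $j=\begin{pmatrix}-1&0\\0&1\end{pmatrix}$ and let $S\subset\mathbb R$ be an interval containing $0$. For each $z\in\mathbb C$ and $\ell\in S$ let $\mathfrak A(z,\ell)$ be a complex $2\times2$ matrix such that: - (continuity) $\ell\mapsto\mathfrak A(z,\ell)$ is continuous on $S$ for every $z$; - ($j$-monotonicity) for all $\ell_1<\ell_2$ in $S$, the function $C(z)=\mathfrak A(z,\ell_1)^{-1}\mathfrak A(z,\ell_2)$ is entire, with $j-C(z)jC(z)^*\ge0$ for $\operatorname{Im}z>0$ and $j-C(z)jC(z)^*=0$ for $z\in\mathbb R$; - (A-gauge) for every $\ell\in S$, $\mathfrak A(i,\ell)$ is lower triangular with positive diagonal entries; - $\det\mathfrak A(z,\ell)=1$ for all $z,\ell$, and $\mathfrak A(z,0)=I$ for all $z$. Then: (a) $\mathfrak A$ is the solution of a canonical system in A-gauge: there are a positive Borel measure $\mu$ on $S$ without atoms, finite on compact subintervals of $S$, and a locally $\mu$-integrable function $\mathfrak a:S\to\mathbb C$ with $|\mathfrak a|\le1$ $\mu$-a.e., such that, with $$A=\begin{pmatrix}1&-\overline{\mathfrak a}\\-\mathfrak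 a&1\end{pmatrix}\ge0,\qquad B=\begin{pmatrix}0&\overline{\mathfrak a}\\-\mathfrak a&0\end{pmatrix}=-B^*,$$ $$\mathfrak A(z,\ell)j=j+\int_0^\ell\mathfrak A(z,l)\bigl(izA(l)-B(l)\bigr)\,d\mu(l),\qquad z\in\mathbb C,\ \ell\in S.$$ Moreover, the following hold for every pair $(\mu,\mathfrak a)$ as in (a), where $\mu(\ell)$ denotes the distribution function of $\mu$ normalized by $\mu(0)=0$, so that $\mu([\ell_1,\ell_2))=\mu(\ell_2)-\mu(\ell_1)$ for $\ell_1\le\ell_2$ in $S$: (b) $\mathfrak A_{22}(i,\ell)$ is a (weakly) decreasing function of $\ell\in S$, and $$\mu(\ell)=\log\mathfrak A_{11}(i,\ell)=-\log\mathfrak A_{22}(i,\ell),\qquad \ell\in S.$$ (c) $\mathfrak A(i,\cdot)$ is locally absolutely continuous with respect to $\mu$, and its Radon–Nikodym derivative $\partial_\mu\mathfrak A(i,\cdot)$ satisfies $$A(\ell)+B(\ell)=\begin{pmatrix}1&0\\-2\mathfrak a(\ell)&1\end{pmatrix}=-\mathfrak A(i,\ell)^{-1}\,\partial_\mu\mathfrak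 A(i,\ell)\,j\qquad\text{for }\mu\text{-a.e. }\ell.$$ Moreover, $|\mathfrak a(\ell)|\le1$ for $\mu$-a.e. $\ell$. (d) For every $\ell\in S$, $$\mathfrak A(i,\ell)=\begin{pmatrix}e^{\mu(\ell)}&0\\-e^{\mu(\ell)}\kappa(\ell)&e^{-\mu(\ell)}\end{pmatrix},\qquad \kappa(\ell)=\int_0^\ell2\mathfrak a(l)e^{-2\mu(l)}\,d\mu(l).$$ -/

import Mathlib

open scoped ComplexOrder Matrix

noncomputable section

namespace Arov

/-- Complex `2 × 2` matrices. -/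
abbrev Mat2 : Type := Matrix (Fin 2) (Fin 2) ℂ

/-- The signature matrix `j = diag(-1, 1)`. -/
def jMat : Mat2 := !![-1, 0; 0, 1]

/-- An entire matrix function `A` is `J`-inner if `J - A(z) J A(z)* ≥ 0` for `Im z > 0`,
with equality to zero for real `z`. -/
structure IsJInner (J : Mat2) (A : ℂ → Mat2) : Prop where
  entire : ∀ i k, Differentiable ℂ fun z => A z i k
  contractive : ∀ z : ℂ, 0 < z.im → (J - A z * J * (A z)ᴴ).PosSemidef
  unitary : ∀ x : ℝ, J - A x * J * (A x)ᴴ = 0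

/-- The family `A(z, t)`, `t ∈ S`, is `J`-monotonic if `A(z, t₁)⁻¹ A(z, t₂)` is `J`-inner
whenever `t₁ < t₂`. -/
def IsJMonotonic (J : Mat2) (S : Set ℝ) (A : ℂ → ℝ → Mat2) : Prop :=
  ∀ t₁ ∈ S, ∀ t₂ ∈ S, t₁ < t₂ → IsJInner J fun z => (A z t₁)⁻¹ * A z t₂

/-- Continuity of the family in the parameter `t ∈ S`, for each fixed `z`. -/
def IsContinuousFamily (S : Set ℝ) (A : ℂ → ℝ → Mat2) : Prop :=
  ∀ z, ContinuousOn (fun t => A z t) S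

/-- Arov gauge: at `z = i` the matrices are lower triangular with positive diagonal entries
(`0 < w` for a complex number `w` means that `w` is real and positive). -/
def InArovGauge (S : Set ℝ) (A : ℂ → ℝ → Mat2) : Prop :=
  ∀ t ∈ S, A Complex.I t 0 1 = 0 ∧ 0 < A Complex.I t 0 0 ∧ 0 < A Complex.I t 1 1

/-- A matrix function is locally `ν`-integrable on `S`: every entry is integrable on every
compact interval with end points in `S`. -/
def LocInt (S : Set ℝ) (ν : MeasureTheory.Measure ℝ) (F : ℝ → Mat2) : Prop :=
  ∀ a ∈ S, ∀ b ∈ S, ∀ i k, MeasureTheory.IntegrableOn (fun t => F t i k) (Set.Icc a b) ν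

/-- The entrywise oriented integral `∫ₐᵇ F dν` of a matrix function. -/
def matIntegral (ν : MeasureTheory.Measure ℝ) (F : ℝ → Mat2) (a b : ℝ) : Mat2 :=
  Matrix.of fun i k => ∫ t in a..b, F t i k ∂ν

/-- Coefficients `(ν, P, Q)` of a canonical system on the interval `S`: `ν` is a continuous
positive Borel measure on `S` (viewed as a measure on `ℝ` carried by `S`), finite on compact
subintervals of `S`; `P, Q` are locally integrable with `P ≥ 0`, `Q = -Q*` and
`tr (jP) = tr (jQ) = 0` almost everywhere. -/
structure IsCanonicalSystem (S : Set ℝ) (ν : MeasureTheory.Measure ℝ) (P Q : ℝ → Mat2) :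
    Prop where
  carried : ν Sᶜ = 0
  continuous : ∀ t, ν {t} = 0
  finite : ∀ a ∈ S, ∀ b ∈ S, ν (Set.Icc a b) < ⊤
  locInt_P : LocInt S ν P
  locInt_Q : LocInt S ν Q
  nonneg : ∀ᵐ t ∂ν, (P t).PosSemidef
  skew : ∀ᵐ t ∂ν, Q t = -(Q t)ᴴ
  trace_P : ∀ᵐ t ∂ν, (jMat * P t).trace = 0
  trace_Q : ∀ᵐ t ∂ν, (jMat * Q t).trace = 0

/-- The coefficients are in Arov gauge: `P + Q` is lower triangular and `tr Q = 0` a.e. -/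
def CoeffInArovGauge (ν : MeasureTheory.Measure ℝ) (P Q : ℝ → Mat2) : Prop :=
  ∀ᵐ t ∂ν, (P t + Q t) 0 1 = 0 ∧ (Q t).trace = 0

/-- `A` solves the canonical system on `S`:
`A(z,t) j = j + ∫₀ᵗ A(z,ξ) (i z P(ξ) - Q(ξ)) dν(ξ)` for all `z ∈ ℂ`, `t ∈ S`,
with locally integrable integrand. -/
def SolvesCanonicalSystem (S : Set ℝ) (ν : MeasureTheory.Measure ℝ) (P Q : ℝ → Mat2)
    (A : ℂ → ℝ → Mat2) : Prop :=
  ∀ z : ℂ,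
    LocInt S ν (fun ξ => A z ξ * ((Complex.I * z) • P ξ - Q ξ)) ∧
    ∀ t ∈ S, A z t * jMat =
      jMat + matIntegral ν (fun ξ => A z ξ * ((Complex.I * z) • P ξ - Q ξ)) 0 t

/-- The coefficient `A` attached to the parameter `𝔞`. -/
def coeffA (𝔞 : ℝ → ℂ) (t : ℝ) : Mat2 := !![1, -star (𝔞 t); -𝔞 t, 1]

/-- The coefficient `B` attached to the parameter `𝔞`. -/
def coeffB (𝔞 : ℝ → ℂ) (t : ℝ) : Mat2 := !![0, star (𝔞 t); -𝔞 t, 0]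

/-- The family `𝔄` is the solution on `S` of the canonical system in Arov gauge with
parameters `(μ, 𝔞)`. -/
structure IsArovSolution (S : Set ℝ) (μ : MeasureTheory.Measure ℝ) (𝔞 : ℝ → ℂ)
    (𝔄 : ℂ → ℝ → Mat2) : Prop where
  system : IsCanonicalSystem S μ (coeffA 𝔞) (coeffB 𝔞)
  gauge : CoeffInArovGauge μ (coeffA 𝔞) (coeffB 𝔞)
  solves : SolvesCanonicalSystem S μ (coeffA 𝔞) (coeffB 𝔞) 𝔄

/-- The distribution function of `μ`, normalized to vanish at `0`. -/
def distrib (μ : MeasureTheory.Measure ℝ) (t : ℝ) : ℝ :=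
  if 0 ≤ t then μ.real (Set.Ico 0 t) else -μ.real (Set.Ico t 0)

/-- On `S` the matrix function `F` is locally absolutely continuous with respect to `μ`, with
Radon–Nikodym derivative `∂_μ F = D`. -/
def HasRNDeriv (S : Set ℝ) (μ : MeasureTheory.Measure ℝ) (F D : ℝ → Mat2) : Prop :=
  LocInt S μ D ∧ ∀ a ∈ S, ∀ b ∈ S, F b - F a = matIntegral μ D a b

/-- `κ(ℓ) = ∫₀^ℓ 2 𝔞(l) e^{-2μ(l)} dμ(l)`. -/
def kappa (μ : MeasureTheory.Measure ℝ) (𝔞 : ℝ → ℂ) (t : ℝ) : ℂ :=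
  ∫ l in (0 : ℝ)..t, 2 * 𝔞 l * (Real.exp (-2 * distrib μ l) : ℂ) ∂μ

end Arov

end

/-! Write C = 𝔄(z,s)⁻¹𝔄(z,t) for s ≤ t (`transfer`), m(t) = log 𝔄₁₁(i,t) (`logDiag`) and κ =
-e^{-m}𝔄₂₁(i,·) (`offDiag`). Each C is j-inner and in A-gauge, and its `mass` is m(t) - m(s) ≥ 0.
The theorem rests on the fact that, for s close to t, C is determined by its value at i up to an
error that is small compared with its mass.

The unit quadratic forms of the Cayley transform (1+C)⁻¹(1-C)j have nonnegative real part in the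
upper half plane and satisfy f(z̄) = -conj f(z). If C is close to 1 on a large disc they are
holomorphic there, and functions of this kind are nearly affine
(`IsHerglotzOnDisc.norm_sub_affine_le`), hence fixed by the values at ±i. Those values have size at
most twice the mass, so undoing the Cayley transform makes C affine in z up to ε times the mass
(`IsArovInner.exists_norm_sub_affine_le`). That short transfer matrices are close to 1 on a large
disc follows from a Harnack bound of the entries by the mass, a maximum principle across the real
axis, and equicontinuity (`IsArovFamily.exists_nearOne`).

At z = i positivity gives |κ(t) - κ(s)| ≤ e^{-2m(s)} - e^{-2m(t)}
(`IsArovFamily.norm_offDiag_sub_le`). So κ is a Lipschitz function of m on compact intervals. Its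
derivative provides 𝔞 with |𝔞| ≤ 1, and the measure with distribution function m provides μ
(`IsArovFamily.exists_isParameter`). The local approximation shows that 𝔄j minus the integral of
𝔄(izA - B) has increments negligible against those of m; such a function is constant
(`eq_of_increments_le`), which is the canonical system.

Conversely, for any solving pair the first column of the system at z = i reads d(e^m) = e^m dμ
together with an equation for 𝔄₂₁. The same negligible-increment principle integrates them to μ = m
and dκ = 2𝔞e^{-2m} dμ. The derivative formula follows since izA - B = -(A+B) at z = i and densities
are unique. -/

noncomputable section

open Complex Metric Set Filter Topology MeasureTheory

namespace Arov

/-! ### Harnack inequalities -/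

/-- The open upper half of the disc of radius `R` around the origin. -/
def upperHalfDisc (R : ℝ) : Set ℂ := {z | 0 < z.im} ∩ ball 0 R

/-- Borel–Carathéodory applies to -f, whose real part lies below every M > 0; letting M tend to 0
leaves a Harnack bound for the modulus of f. -/
theorem norm_mul_le_of_re_nonneg {f : ℂ → ℂ} {c z : ℂ} {r : ℝ}
    (hf : DifferentiableOn ℂ f (ball c r)) (hre : ∀ w ∈ ball c r, 0 ≤ (f w).re)
    (hz : z ∈ ball c r) :
    ‖f z‖ * (r - dist z c) ≤ (r + dist z c) * ‖f c‖ := by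
  have hr : 0 < r := nonempty_ball.1 ⟨z, hz⟩
  have hd : dist z c < r := hz
  have hmaps : MapsTo (fun w : ℂ => w + c) (ball 0 r) (ball c r) := by
    intro w hw
    simpa [dist_eq_norm] using hw
  have hg : DifferentiableOn ℂ (fun w => -f (w + c)) (ball 0 r) :=
    (hf.comp (by fun_prop) hmaps).neg
  have hz' : z - c ∈ ball (0 : ℂ) r := by simpa [dist_eq_norm] using hz
  have key : ∀ M : ℝ, 0 < M →
      ‖f z‖ * (r - dist z c) ≤ (r + dist z c) * ‖f c‖ + 2 * dist z c * M := by
    intro M hM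
    have h := borelCaratheodory hM hg (fun w hw => ?_) hr hz'
    · simp only [norm_neg, sub_add_cancel, zero_add, ← dist_eq_norm] at h
      rw [← add_div, le_div_iff₀ (by linarith)] at h
      linarith
    · have := hre _ (hmaps hw)
      simp only [mem_ofPred_eq, neg_re]
      linarith
  refine le_of_forall_pos_le_add fun ε hε => ?_
  refine (key (ε / (2 * r)) (by positivity)).trans ?_
  gcongr
  rw [mul_div_assoc', div_le_iff₀ (by positivity)]
  nlinarith

/-- Reciprocals preserve positive real part, so the preceding bound for 1/(f + ε) inverts to the
opposite inequality. The shift by ε excludes zeros and is then sent to 0. -/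
theorem norm_center_mul_le_of_re_nonneg {f : ℂ → ℂ} {c z : ℂ} {r : ℝ}
    (hf : DifferentiableOn ℂ f (ball c r)) (hre : ∀ w ∈ ball c r, 0 ≤ (f w).re)
    (hz : z ∈ ball c r) :
    ‖f c‖ * (r - dist z c) ≤ (r + dist z c) * ‖f z‖ := by
  have hr : 0 < r := nonempty_ball.1 ⟨z, hz⟩
  have hd : dist z c < r := hz
  have hc : c ∈ ball c r := mem_ball_self hr
  have key : ∀ ε : ℝ, 0 < ε →
      ‖f c + ε‖ * (r - dist z c) ≤ (r + dist z c) * ‖f z + ε‖ := by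
    intro ε hε
    have hpos : ∀ w ∈ ball c r, 0 < (f w + ε).re := fun w hw => by
      have := hre w hw
      simp only [add_re, ofReal_re]
      linarith
    have hne : ∀ w ∈ ball c r, f w + ε ≠ 0 := fun w hw h => by
      have := hpos w hw
      rw [h] at this
      simp at this
    have h := norm_mul_le_of_re_nonneg (f := fun w => (f w + ε)⁻¹) (c := c) (z := z) (r := r)
      ((hf.add_const _).inv hne) (fun w hw => ?_) hz
    · simp only [norm_inv] at h
      have h1 : 0 < ‖f c + ε‖ := norm_pos_iff.2 (hne c hc)
      have h2 : 0 < ‖f z + ε‖ := norm_pos_iff.2 (hne z hz)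
      rw [inv_mul_eq_div, ← div_eq_mul_inv, div_le_div_iff₀ h2 h1] at h
      linarith
    · rw [inv_re]
      exact div_nonneg (hpos w hw).le (normSq_nonneg _)
  have hlim : Tendsto (fun ε : ℝ => ‖f c + ε‖ * (r - dist z c)) (𝓝[>] 0)
      (𝓝 (‖f c‖ * (r - dist z c))) := by
    have : Continuous fun ε : ℝ => ‖f c + ε‖ * (r - dist z c) := by fun_prop
    simpa using (this.tendsto 0).mono_left nhdsWithin_le_nhds
  have hlim' : Tendsto (fun ε : ℝ => (r + dist z c) * ‖f z + ε‖) (𝓝[>] 0)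
      (𝓝 ((r + dist z c) * ‖f z‖)) := by
    have : Continuous fun ε : ℝ => (r + dist z c) * ‖f z + ε‖ := by fun_prop
    simpa using (this.tendsto 0).mono_left nhdsWithin_le_nhds
  exact le_of_tendsto_of_tendsto hlim hlim'
    (eventually_nhdsWithin_of_forall fun ε hε => key ε hε)

/-- A nonnegative function satisfying both Harnack inequalities on all discs in an upper half
disc is controlled there by its value at `i`. -/
theorem mul_im_le_of_harnack {N : ℂ → ℝ} {ρ : ℝ} (hρ : 1 ≤ ρ)
    (h0 : ∀ z ∈ upperHalfDisc (4 * ρ), 0 ≤ N z)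
    (hN : ∀ c r, ball c r ⊆ upperHalfDisc (4 * ρ) → ∀ z ∈ ball c r,
      N z * (r - dist z c) ≤ (r + dist z c) * N c ∧
      N c * (r - dist z c) ≤ (r + dist z c) * N z)
    {z : ℂ} (hz : 0 < z.im) (hzρ : ‖z‖ ≤ ρ) :
    N z * z.im ≤ 56 * ρ ^ 2 * N I := by
  have hx : |z.re| ≤ ρ := (abs_re_le_norm z).trans hzρ
  have hy : z.im ≤ ρ := (im_le_norm z).trans hzρ
  -- Harnack chain i → 2ρi → p = Re z + iρ → z. The first two links lie in the disc of radius 2ρ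
  -- about 2ρi, the last in the disc of radius ρ about p. They cost factors 4ρ, 7 and 2ρ / Im z,
  -- whose product is 56ρ² / Im z.
  have hsub1 : ball (2 * ρ * I) (2 * ρ) ⊆ upperHalfDisc (4 * ρ) := by
    intro w hw
    rw [mem_ball, dist_eq_norm] at hw
    have h1 := (abs_im_le_norm (w - 2 * ρ * I)).trans_lt hw
    have h2 : ‖w‖ ≤ ‖w - 2 * ρ * I‖ + ‖(2 * ρ * I : ℂ)‖ := by
      simpa using norm_add_le (w - 2 * ρ * I) (2 * ρ * I)
    have h3 : ‖(2 * ρ * I : ℂ)‖ = 2 * ρ := by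
      simp [abs_of_pos (by linarith : 0 < ρ)]
    simp only [sub_im, mul_im, mul_re, I_im, I_re, ofReal_re, ofReal_im, re_ofNat, im_ofNat,
      abs_lt] at h1
    refine ⟨?_, ?_⟩
    · simp only [mem_ofPred_eq]; linarith [h1.1]
    · rw [mem_ball, dist_zero_right]; linarith
  set p : ℂ := ⟨z.re, ρ⟩ with hp
  have hpc : dist p (2 * ρ * I) ≤ 3 / 2 * ρ := by
    rw [dist_eq_norm, Complex.norm_def, Real.sqrt_le_left (by linarith), normSq_apply]
    simp only [hp, sub_re, sub_im, mul_im, mul_re, I_im, I_re, ofReal_re, ofReal_im, re_ofNat,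
      im_ofNat]
    nlinarith [sq_abs z.re, abs_nonneg z.re]
  have hpn : ‖p‖ ≤ 3 / 2 * ρ := by
    rw [Complex.norm_def, Real.sqrt_le_left (by linarith), normSq_apply]
    simp only [hp]
    nlinarith [sq_abs z.re, abs_nonneg z.re]
  have hsub2 : ball p ρ ⊆ upperHalfDisc (4 * ρ) := by
    intro w hw
    rw [mem_ball, dist_eq_norm] at hw
    have h1 := (abs_im_le_norm (w - p)).trans_lt hw
    have h2 : ‖w‖ ≤ ‖w - p‖ + ‖p‖ := by simpa using norm_add_le (w - p) p
    simp only [sub_im, hp, abs_lt] at h1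
    refine ⟨?_, ?_⟩
    · simp only [mem_ofPred_eq]; linarith [h1.1]
    · rw [mem_ball, dist_zero_right]; linarith
  have hI : dist I (2 * ρ * I) = 2 * ρ - 1 := by
    rw [dist_comm, dist_eq_norm, show (2 * ρ * I - I : ℂ) = ((2 * ρ - 1 : ℝ) : ℂ) * I by
      push_cast; ring]
    rw [norm_mul, norm_I, mul_one, norm_real, Real.norm_of_nonneg (by linarith)]
  have hzp : dist z p = ρ - z.im := by
    rw [dist_comm, dist_eq_norm, show p - z = ((ρ - z.im : ℝ) : ℂ) * I by
      apply Complex.ext <;> simp [hp]]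
    rw [norm_mul, norm_I, mul_one, norm_real, Real.norm_of_nonneg (by linarith)]
  have hIm : I ∈ ball (2 * ρ * I : ℂ) (2 * ρ) := by rw [mem_ball, hI]; linarith
  have hpm : p ∈ ball (2 * ρ * I : ℂ) (2 * ρ) := by rw [mem_ball]; linarith
  have hzm : z ∈ ball p ρ := by rw [mem_ball, hzp]; linarith
  have s1 := (hN _ _ hsub1 I hIm).2
  have s2 := (hN _ _ hsub1 p hpm).1
  have s3 := (hN _ _ hsub2 z hzm).1
  rw [hI] at s1
  rw [hzp] at s3
  have nI := h0 I (hsub1 hIm)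
  have np := h0 p (hsub1 hpm)
  have nc := h0 _ (hsub1 (mem_ball_self (by linarith)))
  have t1 : N (2 * ρ * I) ≤ 4 * ρ * N I := by nlinarith
  have t2 : N p ≤ 7 * N (2 * ρ * I) := by
    have h1 : N p * (ρ / 2) ≤ N p * (2 * ρ - dist p (2 * ρ * I)) := by gcongr; linarith
    have h2 : (2 * ρ + dist p (2 * ρ * I)) * N (2 * ρ * I) ≤ (7 / 2 * ρ) * N (2 * ρ * I) := by
      gcongr; linarith
    have h3 : ρ * (N p) ≤ ρ * (7 * N (2 * ρ * I)) := by linarith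
    exact le_of_mul_le_mul_left h3 (by linarith)
  have t3 : N z * z.im ≤ 2 * ρ * N p := by nlinarith
  calc N z * z.im ≤ 2 * ρ * N p := t3
    _ ≤ 2 * ρ * (7 * (4 * ρ * N I)) := by gcongr; linarith
    _ = 56 * ρ ^ 2 * N I := by ring

theorem norm_mul_im_le_of_re_nonneg {f : ℂ → ℂ} {ρ : ℝ} (hρ : 1 ≤ ρ)
    (hf : DifferentiableOn ℂ f (upperHalfDisc (4 * ρ)))
    (hre : ∀ z ∈ upperHalfDisc (4 * ρ), 0 ≤ (f z).re) {z : ℂ} (hz : 0 < z.im) (hzρ : ‖z‖ ≤ ρ) :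
    ‖f z‖ * z.im ≤ 56 * ρ ^ 2 * ‖f I‖ :=
  mul_im_le_of_harnack (N := fun z => ‖f z‖) hρ (fun _ _ => norm_nonneg _)
    (fun _ _ hsub _ hw => ⟨norm_mul_le_of_re_nonneg (hf.mono hsub) (fun _ hv => hre _ (hsub hv)) hw,
      norm_center_mul_le_of_re_nonneg (hf.mono hsub) (fun _ hv => hre _ (hsub hv)) hw⟩) hz hzρ

/-- A zero-free holomorphic function on a disc has a logarithm, with prescribed real value of the
logarithm of the modulus at a given point. -/
theorem exists_log_on_ball {g : ℂ → ℂ} {c w : ℂ} {r : ℝ} (hg : DifferentiableOn ℂ g (ball c r))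
    (hne : ∀ z ∈ ball c r, g z ≠ 0) (hw : w ∈ ball c r) :
    ∃ L : ℂ → ℂ, DifferentiableOn ℂ L (ball c r) ∧
      (∀ z ∈ ball c r, (L z).re = Real.log ‖g z‖) ∧ L w = (Real.log ‖g w‖ : ℂ) := by
  have hq : DifferentiableOn ℂ (fun z => deriv g z / g z) (ball c r) :=
    (hg.deriv isOpen_ball).div hg hne
  obtain ⟨L, hL⟩ := (hq.isExactOn_ball).with_val_at w (Real.log ‖g w‖ : ℂ)
  refine ⟨L, fun z hz => ((hL.2 z hz).differentiableAt).differentiableWithinAt, ?_, hL.1⟩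
  have hconst : ∀ z ∈ ball c r, g z * exp (-L z) = g w * exp (-L w) := by
    intro z hz
    refine (convex_ball c r).is_const_of_fderivWithin_eq_zero (𝕜 := ℂ)
      (f := fun z => g z * exp (-L z)) ?_ ?_ hz hw
    · intro y hy
      exact ((hg y hy).mul ((hL.2 y hy).differentiableAt.differentiableWithinAt.neg.cexp))
    · intro y hy
      have hgy := (hg.differentiableAt (isOpen_ball.mem_nhds hy)).hasDerivAt
      have hd : HasDerivAt (fun z => g z * exp (-L z)) 0 y := by
        convert! hgy.mul (hL.2 y hy).neg.cexp using 1
        field_simp [hne y hy]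
        ring
      rw [fderivWithin_of_isOpen isOpen_ball hy]
      ext
      simpa using hd.deriv
  intro z hz
  have h := congrArg norm (hconst z hz)
  simp only [norm_mul, norm_exp, neg_re, hL.1, ofReal_re] at h
  have hgw : 0 < ‖g w‖ := norm_pos_iff.2 (hne w hw)
  have hgz : 0 < ‖g z‖ := norm_pos_iff.2 (hne z hz)
  rw [Real.exp_neg, Real.exp_neg, Real.exp_log hgw, mul_inv_cancel₀ hgw.ne',
    ← div_eq_mul_inv, div_eq_one_iff_eq (Real.exp_pos _).ne'] at h
  rw [h, Real.log_exp]

/-- On a disc log|g| is the real part of a holomorphic L, and Re L ≥ 0. Harnack controls |L|, not Re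
L. Making L real at the point on the larger side of the inequality gives |L| = log|g| there, and at
the other point Re L ≤ |L| suffices. -/
theorem log_norm_mul_im_le {g : ℂ → ℂ} {ρ : ℝ} (hρ : 1 ≤ ρ)
    (hg : DifferentiableOn ℂ g (upperHalfDisc (4 * ρ)))
    (h1 : ∀ z ∈ upperHalfDisc (4 * ρ), 1 ≤ ‖g z‖) {z : ℂ} (hz : 0 < z.im) (hzρ : ‖z‖ ≤ ρ) :
    Real.log ‖g z‖ * z.im ≤ 56 * ρ ^ 2 * Real.log ‖g I‖ := by
  have hne : ∀ z ∈ upperHalfDisc (4 * ρ), g z ≠ 0 := fun z hz h => by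
    have := h1 z hz
    rw [h, norm_zero] at this
    linarith
  refine mul_im_le_of_harnack (N := fun z => Real.log ‖g z‖) hρ
    (fun w hw => Real.log_nonneg (h1 w hw)) (fun c r hsub w hw => ?_) hz hzρ
  have hc : c ∈ ball c r := mem_ball_self (nonempty_ball.1 ⟨w, hw⟩)
  have hd : 0 ≤ r - dist w c := sub_nonneg.2 (le_of_lt hw)
  have hsum : 0 ≤ r + dist w c := by linarith [dist_nonneg (x := w) (y := c)]
  constructor
  · obtain ⟨L, hL, hre, hval⟩ := exists_log_on_ball (hg.mono hsub) (fun v hv => hne v (hsub hv)) hc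
    have h := norm_mul_le_of_re_nonneg hL
      (fun v hv => by rw [hre v hv]; exact Real.log_nonneg (h1 v (hsub hv))) hw
    rw [hval, norm_real, Real.norm_of_nonneg (Real.log_nonneg (h1 c (hsub hc)))] at h
    refine le_trans ?_ h
    gcongr
    rw [← hre w hw]
    exact re_le_norm _
  · obtain ⟨L, hL, hre, hval⟩ := exists_log_on_ball (hg.mono hsub) (fun v hv => hne v (hsub hv)) hw
    have h := norm_center_mul_le_of_re_nonneg hL
      (fun v hv => by rw [hre v hv]; exact Real.log_nonneg (h1 v (hsub hv))) hw
    rw [hval, norm_real, Real.norm_of_nonneg (Real.log_nonneg (h1 w (hsub hw)))] at h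
    refine le_trans ?_ h
    gcongr
    rw [← hre c hc]
    exact re_le_norm _

/-! ### Functions with positive real part in the upper half of a disc -/

/-- A holomorphic function on the disc of radius `R` around `0` with nonnegative real part in the
upper half and the symmetry `f (conj z) = -conj (f z)`. -/
structure IsHerglotzOnDisc (R : ℝ) (f : ℂ → ℂ) : Prop where
  differentiableOn : DifferentiableOn ℂ f (ball 0 R)
  re_nonneg : ∀ z ∈ upperHalfDisc R, 0 ≤ (f z).re
  symm : ∀ z ∈ ball (0 : ℂ) R, f (star z) = -star (f z)

namespace IsHerglotzOnDisc

variable {f : ℂ → ℂ} {ρ : ℝ}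

theorem norm_mul_abs_im_le (hf : IsHerglotzOnDisc (4 * ρ) f) (hρ : 1 ≤ ρ) {z : ℂ}
    (hz : ‖z‖ ≤ ρ) : ‖f z‖ * |z.im| ≤ 56 * ρ ^ 2 * ‖f I‖ := by
  have hup : ∀ w : ℂ, 0 < w.im → ‖w‖ ≤ ρ → ‖f w‖ * w.im ≤ 56 * ρ ^ 2 * ‖f I‖ := fun w hw hwρ =>
    norm_mul_im_le_of_re_nonneg hρ (hf.differentiableOn.mono inter_subset_right) hf.re_nonneg hw hwρ
  rcases lt_trichotomy z.im 0 with h | h | h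
  · have hs : ‖f (star z)‖ = ‖f z‖ := by
      rw [hf.symm z (by rw [mem_ball, dist_zero_right]; linarith), norm_neg, norm_star]
    have := hup (star z) (by simpa using h) (by simpa using hz)
    rw [hs] at this
    rw [abs_of_neg h]
    simpa using this
  · rw [h, abs_zero, mul_zero]
    positivity
  · rw [abs_of_pos h]
    exact hup z h hz

/-- The factor z² - ρ² has modulus exactly 2ρ|Im z| on the circle |z| = ρ and so cancels the 1/|Im
z| singularity of the Harnack bound. The maximum principle then carries the estimate inside, where
the factor is at least 3ρ²/4. -/
theorem norm_le (hf : IsHerglotzOnDisc (4 * ρ) f) (hρ : 1 ≤ ρ) {z : ℂ} (hz : ‖z‖ ≤ ρ / 2) :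
    ‖f z‖ ≤ 150 * ρ * ‖f I‖ := by
  have hd : DiffContOnCl ℂ (fun z => f z * (z ^ 2 - (ρ : ℂ) ^ 2)) (ball 0 ρ) := by
    apply DifferentiableOn.diffContOnCl
    refine (hf.differentiableOn.mono fun w hw => ?_).mul (by fun_prop)
    have := closure_ball_subset_closedBall hw
    rw [mem_closedBall, dist_zero_right] at this
    rw [mem_ball, dist_zero_right]
    linarith
  have hb : ∀ w ∈ frontier (ball (0 : ℂ) ρ),
      ‖f w * (w ^ 2 - (ρ : ℂ) ^ 2)‖ ≤ 112 * ρ ^ 3 * ‖f I‖ := by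
    intro w hw
    rw [frontier_ball _ (by linarith : ρ ≠ 0), mem_sphere, dist_zero_right] at hw
    have hsq : ‖w ^ 2 - (ρ : ℂ) ^ 2‖ = 2 * ρ * |w.im| := by
      have h1 : (ρ : ℂ) ^ 2 = w * star w := by
        rw [star_def, mul_conj, normSq_eq_norm_sq, hw]
        push_cast; rfl
      have h2 : w ^ 2 - (ρ : ℂ) ^ 2 = w * ((2 * w.im : ℝ) * I) := by
        rw [h1, pow_two, ← mul_sub, star_def, sub_conj]
      rw [h2, norm_mul, norm_mul, norm_I, hw, norm_real, Real.norm_eq_abs, abs_mul]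
      norm_num
      ring
    rw [norm_mul, hsq]
    have := hf.norm_mul_abs_im_le hρ hw.le
    nlinarith
  have hzc : z ∈ closure (ball (0 : ℂ) ρ) := by
    apply subset_closure
    rw [mem_ball, dist_zero_right]
    linarith
  have h := norm_le_of_forall_mem_frontier_norm_le isBounded_ball hd hb hzc
  have hlow : 3 / 4 * ρ ^ 2 ≤ ‖z ^ 2 - (ρ : ℂ) ^ 2‖ := by
    have h1 : ‖(ρ : ℂ) ^ 2‖ - ‖z ^ 2‖ ≤ ‖z ^ 2 - (ρ : ℂ) ^ 2‖ := by
      rw [norm_sub_rev]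
      exact norm_sub_norm_le _ _
    rw [norm_pow, norm_pow, norm_real, Real.norm_of_nonneg (by linarith)] at h1
    nlinarith [norm_nonneg z]
  rw [norm_mul] at h
  have h2 : ‖f z‖ * (3 / 4 * ρ ^ 2) ≤ 112 * ρ ^ 3 * ‖f I‖ :=
    (mul_le_mul_of_nonneg_left hlow (norm_nonneg _)).trans h
  have h3 : ρ ^ 2 * ‖f z‖ ≤ ρ ^ 2 * (150 * ρ * ‖f I‖) := by
    nlinarith [mul_nonneg (pow_nonneg (by linarith : 0 ≤ ρ) 3) (norm_nonneg (f I))]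
  exact le_of_mul_le_mul_left h3 (by positivity)

/-- On large discs such a function is nearly affine. -/
theorem norm_sub_affine_le (hf : IsHerglotzOnDisc (4 * ρ) f) (hρ : 4 ≤ ρ) {z : ℂ}
    (hz : ‖z‖ < ρ / 2) :
    ‖f z - ((f I + f (-I)) / 2 - I * z * ((f I - f (-I)) / 2))‖ ≤
      2400 * (1 + ‖z‖) ^ 2 * ‖f I‖ / ρ := by
  -- M grows only linearly in ρ, whereas the second-order Schwarz lemma bounds the remainder after
  -- the affine part by a multiple of M/ρ². The remainder is therefore O(1/ρ).
  set M := 150 * ρ * ‖f I‖ with hM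
  have hM0 : 0 ≤ M := by positivity
  have hsub : ball (0 : ℂ) (ρ / 2) ⊆ ball 0 (4 * ρ) := ball_subset_ball (by linarith)
  have hd := hf.differentiableOn.mono hsub
  have hb : ∀ w ∈ ball (0 : ℂ) (ρ / 2), ‖f w‖ ≤ M := fun w hw =>
    hf.norm_le (by linarith) (by rw [mem_ball, dist_zero_right] at hw; exact hw.le)
  have h0 : (0 : ℂ) ∈ ball (0 : ℂ) (ρ / 2) := mem_ball_self (by linarith)
  have hmaps : MapsTo f (ball 0 (ρ / 2)) (closedBall (f 0) (2 * M)) := fun w hw => by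
    rw [mem_closedBall, dist_eq_norm]
    linarith [norm_sub_le (f w) (f 0), hb w hw, hb 0 h0]
  have hderiv := norm_deriv_le_div_of_mapsTo_ball hd hmaps (by linarith)
  set g : ℂ → ℂ := fun w => f w - deriv f 0 * w with hg
  have hgd : DifferentiableOn ℂ g (ball 0 (ρ / 2)) := hd.sub (by fun_prop)
  have hgmaps : MapsTo g (ball 0 (ρ / 2)) (closedBall (g 0) (4 * M)) := fun w hw => by
    have h1 := hmaps hw
    rw [mem_closedBall, dist_eq_norm] at h1 ⊢
    have h2 : ‖deriv f 0 * w‖ ≤ 2 * M := by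
      rw [norm_mul]
      rw [mem_ball, dist_zero_right] at hw
      calc ‖deriv f 0‖ * ‖w‖ ≤ 2 * M / (ρ / 2) * (ρ / 2) := by gcongr
        _ = 2 * M := by field_simp
    have h3 : g w - g 0 = (f w - f 0) - deriv f 0 * w := by simp only [hg]; ring
    rw [h3]
    linarith [norm_sub_le (f w - f 0) (deriv f 0 * w)]
  have hlittle : (fun w => g w - g 0) =o[𝓝 0] fun w : ℂ => ‖w - 0‖ ^ 1 := by
    have h1 := ((hd.differentiableAt (isOpen_ball.mem_nhds h0)).hasDerivAt).isLittleO
    simp only [pow_one]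
    refine (h1.norm_right).congr_left fun w => ?_
    simp only [hg, smul_eq_mul]
    ring
  have herr : ∀ w : ℂ, ‖w‖ < ρ / 2 → ‖f w - (f 0 + deriv f 0 * w)‖ ≤ 16 * M * ‖w‖ ^ 2 / ρ ^ 2 := by
    intro w hw
    have h := dist_le_mul_div_pow_of_mapsTo_ball_of_isLittleO hgd hgmaps hlittle
      (z := w) (by rwa [mem_ball, dist_zero_right])
    rw [dist_eq_norm, dist_zero_right] at h
    have h3 : g w - g 0 = f w - (f 0 + deriv f 0 * w) := by simp only [hg]; ring
    rw [h3] at h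
    refine h.trans_eq ?_
    simp only [div_pow]
    field_simp
    norm_num
    ring
  have e1 := herr z hz
  have e2 := herr I (by rw [norm_I]; linarith)
  have e3 := herr (-I) (by rw [norm_neg, norm_I]; linarith)
  rw [norm_I] at e2
  rw [norm_neg, norm_I] at e3
  set E1 := f z - (f 0 + deriv f 0 * z)
  set E2 := f I - (f 0 + deriv f 0 * I) with hE2
  set E3 := f (-I) - (f 0 + deriv f 0 * -I) with hE3
  -- The subtracted expression is the affine interpolant of f at ±i. It reproduces affine functions,
  -- so only the Taylor remainders at z, i and -i survive.
  have hid : f z - ((f I + f (-I)) / 2 - I * z * ((f I - f (-I)) / 2)) =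
      E1 - ((E2 + E3) / 2 - I * z * ((E2 - E3) / 2)) := by
    simp only [E1, E2, E3]
    linear_combination (deriv f 0 * z) * I_sq
  rw [hid]
  have hadd : ‖(E2 + E3) / 2‖ ≤ 16 * M * 1 ^ 2 / ρ ^ 2 := by
    rw [norm_div, RCLike.norm_ofNat]
    linarith [norm_add_le E2 E3]
  have hsub' : ‖(E2 - E3) / 2‖ ≤ 16 * M * 1 ^ 2 / ρ ^ 2 := by
    rw [norm_div, RCLike.norm_ofNat]
    linarith [norm_sub_le E2 E3]
  have hmul : ‖I * z * ((E2 - E3) / 2)‖ ≤ ‖z‖ * (16 * M * 1 ^ 2 / ρ ^ 2) := by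
    rw [norm_mul, norm_mul, norm_I, one_mul]
    gcongr
  have htot : ‖E1 - ((E2 + E3) / 2 - I * z * ((E2 - E3) / 2))‖ ≤
      16 * M / ρ ^ 2 * (‖z‖ ^ 2 + 1 + ‖z‖) := by
    have t1 := norm_sub_le E1 ((E2 + E3) / 2 - I * z * ((E2 - E3) / 2))
    have t2 := norm_sub_le ((E2 + E3) / 2) (I * z * ((E2 - E3) / 2))
    have : 16 * M / ρ ^ 2 * (‖z‖ ^ 2 + 1 + ‖z‖) =
      16 * M * ‖z‖ ^ 2 / ρ ^ 2 + (16 * M * 1 ^ 2 / ρ ^ 2 + ‖z‖ * (16 * M * 1 ^ 2 / ρ ^ 2)) := by ring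
    linarith
  refine htot.trans ?_
  calc 16 * M / ρ ^ 2 * (‖z‖ ^ 2 + 1 + ‖z‖) ≤ 16 * M / ρ ^ 2 * (1 + ‖z‖) ^ 2 := by
        gcongr
        nlinarith [norm_nonneg z]
    _ = 2400 * (1 + ‖z‖) ^ 2 * ‖f I‖ / ρ := by
        rw [hM]
        field_simp
        ring

end IsHerglotzOnDisc

/-! ### Removing a singular bound near the real axis -/

/-- An entire function bounded by `exp (K / |Im z|)` off the real axis is bounded near the origin
in terms of `K` only. -/
theorem norm_le_exp_of_norm_le_exp_div_im {g : ℂ → ℂ} (hg : Differentiable ℂ g) {K R : ℝ}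
    (hK : 0 < K) (hR : 0 < R)
    (hb : ∀ z : ℂ, ‖z‖ ≤ R → z.im ≠ 0 → ‖g z‖ ≤ Real.exp (K / |z.im|)) {z : ℂ}
    (hz : ‖z‖ ≤ R / 4) : ‖g z‖ ≤ Real.exp (16 * K / R) := by
  obtain ⟨B, hB⟩ := (isCompact_closedBall (0 : ℂ) R).exists_bound_of_continuousOn
    hg.continuous.continuousOn
  set U := max B 1 with hU
  have hU1 : 1 ≤ U := le_max_right _ _
  have hUB : ∀ w : ℂ, ‖w‖ ≤ R → ‖g w‖ ≤ U := fun w hw =>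
    (hB w (by simpa using hw)).trans (le_max_left _ _)
  -- The uncontrolled bound U enters only through ε, chosen so that U ≤ K/ε; hence it disappears
  -- from the conclusion.
  set ε := min (R / 4) (K / U) with hε
  have hε0 : 0 < ε := lt_min (by linarith) (by positivity)
  have hεR : ε ≤ R / 4 := min_le_left _ _
  have hεK : U ≤ K / ε := by
    rw [le_div_iff₀ hε0, mul_comm, ← le_div_iff₀ (by linarith)]
    exact min_le_right _ _
  set r := R - ε with hr
  -- On the boundary of this square R - |Re w| = |Im w| + ε, so the distance to the nearer of ±R is
  -- comparable to |Im w| + ε.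
  set V : Set ℂ := {w | |w.re| + |w.im| < r} with hV
  have hVo : IsOpen V := isOpen_lt (by fun_prop) continuous_const
  have hVcl : closure V ⊆ {w | |w.re| + |w.im| ≤ r} :=
    closure_minimal (fun w (hw : |w.re| + |w.im| < r) => hw.le) (isClosed_le (by fun_prop) continuous_const)
  have hnorm : ∀ w ∈ closure V, ‖w‖ ≤ r := fun w hw =>
    (norm_le_abs_re_add_abs_im w).trans (hVcl hw)
  have hVb : Bornology.IsBounded V :=
    isBounded_ball.subset (t := ball (0 : ℂ) (r + 1)) fun w hw => by
      rw [mem_ball, dist_zero_right]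
      linarith [hnorm w (subset_closure hw)]
  have hre : ∀ w ∈ closure V, |w.re| < R := fun w hw => by
    have h1 : |w.re| + |w.im| ≤ r := hVcl hw
    linarith [abs_nonneg w.im]
  have hne1 : ∀ w ∈ closure V, (R : ℂ) - w ≠ 0 := fun w hw h => by
    have h1 := congrArg re h
    simp only [sub_re, ofReal_re, zero_re] at h1
    have h2 := (abs_lt.1 (hre w hw)).2
    linarith
  have hne2 : ∀ w ∈ closure V, (R : ℂ) + w ≠ 0 := fun w hw h => by
    have h1 := congrArg re h
    simp only [add_re, ofReal_re, zero_re] at h1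
    have h2 := (abs_lt.1 (hre w hw)).1
    linarith
  -- On the boundary the real part of 1/(R-w) + 1/(R+w) is at least 1/(2(|Im w| + ε)). The damping
  -- exponent is then at least 2K/(|Im w| + ε), which dominates K/|Im w| if |Im w| ≥ ε and K/ε
  -- otherwise, so |F| ≤ 1.
  set F : ℂ → ℂ := fun w =>
    g w * exp (-(4 * K : ℝ) * (((R : ℂ) - w)⁻¹ + ((R : ℂ) + w)⁻¹)) with hF
  have hFd : DiffContOnCl ℂ F V := by
    apply DifferentiableOn.diffContOnCl
    refine hg.differentiableOn.mul (DifferentiableOn.cexp ?_)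
    refine DifferentiableOn.const_mul (DifferentiableOn.add ?_ ?_) _
    · exact DifferentiableOn.inv (by fun_prop) hne1
    · exact DifferentiableOn.inv (by fun_prop) hne2
  have hFn : ∀ w, ‖F w‖ = ‖g w‖ *
      Real.exp (-(4 * K) * ((((R : ℂ) - w)⁻¹).re + (((R : ℂ) + w)⁻¹).re)) := fun w => by
    simp only [hF]
    rw [norm_mul, norm_exp, ← ofReal_neg, re_ofReal_mul, add_re]
  have hinv : ∀ s t : ℝ, 0 < s → ((⟨s, t⟩ : ℂ)⁻¹).re = s / (s ^ 2 + t ^ 2) := fun s t hs => by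
    rw [inv_re, normSq_apply]
    ring_nf
  have hsub : ∀ w : ℂ, (R : ℂ) - w = ⟨R - w.re, -w.im⟩ := fun w => by
    apply Complex.ext <;> simp
  have hadd : ∀ w : ℂ, (R : ℂ) + w = ⟨R + w.re, w.im⟩ := fun w => by
    apply Complex.ext <;> simp
  have hFb : ∀ w ∈ frontier V, ‖F w‖ ≤ 1 := by
    intro w hw
    have hwc : w ∈ closure V := frontier_subset_closure hw
    have hwr : |w.re| + |w.im| = r := by
      refine le_antisymm (hVcl hwc) (not_lt.1 fun h => ?_)
      rw [hVo.frontier_eq] at hw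
      exact hw.2 h
    have hx := abs_lt.1 (hre w hwc)
    have hsum : 1 / (2 * (|w.im| + ε)) ≤ (((R : ℂ) - w)⁻¹).re + (((R : ℂ) + w)⁻¹).re := by
      rw [hsub, hadd, hinv _ _ (by linarith), hinv _ _ (by linarith)]
      have key : ∀ s : ℝ, s = |w.im| + ε → 1 / (2 * (|w.im| + ε)) ≤ s / (s ^ 2 + w.im ^ 2) := by
        intro s hs
        have hspos : 0 < s := by rw [hs]; positivity
        rw [← hs, div_le_div_iff₀ (by positivity) (by positivity)]
        have : w.im ^ 2 ≤ s ^ 2 := by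
          rw [← sq_abs w.im]
          have h : |w.im| ≤ s := by linarith
          gcongr
        nlinarith
      have p1 : 0 ≤ (R - w.re) / ((R - w.re) ^ 2 + (-w.im) ^ 2) := by
        have : 0 < R - w.re := by linarith
        positivity
      have p2 : 0 ≤ (R + w.re) / ((R + w.re) ^ 2 + w.im ^ 2) := by
        have : 0 < R + w.re := by linarith
        positivity
      rcases le_total 0 w.re with h | h
      · have := key (R - w.re) (by rw [abs_of_nonneg h] at hwr; linarith)
        rw [neg_sq] at p1 ⊢
        linarith
      · have := key (R + w.re) (by rw [abs_of_nonpos h] at hwr; linarith)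
        linarith
    have hwR : ‖w‖ ≤ R := by linarith [hnorm w hwc]
    have hgw : ‖g w‖ ≤ Real.exp (4 * K * (1 / (2 * (|w.im| + ε)))) := by
      rcases lt_or_ge |w.im| ε with h | h
      · refine (hUB w hwR).trans (le_trans ?_ (Real.add_one_le_exp _))
        have : K / ε ≤ 4 * K * (1 / (2 * (|w.im| + ε))) := by
          rw [mul_one_div, div_le_div_iff₀ hε0 (by positivity)]
          nlinarith
        linarith
      · have hpos : 0 < |w.im| := by linarith
        refine (hb w hwR (abs_pos.1 hpos)).trans (Real.exp_le_exp.2 ?_)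
        rw [mul_one_div, div_le_div_iff₀ hpos (by positivity)]
        nlinarith
    rw [hFn]
    calc ‖g w‖ * Real.exp (-(4 * K) * ((((R : ℂ) - w)⁻¹).re + (((R : ℂ) + w)⁻¹).re))
        ≤ Real.exp (4 * K * (1 / (2 * (|w.im| + ε)))) *
          Real.exp (-(4 * K) * (1 / (2 * (|w.im| + ε)))) := by
          refine mul_le_mul hgw (Real.exp_le_exp.2 ?_) (Real.exp_pos _).le (Real.exp_pos _).le
          nlinarith
      _ = 1 := by rw [← Real.exp_add]; simp
  have hzV : z ∈ V := by
    have h1 := abs_re_le_norm z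
    have h2 := abs_im_le_norm z
    simp only [hV, mem_ofPred_eq]
    linarith
  have h := norm_le_of_forall_mem_frontier_norm_le hVb hFd hFb (subset_closure hzV)
  rw [hFn] at h
  have hup : (((R : ℂ) - z)⁻¹).re + (((R : ℂ) + z)⁻¹).re ≤ 4 / R := by
    have b1 : (((R : ℂ) - z)⁻¹).re ≤ 2 / R := by
      refine (re_le_norm _).trans ?_
      rw [norm_inv, inv_eq_one_div, div_le_div_iff₀ (norm_pos_iff.2 (hne1 z (subset_closure hzV))) hR]
      have : R - ‖z‖ ≤ ‖(R : ℂ) - z‖ := by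
        simpa [abs_of_pos hR] using norm_sub_norm_le (R : ℂ) z
      linarith
    have b2 : (((R : ℂ) + z)⁻¹).re ≤ 2 / R := by
      refine (re_le_norm _).trans ?_
      rw [norm_inv, inv_eq_one_div, div_le_div_iff₀ (norm_pos_iff.2 (hne2 z (subset_closure hzV))) hR]
      have : R - ‖z‖ ≤ ‖(R : ℂ) + z‖ := by
        simpa [abs_of_pos hR] using norm_sub_norm_le (R : ℂ) (-z)
      linarith
    calc _ ≤ 2 / R + 2 / R := add_le_add b1 b2
      _ = 4 / R := by ring
  set s := (((R : ℂ) - z)⁻¹).re + (((R : ℂ) + z)⁻¹).re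
  calc ‖g z‖ = ‖g z‖ * Real.exp (-(4 * K) * s) * Real.exp (4 * K * s) := by
        rw [mul_assoc, ← Real.exp_add]; simp
    _ ≤ 1 * Real.exp (4 * K * s) := by gcongr
    _ ≤ Real.exp (16 * K / R) := by
        rw [one_mul, Real.exp_le_exp]
        calc 4 * K * s ≤ 4 * K * (4 / R) := by gcongr
          _ = 16 * K / R := by ring

/-! ### Contractive matrices -/

/-- Multiplying by X⁻¹ = adj X on the left and by its adjoint on the right turns j ≥ XjX* into
X⁻¹jX⁻* ≥ j. The three inequalities are diagonal entries of these two forms. -/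
theorem jContractive_entries {X : Mat2} (hdet : X.det = 1)
    (h : (jMat - X * jMat * Xᴴ).PosSemidef) :
    1 + normSq (X 0 1) ≤ normSq (X 0 0) ∧ 1 + normSq (X 1 0) ≤ normSq (X 0 0) ∧
      normSq (X 1 1) ≤ 1 + normSq (X 0 1) := by
  have hadj : X.adjugate * X = 1 := by rw [Matrix.adjugate_mul, hdet, one_smul]
  have hadj' : Xᴴ * X.adjugateᴴ = 1 := by
    rw [← Matrix.conjTranspose_mul, hadj, Matrix.conjTranspose_one]
  have h' : (X.adjugate * jMat * X.adjugateᴴ - jMat).PosSemidef := by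
    have := h.mul_mul_conjTranspose_same X.adjugate
    convert! this using 1
    rw [mul_sub, sub_mul]
    congr 1
    calc jMat = (X.adjugate * X) * jMat * (Xᴴ * X.adjugateᴴ) := by rw [hadj, hadj']; simp
      _ = _ := by simp only [mul_assoc]
  have e1 := (Complex.le_def.1 (h.diag_nonneg (i := 0))).1
  have e2 := (Complex.le_def.1 (h'.diag_nonneg (i := 1))).1
  have e3 := (Complex.le_def.1 (h'.diag_nonneg (i := 0))).1
  simp [jMat, Matrix.mul_apply, Fin.sum_univ_two, Matrix.adjugate_fin_two,
    Matrix.vecMul, dotProduct] at e1 e2 e3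
  simp only [normSq_apply]
  refine ⟨by linarith, by linarith, by linarith⟩

/-- The identity 2(j - XjX*) = (1-X)j(1+X)* + (1+X)j(1-X)* makes the Cayley transform (1+X)⁻¹(1-X)j
have nonnegative real part. Using the adjugate of 1+X, with det(1+X) = 2 + tr X, avoids assuming
invertibility. The test vector is (1, w). -/
theorem cayley_numerator_posSemidef {X : Mat2} (hdet : X.det = 1)
    (h : (jMat - X * jMat * Xᴴ).PosSemidef) (w : ℂ) (hw : ‖w‖ = 1) :
    0 ≤ ((X 0 0 - X 1 1 - w * X 0 1 + star w * X 1 0) * star (2 + X 0 0 + X 1 1)).re := by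
  set P := (1 + X).adjugate with hP
  set t : ℂ := 2 + X 0 0 + X 1 1 with ht
  have hdet' : X 0 0 * X 1 1 - X 0 1 * X 1 0 = 1 := by rw [← Matrix.det_fin_two, hdet]
  set V : Mat2 := !![X 0 0 - X 1 1, -2 * X 0 1; 2 * X 1 0, X 0 0 - X 1 1] with hV
  have hP1 : P * (1 + X) = t • 1 := by
    rw [hP, Matrix.adjugate_mul]
    congr 1
    rw [Matrix.det_fin_two]
    simp
    linear_combination hdet'
  have hP2 : P * (1 - X) * jMat = V := by
    rw [hP, Matrix.adjugate_fin_two]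
    ext i k
    fin_cases i <;> fin_cases k <;>
      simp [jMat, V, Matrix.mul_apply, Fin.sum_univ_two, Matrix.vecMul, dotProduct]
    · linear_combination hdet'
    · ring
    · ring
    · linear_combination -hdet'
  have hexp : (2 : ℂ) • (jMat - X * jMat * Xᴴ) =
      (1 - X) * jMat * (1 + X)ᴴ + (1 + X) * jMat * (1 - X)ᴴ := by
    rw [Matrix.conjTranspose_add, Matrix.conjTranspose_sub, Matrix.conjTranspose_one, two_smul]
    noncomm_ring
  have hj : jMatᴴ = jMat := by
    ext i k
    fin_cases i <;> fin_cases k <;> simp [jMat]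
  have hK : (2 : ℂ) • (P * (jMat - X * jMat * Xᴴ) * Pᴴ) = star t • V + t • Vᴴ := by
    rw [← Matrix.smul_mul, ← Matrix.mul_smul, hexp]
    calc P * ((1 - X) * jMat * (1 + X)ᴴ + (1 + X) * jMat * (1 - X)ᴴ) * Pᴴ
        = (P * (1 - X) * jMat) * (P * (1 + X))ᴴ +
          (P * (1 + X)) * (P * (1 - X) * jMat)ᴴ := by
          simp only [Matrix.conjTranspose_mul, hj]
          noncomm_ring
      _ = _ := by
          rw [hP1, hP2]
          simp
  have hpsd : (star t • V + t • Vᴴ).PosSemidef := by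
    rw [← hK]
    exact (h.mul_mul_conjTranspose_same P).smul (by norm_num)
  have hq := (Complex.le_def.1 (hpsd.dotProduct_mulVec_nonneg ![1, w])).1
  have hw2 : w.re * w.re + w.im * w.im = 1 := by
    rw [← normSq_apply, normSq_eq_norm_sq, hw, one_pow]
  simp [V, dotProduct, Matrix.mulVec, Fin.sum_univ_two] at hq ⊢
  linear_combination (1 / 4) * hq + ((t.re * ((X 0 0).re - (X 1 1).re) +
    t.im * ((X 0 0).im - (X 1 1).im)) / 2) * hw2

/-! ### Inner functions in Arov gauge -/

/-- Two entire functions that agree on the real axis are equal. -/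
theorem eq_of_eq_on_real {f g : ℂ → ℂ} (hf : Differentiable ℂ f) (hg : Differentiable ℂ g)
    (h : ∀ x : ℝ, f x = g x) : f = g := by
  refine AnalyticOnNhd.eq_of_frequently_eq (z₀ := 0) (fun z _ => hf.analyticAt z)
    (fun z _ => hg.analyticAt z) ?_
  have hlim : Tendsto (fun x : ℝ => (x : ℂ)) (𝓝[≠] 0) (𝓝[≠] 0) := by
    refine tendsto_nhdsWithin_iff.2 ⟨?_, ?_⟩
    · simpa using (continuous_ofReal.tendsto 0).mono_left nhdsWithin_le_nhds
    · filter_upwards [self_mem_nhdsWithin] with x hx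
      simpa using hx
  exact hlim.frequently (Eventually.of_forall h).frequently

theorem differentiable_star_comp_star {f : ℂ → ℂ} (hf : Differentiable ℂ f) :
    Differentiable ℂ fun z => star (f (star z)) := fun z => by
  simpa [Function.comp_def] using (hf (star z)).conj_conj

/-- An entire `j`-inner function of determinant one, normalized at `i`. -/
structure IsArovInner (C : ℂ → Mat2) : Prop where
  inner : IsJInner jMat C
  det : ∀ z, (C z).det = 1
  zero : C I 0 1 = 0
  pos : 0 < C I 0 0

/-- The logarithm of the upper diagonal entry at `i`. -/
def mass (C : ℂ → Mat2) : ℝ := Real.log ‖C I 0 0‖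

namespace IsArovInner

variable {C : ℂ → Mat2}

theorem normSq_le (hC : IsArovInner C) {z : ℂ} (hz : 0 < z.im) (i k : Fin 2) :
    normSq (C z i k) ≤ normSq (C z 0 0) := by
  obtain ⟨h1, h2, h3⟩ := jContractive_entries (hC.det z) (hC.inner.contractive z hz)
  fin_cases i <;> fin_cases k <;> simp <;> linarith

theorem norm_le (hC : IsArovInner C) {z : ℂ} (hz : 0 < z.im) (i k : Fin 2) :
    ‖C z i k‖ ≤ ‖C z 0 0‖ := by
  have := hC.normSq_le hz i k
  rw [normSq_eq_norm_sq, normSq_eq_norm_sq] at this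
  exact (sq_le_sq₀ (norm_nonneg _) (norm_nonneg _)).1 this

theorem one_le_norm (hC : IsArovInner C) {z : ℂ} (hz : 0 < z.im) : 1 ≤ ‖C z 0 0‖ := by
  obtain ⟨h1, -, -⟩ := jContractive_entries (hC.det z) (hC.inner.contractive z hz)
  have h2 := normSq_nonneg (C z 0 1)
  rw [normSq_eq_norm_sq (C z 0 0)] at h1
  have h3 : (1 : ℝ) ^ 2 ≤ ‖C z 0 0‖ ^ 2 := by linarith
  exact (sq_le_sq₀ zero_le_one (norm_nonneg _)).1 h3

theorem mass_nonneg (hC : IsArovInner C) : 0 ≤ mass C :=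
  Real.log_nonneg (hC.one_le_norm (by simp))

/-- From CjC* = j on the real line one gets C* = jC⁻¹j, and the inverse is the adjugate since det C
= 1. -/
theorem conjTranspose_real (hC : IsArovInner C) (x : ℝ) :
    star (C x 0 0) = C x 1 1 ∧ star (C x 0 1) = C x 1 0 := by
  have hu := hC.inner.unitary x
  have hadj : (C x).adjugate * C x = 1 := by rw [Matrix.adjugate_mul, hC.det, one_smul]
  have hjj : jMat * jMat = 1 := by
    ext i k
    fin_cases i <;> fin_cases k <;> simp [jMat]
  have h : (C x)ᴴ = jMat * (C x).adjugate * jMat := by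
    have h1 : C x * jMat * (C x)ᴴ = jMat := (sub_eq_zero.1 hu).symm
    calc (C x)ᴴ = jMat * ((C x).adjugate * C x) * jMat * (C x)ᴴ := by
          rw [hadj, mul_one, hjj, one_mul]
      _ = jMat * (C x).adjugate * (C x * jMat * (C x)ᴴ) := by simp only [mul_assoc]
      _ = _ := by rw [h1]
  have h00 := congrFun (congrFun h 0) 0
  have h01 := congrFun (congrFun h 1) 0
  rw [Matrix.adjugate_fin_two] at h00 h01
  simp [jMat, Matrix.mul_apply, Fin.sum_univ_two] at h00 h01
  exact ⟨by simpa using h00, by simpa using h01⟩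

theorem star_star_zero_zero (hC : IsArovInner C) (z : ℂ) : star (C (star z) 0 0) = C z 1 1 := by
  refine congrFun (eq_of_eq_on_real (differentiable_star_comp_star (hC.inner.entire 0 0))
    (hC.inner.entire 1 1) fun x => ?_) z
  simpa using (hC.conjTranspose_real x).1

theorem star_star_zero_one (hC : IsArovInner C) (z : ℂ) : star (C (star z) 0 1) = C z 1 0 := by
  refine congrFun (eq_of_eq_on_real (differentiable_star_comp_star (hC.inner.entire 0 1))
    (hC.inner.entire 1 0) fun x => ?_) z
  simpa using (hC.conjTranspose_real x).2

/-- The reflection principle: it transfers entrywise bounds from the upper to the lower half plane,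
with the entries permuted. -/
theorem apply_star (hC : IsArovInner C) (z : ℂ) :
    C (star z) 0 0 = star (C z 1 1) ∧ C (star z) 1 1 = star (C z 0 0) ∧
      C (star z) 0 1 = star (C z 1 0) ∧ C (star z) 1 0 = star (C z 0 1) := by
  refine ⟨?_, ?_, ?_, ?_⟩
  · rw [← hC.star_star_zero_zero z, star_star]
  · rw [← hC.star_star_zero_zero (star z), star_star]
  · rw [← hC.star_star_zero_one z, star_star]
  · rw [← hC.star_star_zero_one (star z), star_star]

/-- In the upper half plane the (0,0) entry dominates all others and has modulus at least 1. Harnack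
for its log-modulus, whose value at i is the mass, gives the bound; reflection gives the lower half
plane. -/
theorem norm_le_exp_div_im (hC : IsArovInner C) {ρ : ℝ} (hρ : 1 ≤ ρ) {z : ℂ} (hz : ‖z‖ ≤ ρ)
    (him : z.im ≠ 0) (i k : Fin 2) : ‖C z i k‖ ≤ Real.exp (56 * ρ ^ 2 * mass C / |z.im|) := by
  have hup : ∀ w : ℂ, 0 < w.im → ‖w‖ ≤ ρ → ∀ i k : Fin 2,
      ‖C w i k‖ ≤ Real.exp (56 * ρ ^ 2 * mass C / w.im) := by
    intro w hw hwρ i k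
    refine (hC.norm_le hw i k).trans ?_
    have h := log_norm_mul_im_le hρ (hC.inner.entire 0 0).differentiableOn
      (fun v hv => hC.one_le_norm hv.1) hw hwρ
    rw [← le_div_iff₀ hw] at h
    exact (Real.log_le_iff_le_exp (by linarith [hC.one_le_norm hw])).1 h
  rcases lt_or_gt_of_ne him with h | h
  · have hs := hup (star z) (by simpa using h) (by simpa using hz)
    have him' : (star z).im = |z.im| := by rw [abs_of_neg h]; simp
    obtain ⟨h1, h2, h3, h4⟩ := hC.apply_star z
    rw [him'] at hs
    fin_cases i <;> fin_cases k
    · have h := hs 1 1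
      rw [h2, norm_star] at h
      exact h
    · have h := hs 1 0
      rw [h4, norm_star] at h
      exact h
    · have h := hs 0 1
      rw [h3, norm_star] at h
      exact h
    · have h := hs 0 0
      rw [h1, norm_star] at h
      exact h
  · rw [abs_of_pos h]
    exact hup z h hz i k

/-- The singularity at the real axis is removed, leaving a bound through the mass alone. Replacing
the mass by mass + 1 keeps the constant K positive. -/
theorem norm_le_exp (hC : IsArovInner C) {ρ : ℝ} (hρ : 1 ≤ ρ) {z : ℂ} (hz : ‖z‖ ≤ ρ / 4)
    (i k : Fin 2) : ‖C z i k‖ ≤ Real.exp (896 * ρ * (mass C + 1)) := by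
  have hm := hC.mass_nonneg
  have h := norm_le_exp_of_norm_le_exp_div_im (hC.inner.entire i k)
    (K := 56 * ρ ^ 2 * (mass C + 1)) (R := ρ) (by positivity) (by linarith)
    (fun w hw him => (hC.norm_le_exp_div_im hρ hw him i k).trans
      (Real.exp_le_exp.2 (by gcongr; linarith))) hz
  refine h.trans_eq ?_
  congr 1
  field_simp
  norm_num

end IsArovInner

/-! ### The Cayley transform of an inner function -/

/-- The value at the vector `(1, w) / √2` of the quadratic form of the Cayley transform
`(1 + C)⁻¹ (1 - C) j`. -/
def cayley (C : ℂ → Mat2) (w z : ℂ) : ℂ :=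
  (C z 0 0 - C z 1 1 - w * C z 0 1 + star w * C z 1 0) / (2 + C z 0 0 + C z 1 1)

/-- On the disc of radius `R` the values of `C` are close to the identity matrix. -/
def NearOne (R : ℝ) (C : ℂ → Mat2) : Prop :=
  ∀ z ∈ ball (0 : ℂ) R, ∀ i k, ‖C z i k - (1 : Mat2) i k‖ ≤ 1 / 10

theorem NearOne.norm_trace_sub_le {C : ℂ → Mat2} {R : ℝ} (h : NearOne R C) {z : ℂ}
    (hz : z ∈ ball (0 : ℂ) R) : ‖(2 + C z 0 0 + C z 1 1) - 4‖ ≤ 1 / 5 := by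
  have h0 := h z hz 0 0
  have h1 := h z hz 1 1
  rw [Matrix.one_apply_eq] at h0 h1
  have : (2 + C z 0 0 + C z 1 1) - 4 = (C z 0 0 - 1) + (C z 1 1 - 1) := by ring
  rw [this]
  linarith [norm_add_le (C z 0 0 - 1) (C z 1 1 - 1)]

theorem NearOne.norm_trace_le {C : ℂ → Mat2} {R : ℝ} (h : NearOne R C) {z : ℂ}
    (hz : z ∈ ball (0 : ℂ) R) : ‖2 + C z 0 0 + C z 1 1‖ ≤ 5 := by
  have h1 := h.norm_trace_sub_le hz
  have h2 := norm_sub_norm_le (2 + C z 0 0 + C z 1 1) 4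
  rw [RCLike.norm_ofNat] at h2
  linarith

theorem NearOne.trace_ne_zero {C : ℂ → Mat2} {R : ℝ} (h : NearOne R C) {z : ℂ}
    (hz : z ∈ ball (0 : ℂ) R) : 2 + C z 0 0 + C z 1 1 ≠ 0 := fun h0 => by
  have := h.norm_trace_sub_le hz
  rw [h0, zero_sub, norm_neg, RCLike.norm_ofNat] at this
  norm_num at this

theorem norm_le_half {u v : ℂ} {b : ℝ} (hu : ‖u‖ ≤ b) (hv : ‖v‖ ≤ b) :
    ‖(u + v) / 2‖ ≤ b ∧ ‖(u - v) / 2‖ ≤ b := by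
  rw [norm_div, norm_div, RCLike.norm_ofNat]
  constructor
  · linarith [norm_add_le u v]
  · linarith [norm_sub_le u v]

/-- Recovering the entries of a matrix of determinant one close to the identity from approximate
values of its Cayley transform. -/
theorem norm_entries_sub_le {a b c d φ x y σ γ z t : ℂ} {t₀ s δ e B : ℝ}
    (ht : t = 2 + a + d) (ht0 : t ≠ 0) (ht5 : ‖t‖ ≤ 5) (hdet : a * d - b * c = 1)
    (e1 : a - d = t * φ) (e2 : c - b = t * x) (e3 : b + c = t * y)
    (bφ : ‖φ‖ ≤ B) (bx : ‖x‖ ≤ B) (hy_le : ‖y‖ ≤ B) (bσ : ‖σ‖ ≤ 1) (bγ : ‖γ‖ ≤ 1)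
    (ht₀ : |t₀ - 4| ≤ B ^ 2) (hsδ : |s / 2 - δ| ≤ δ ^ 2) (hsσ : (t₀ : ℂ) * σ = s)
    (dφ : ‖φ - -(I * z * σ)‖ ≤ e)
    (dx : ‖x - ((γ - star γ) / 2 - I * z * ((γ + star γ) / 2))‖ ≤ e)
    (dy : ‖y - ((γ + star γ) / 2 - I * z * ((γ - star γ) / 2))‖ ≤ e) :
    let η := 5 * e + 40 * (1 + ‖z‖) * B ^ 2 + (1 + ‖z‖) * δ ^ 2
    ‖a - 1 + I * z * δ‖ ≤ η ∧ ‖d - 1 - I * z * δ‖ ≤ η ∧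
      ‖b - t₀ * star γ * (1 + I * z) / 2‖ ≤ η ∧ ‖c - t₀ * γ * (1 - I * z) / 2‖ ≤ η := by
  intro η
  have hB0 : 0 ≤ B := (norm_nonneg _).trans bφ
  have he0 : 0 ≤ e := (norm_nonneg _).trans dφ
  have hzn := norm_nonneg z
  -- Because the determinant is 1, (a-d)² + 4bc = (a+d)² - 4 = t(t-4). The trace thus deviates from
  -- 2 only to second order in the Cayley data.
  have htt : t - 4 = t * (φ ^ 2 + y ^ 2 - x ^ 2) := by
    apply mul_left_cancel₀ ht0
    have q1 : (a - d) ^ 2 = t ^ 2 * φ ^ 2 := by rw [e1]; ring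
    have q2 : (c - b) ^ 2 = t ^ 2 * x ^ 2 := by rw [e2]; ring
    have q3 : (b + c) ^ 2 = t ^ 2 * y ^ 2 := by rw [e3]; ring
    rw [ht] at q1 q2 q3 ⊢
    linear_combination 4 * hdet + q1 + q3 - q2
  have bt : ‖t - 4‖ ≤ 15 * B ^ 2 := by
    rw [htt, norm_mul]
    have h1 : ‖φ ^ 2 + y ^ 2 - x ^ 2‖ ≤ 3 * B ^ 2 := by
      have b1 : ‖φ ^ 2‖ ≤ B ^ 2 := by rw [norm_pow]; gcongr
      have b2 : ‖x ^ 2‖ ≤ B ^ 2 := by rw [norm_pow]; gcongr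
      have b3 : ‖y ^ 2‖ ≤ B ^ 2 := by rw [norm_pow]; gcongr
      linarith [norm_sub_le (φ ^ 2 + y ^ 2) (x ^ 2), norm_add_le (φ ^ 2) (y ^ 2)]
    calc ‖t‖ * _ ≤ 5 * (3 * B ^ 2) := by gcongr
      _ = 15 * B ^ 2 := by ring
  have htt₀ : ‖t - t₀‖ ≤ 16 * B ^ 2 := by
    have h1 : ‖(4 : ℂ) - t₀‖ = |t₀ - 4| := by
      rw [norm_sub_rev, ← Real.norm_eq_abs, ← norm_real]
      push_cast
      rfl
    have h2 : ‖t - t₀‖ ≤ ‖t - 4‖ + ‖(4 : ℂ) - t₀‖ := by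
      simpa using norm_add_le (t - 4) ((4 : ℂ) - t₀)
    linarith
  set Eφ := φ - -(I * z * σ) with hEφ
  set Ex := x - ((γ - star γ) / 2 - I * z * ((γ + star γ) / 2)) with hEx
  set Ey := y - ((γ + star γ) / 2 - I * z * ((γ - star γ) / 2)) with hEy
  have hB2 : 0 ≤ B ^ 2 := sq_nonneg B
  have hzB : 0 ≤ ‖z‖ * B ^ 2 := by positivity
  have hzδ : 0 ≤ ‖z‖ * δ ^ 2 := by positivity
  have hδ2 : 0 ≤ δ ^ 2 := sq_nonneg δ
  have hηdef : η = 5 * e + 40 * (1 + ‖z‖) * B ^ 2 + (1 + ‖z‖) * δ ^ 2 := rfl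
  clear_value Eφ Ex Ey η
  have hmul : ‖t / 2 * Eφ‖ ≤ 5 / 2 * e := by
    rw [norm_mul, norm_div, RCLike.norm_ofNat]
    gcongr
  have hmul2 : ‖(t - t₀) / 2 * (I * z * σ)‖ ≤ 8 * (‖z‖ * B ^ 2) := by
    rw [norm_mul, norm_div, RCLike.norm_ofNat, norm_mul, norm_mul, norm_I, one_mul]
    calc ‖t - t₀‖ / 2 * (‖z‖ * ‖σ‖) ≤ 16 * B ^ 2 / 2 * (‖z‖ * 1) := by gcongr
      _ = 8 * (‖z‖ * B ^ 2) := by ring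
  have hmul3 : ‖I * z * ((s / 2 - δ : ℝ) : ℂ)‖ ≤ ‖z‖ * δ ^ 2 := by
    rw [norm_mul, norm_mul, norm_I, one_mul, norm_real, Real.norm_eq_abs]
    gcongr
  have hhalf : ‖(t - 4) / 2‖ ≤ 15 / 2 * B ^ 2 := by
    rw [norm_div, RCLike.norm_ofNat]
    linarith
  have hIz : ∀ u : ℂ, ‖u‖ = ‖z‖ → ‖1 + u‖ ≤ 1 + ‖z‖ := fun u hu => by
    have := norm_add_le 1 u
    rw [norm_one, hu] at this
    exact this
  have hoff : ∀ u v : ℂ, ‖u‖ = ‖z‖ → ‖v‖ ≤ 1 →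
      ‖(t - t₀) / 2 * (v * (1 + u))‖ ≤ 8 * (1 + ‖z‖) * B ^ 2 := fun u v hu hv => by
    rw [norm_mul, norm_div, RCLike.norm_ofNat, norm_mul]
    calc ‖t - t₀‖ / 2 * (‖v‖ * ‖1 + u‖) ≤ 16 * B ^ 2 / 2 * (1 * (1 + ‖z‖)) := by
          gcongr
          exact hIz u hu
      _ = 8 * (1 + ‖z‖) * B ^ 2 := by ring
  have hIzn : ‖I * z‖ = ‖z‖ := by rw [norm_mul, norm_I, one_mul]
  refine ⟨?_, ?_, ?_, ?_⟩
  · have hid : a - 1 + I * z * δ =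
        ((t - 4) / 2 + t / 2 * Eφ) - ((t - t₀) / 2 * (I * z * σ) +
          I * z * ((s / 2 - δ : ℝ) : ℂ)) := by
      rw [hEφ]
      push_cast
      linear_combination e1 / 2 - ht / 2 - I * z / 2 * hsσ
    rw [hid]
    refine (norm_sub_le _ _).trans ?_
    have u1 := norm_add_le ((t - 4) / 2) (t / 2 * Eφ)
    have u2 := norm_add_le ((t - t₀) / 2 * (I * z * σ)) (I * z * ((s / 2 - δ : ℝ) : ℂ))
    linarith
  · have hid : d - 1 - I * z * δ =
        ((t - 4) / 2 - t / 2 * Eφ) + ((t - t₀) / 2 * (I * z * σ) +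
          I * z * ((s / 2 - δ : ℝ) : ℂ)) := by
      rw [hEφ]
      push_cast
      linear_combination -e1 / 2 - ht / 2 + I * z / 2 * hsσ
    rw [hid]
    refine (norm_add_le _ _).trans ?_
    have u1 := norm_sub_le ((t - 4) / 2) (t / 2 * Eφ)
    have u2 := norm_add_le ((t - t₀) / 2 * (I * z * σ)) (I * z * ((s / 2 - δ : ℝ) : ℂ))
    linarith
  · have hid : b - t₀ * star γ * (1 + I * z) / 2 =
        t / 2 * (Ey - Ex) + (t - t₀) / 2 * (star γ * (1 + I * z)) := by
      rw [hEx, hEy]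
      linear_combination e3 / 2 - e2 / 2
    rw [hid]
    refine (norm_add_le _ _).trans ?_
    have u1 := hoff (I * z) (star γ) hIzn (by rwa [norm_star])
    have u2 : ‖t / 2 * (Ey - Ex)‖ ≤ 5 / 2 * (e + e) := by
      rw [norm_mul, norm_div, RCLike.norm_ofNat]
      gcongr
      linarith [norm_sub_le Ey Ex]
    linarith
  · have hid : c - t₀ * γ * (1 - I * z) / 2 =
        t / 2 * (Ex + Ey) + (t - t₀) / 2 * (γ * (1 + -(I * z))) := by
      rw [hEx, hEy]
      linear_combination e3 / 2 + e2 / 2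
    rw [hid]
    refine (norm_add_le _ _).trans ?_
    have u1 := hoff (-(I * z)) γ (by rw [norm_neg, hIzn]) bγ
    have u2 : ‖t / 2 * (Ex + Ey)‖ ≤ 5 / 2 * (e + e) := by
      rw [norm_mul, norm_div, RCLike.norm_ofNat]
      gcongr
      linarith [norm_add_le Ex Ey]
    linarith

/-! ### Approximation of an inner function by its value at i -/

namespace IsArovInner

variable {C : ℂ → Mat2}

theorem cayley_re_nonneg (hC : IsArovInner C) {w z : ℂ} (hw : ‖w‖ = 1) (hz : 0 < z.im) :
    0 ≤ (cayley C w z).re := by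
  have h := cayley_numerator_posSemidef (hC.det z) (hC.inner.contractive z hz) w hw
  rw [cayley, div_eq_mul_inv, Complex.inv_def, ← mul_assoc, re_mul_ofReal]
  exact mul_nonneg h (inv_nonneg.2 (normSq_nonneg _))

theorem cayley_star (hC : IsArovInner C) (w z : ℂ) :
    cayley C w (star z) = -star (cayley C w z) := by
  obtain ⟨h1, h2, h3, h4⟩ := hC.apply_star z
  rw [cayley, cayley, h1, h2, h3, h4, star_div₀, ← neg_div]
  congr 1
  · simp only [star_add, star_sub, star_mul', star_star]
    ring
  · simp only [star_add, star_ofNat]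
    ring

theorem isHerglotzOnDisc_cayley (hC : IsArovInner C) {R : ℝ} (hR : NearOne R C) {w : ℂ}
    (hw : ‖w‖ = 1) : IsHerglotzOnDisc R (cayley C w) where
  differentiableOn := by
    have h := hC.inner.entire
    refine DifferentiableOn.div ?_ ?_ fun z hz => hR.trace_ne_zero hz
    · exact (((((h 0 0).sub (h 1 1)).sub ((h 0 1).const_mul w)).add
        ((h 1 0).const_mul (star w)))).differentiableOn
    · exact (((h 0 0).const_add 2).add (h 1 1)).differentiableOn
  re_nonneg z hz := hC.cayley_re_nonneg hw hz.1
  symm z _ := hC.cayley_star w z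

/-- Testing Cayley positivity with the unit w for which w̄ C₁₀(i) = -|C₁₀(i)| bounds |C₁₀(i)| by p -
1/p. This is linear in the mass, whereas |C₁₀|² ≤ p² - 1 would give only its square root. -/
theorem exists_upper_entry (hC : IsArovInner C) :
    ∃ p : ℝ, 1 ≤ p ∧ C I 0 0 = p ∧ C I 1 1 = (p⁻¹ : ℝ) ∧ mass C = Real.log p ∧
      ‖C I 1 0‖ ≤ p - p⁻¹ := by
  have h1 := hC.one_le_norm (z := I) (by simp)
  have hpos := hC.pos
  have hre : C I 0 0 = ((C I 0 0).re : ℂ) := by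
    rw [Complex.lt_def] at hpos
    exact Complex.ext rfl (by simpa using hpos.2.symm)
  have hrepos : 0 < (C I 0 0).re := (Complex.lt_def.1 hpos).1
  have hnorm : ‖C I 0 0‖ = (C I 0 0).re := by
    rw [hre, norm_real, Real.norm_of_nonneg hrepos.le, ofReal_re]
  have hd := hC.det I
  rw [Matrix.det_fin_two, hC.zero, zero_mul, sub_zero] at hd
  have h11 : C I 1 1 = (((C I 0 0).re)⁻¹ : ℝ) := by
    rw [ofReal_inv, ← hre]
    exact eq_inv_of_mul_eq_one_right hd
  refine ⟨(C I 0 0).re, hnorm ▸ h1, hre, h11, by rw [mass, hnorm], ?_⟩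
  set p := (C I 0 0).re
  rcases eq_or_ne (C I 1 0) 0 with h0 | h0
  · rw [h0, norm_zero, sub_nonneg]
    have : 1 ≤ p := hnorm ▸ h1
    exact (inv_le_one_of_one_le₀ this).trans this
  · set c := C I 1 0
    have hn : (0 : ℝ) < ‖c‖ := norm_pos_iff.2 h0
    have hw : ‖-(c / ‖c‖)‖ = 1 := by
      rw [norm_neg, norm_div, norm_real, norm_norm, div_self hn.ne']
    have h := cayley_numerator_posSemidef (hC.det I) (hC.inner.contractive I (by simp)) _ hw
    have hcc : star (-(c / ‖c‖)) * c = -(‖c‖ : ℂ) := by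
      have hn' : (‖c‖ : ℂ) ≠ 0 := by exact_mod_cast hn.ne'
      rw [star_neg, star_div₀, star_def, conj_ofReal, neg_mul, div_mul_eq_mul_div,
        mul_comm, mul_conj, normSq_eq_norm_sq]
      push_cast
      field_simp
    have ht : star (2 + C I 0 0 + C I 1 1) = ((2 + p + p⁻¹ : ℝ) : ℂ) := by
      rw [hre, h11, star_def]
      simp [map_ofNat]
    rw [hcc, ht, hC.zero, re_mul_ofReal, hre, h11] at h
    have hnum : ((p : ℂ) - (p⁻¹ : ℝ) - -(c / ‖c‖) * 0 + -(‖c‖ : ℂ)).re = p - p⁻¹ - ‖c‖ := by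
      simp
      ring
    rw [hnum] at h
    have : 0 < 2 + p + p⁻¹ := by positivity
    have := nonneg_of_mul_nonneg_left h this
    linarith

/-- The numerator is at most 2(p - 1/p), and (p - 1/p)/(2 + p + 1/p) ≤ 1 - 1/p ≤ log p. -/
theorem norm_cayley_I_le (hC : IsArovInner C) {w : ℂ} (hw : ‖w‖ = 1) :
    ‖cayley C w I‖ ≤ 2 * mass C := by
  obtain ⟨p, hp, h00, h11, hm, hc⟩ := hC.exists_upper_entry
  have hp0 : 0 < p := by linarith
  have ht : (2 + C I 0 0 + C I 1 1) = ((2 + p + p⁻¹ : ℝ) : ℂ) := by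
    rw [h00, h11]; push_cast; ring
  have hs : 0 ≤ p - p⁻¹ := (norm_nonneg _).trans hc
  have hnum : ‖C I 0 0 - C I 1 1 - w * C I 0 1 + star w * C I 1 0‖ ≤ 2 * (p - p⁻¹) := by
    have h1 : C I 0 0 - C I 1 1 - w * C I 0 1 = ((p - p⁻¹ : ℝ) : ℂ) := by
      rw [h00, h11, hC.zero]; push_cast; ring
    rw [h1]
    refine (norm_add_le _ _).trans ?_
    rw [norm_real, Real.norm_of_nonneg hs, norm_mul, norm_star, hw, one_mul]
    linarith
  have hpos : 0 < 2 + p + p⁻¹ := by positivity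
  rw [cayley, norm_div, ht, norm_real, Real.norm_of_nonneg hpos.le, div_le_iff₀ hpos, hm]
  refine hnum.trans ?_
  have hlog := Real.one_sub_inv_le_log_of_pos hp0
  have h1 : p - p⁻¹ ≤ (1 - p⁻¹) * (2 + p + p⁻¹) := by
    have e : (1 - p⁻¹) * (2 + p + p⁻¹) - (p - p⁻¹) = (1 - p⁻¹) * (1 + p⁻¹ * 0) + p⁻¹ * (1 - p⁻¹) := by
      field_simp
      ring
    have hi : 0 ≤ 1 - p⁻¹ := sub_nonneg.2 (inv_le_one_of_one_le₀ hp)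
    have : 0 ≤ p⁻¹ * (1 - p⁻¹) := by positivity
    nlinarith
  nlinarith

set_option maxHeartbeats 400000 in
-- The affine approximation is applied to the four forms w = ±1, ±i, and the entries are recovered
-- from them. The error has a part linear in the mass with a factor 1/ρ and a part quadratic in the
-- mass; each can be made a small multiple of the mass.
theorem norm_sub_affine_le (hC : IsArovInner C) {ρ : ℝ} (hρ : 4 ≤ ρ) (hR : NearOne (4 * ρ) C)
    (hδ : mass C ≤ 1) {z : ℂ} (hz : ‖z‖ < ρ / 2) :
    let η := 5 * (4800 * (1 + ‖z‖) ^ 2 * mass C / ρ) +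
      40 * (1 + ‖z‖) * (300 * ρ * mass C) ^ 2 + (1 + ‖z‖) * mass C ^ 2
    ‖C z 0 0 - 1 + I * z * mass C‖ ≤ η ∧
      ‖C z 1 1 - 1 - I * z * mass C‖ ≤ η ∧
      ‖C z 0 1 - star (C I 1 0) * (1 + I * z) / 2‖ ≤ η ∧
      ‖C z 1 0 - C I 1 0 * (1 - I * z) / 2‖ ≤ η := by
  intro η
  have hδ0 := hC.mass_nonneg
  obtain ⟨p, hp, h00, h11, hm, hc⟩ := hC.exists_upper_entry
  have hp0 : 0 < p := by linarith
  set δ := mass C with hδdef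
  set e := 4800 * (1 + ‖z‖) ^ 2 * δ / ρ with he
  set B := 300 * ρ * δ with hB
  have he0 : 0 ≤ e := by positivity
  have hB0 : 0 ≤ B := by positivity
  have hzn := norm_nonneg z
  have hzb : z ∈ ball (0 : ℂ) (4 * ρ) := by rw [mem_ball, dist_zero_right]; linarith
  have hIb : I ∈ ball (0 : ℂ) (4 * ρ) := by rw [mem_ball, dist_zero_right, norm_I]; linarith
  have hstarI : star I = -I := by simp
  have hbd : ∀ w : ℂ, ‖w‖ = 1 → ‖cayley C w z‖ ≤ B := fun w hw => by
    have h := (hC.isHerglotzOnDisc_cayley hR hw).norm_le (by linarith) hz.le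
    have h2 := hC.norm_cayley_I_le hw
    calc _ ≤ 150 * ρ * ‖cayley C w I‖ := h
      _ ≤ 150 * ρ * (2 * δ) := by gcongr
      _ = B := by rw [hB]; ring
  set aff : ℂ → ℂ := fun w => (cayley C w I - star (cayley C w I)) / 2 -
    I * z * ((cayley C w I + star (cayley C w I)) / 2) with haff
  have happ : ∀ w : ℂ, ‖w‖ = 1 → ‖cayley C w z - aff w‖ ≤ e := fun w hw => by
    have h := (hC.isHerglotzOnDisc_cayley hR hw).norm_sub_affine_le hρ hz
    have hmI : cayley C w (-I) = -star (cayley C w I) := by rw [← hstarI, hC.cayley_star]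
    rw [hmI, ← sub_eq_add_neg, sub_neg_eq_add] at h
    refine h.trans ?_
    have h2 := hC.norm_cayley_I_le hw
    calc 2400 * (1 + ‖z‖) ^ 2 * ‖cayley C w I‖ / ρ
        ≤ 2400 * (1 + ‖z‖) ^ 2 * (2 * δ) / ρ := by gcongr
      _ = e := by rw [he]; ring
  set t := 2 + C z 0 0 + C z 1 1 with ht
  have ht0 : t ≠ 0 := hR.trace_ne_zero hzb
  have ht5 : ‖t‖ ≤ 5 := hR.norm_trace_le hzb
  have hcay : ∀ w : ℂ, cayley C w z * t =
      C z 0 0 - C z 1 1 - w * C z 0 1 + star w * C z 1 0 := fun w => by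
    rw [cayley, div_mul_cancel₀ _ ht0]
  have n1 : ‖(1 : ℂ)‖ = 1 := norm_one
  have n2 : ‖(-1 : ℂ)‖ = 1 := by rw [norm_neg, norm_one]
  have n3 : ‖I‖ = 1 := norm_I
  have n4 : ‖-I‖ = 1 := by rw [norm_neg, norm_I]
  set f1 := cayley C 1 z
  set f2 := cayley C (-1) z
  set f3 := cayley C I z
  set f4 := cayley C (-I) z
  have c1 : f1 * t = _ := hcay 1
  have c2 : f2 * t = _ := hcay (-1)
  have c3 : f3 * t = _ := hcay I
  have c4 : f4 * t = _ := hcay (-I)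
  simp only [star_one, star_neg, hstarI, neg_neg] at c1 c2 c3 c4
  -- With a, b, c, d the entries of C z, these combinations satisfy tφ = a - d, tx = c - b and ty =
  -- b + c.
  set φ := (f1 + f2) / 2 with hφ
  set x := (f1 - f2) / 2 with hx
  set y := I * (f3 - f4) / 2 with hy
  have e1 : C z 0 0 - C z 1 1 = t * φ := by rw [hφ]; linear_combination -(c1 + c2) / 2
  have e2 : C z 1 0 - C z 0 1 = t * x := by rw [hx]; linear_combination -(c1 - c2) / 2
  have e3 : C z 0 1 + C z 1 0 = t * y := by
    rw [hy]
    linear_combination -I * (c3 - c4) / 2 + (C z 0 1 + C z 1 0) * I_sq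
  have hdet : C z 0 0 * C z 1 1 - C z 0 1 * C z 1 0 = 1 := by
    rw [← Matrix.det_fin_two, hC.det]
  have bφ : ‖φ‖ ≤ B := (norm_le_half (hbd 1 n1) (hbd (-1) n2)).1
  have bx : ‖x‖ ≤ B := (norm_le_half (hbd 1 n1) (hbd (-1) n2)).2
  have hy_le : ‖y‖ ≤ B := by
    rw [hy, mul_div_assoc, norm_mul, norm_I, one_mul]
    exact (norm_le_half (hbd I n3) (hbd (-I) n4)).2
  set c₀ := C I 1 0 with hc₀
  set t₀ : ℝ := 2 + p + p⁻¹ with ht₀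
  set s : ℝ := p - p⁻¹ with hs
  have ht₀4 : 4 ≤ t₀ := by
    have : 2 ≤ p + p⁻¹ := by
      have : p + p⁻¹ - 2 = (p - 1) ^ 2 * p⁻¹ := by field_simp; ring
      have : 0 ≤ (p - 1) ^ 2 * p⁻¹ := by positivity
      linarith
    linarith
  have hpexp : p = Real.exp δ := by rw [hm, Real.exp_log hp0]
  have hpexp' : p⁻¹ = Real.exp (-δ) := by rw [Real.exp_neg, ← hpexp]
  have x1 := abs_le.1 (Real.abs_exp_sub_one_sub_id_le (x := δ) (by rw [abs_of_nonneg hδ0]; exact hδ))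
  have x2 := abs_le.1 (Real.abs_exp_sub_one_sub_id_le (x := -δ)
    (by rw [abs_neg, abs_of_nonneg hδ0]; exact hδ))
  rw [← hpexp] at x1
  rw [← hpexp', neg_sq] at x2
  have hsδ : |s / 2 - δ| ≤ δ ^ 2 := by
    rw [abs_le]
    constructor <;> linarith [x1.1, x1.2, x2.1, x2.2]
  have hs0 : 0 ≤ s := (norm_nonneg _).trans hc
  have ht₀5 : |t₀ - 4| ≤ 2 * δ ^ 2 := by
    rw [abs_le]
    constructor <;> linarith [x1.1, x1.2, x2.1, x2.2]
  have hB1 : 1200 * δ ≤ B := by rw [hB]; nlinarith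
  have ht₀' : (t₀ : ℂ) ≠ 0 := by exact_mod_cast (by linarith : t₀ ≠ 0)
  clear_value s t₀
  set σ : ℂ := s / t₀ with hσ
  set γ : ℂ := c₀ / t₀ with hγ
  have hs2 : s ≤ 4 := by nlinarith [abs_le.1 hsδ]
  have bσ : ‖σ‖ ≤ 1 := by
    rw [hσ, norm_div, norm_real, norm_real, Real.norm_of_nonneg hs0,
      Real.norm_of_nonneg (by linarith), div_le_one (by linarith)]
    linarith
  have bγ : ‖γ‖ ≤ 1 := by
    rw [hγ, norm_div, norm_real, Real.norm_of_nonneg (by linarith : 0 ≤ t₀),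
      div_le_one (by linarith)]
    linarith
  have hσs : star σ = σ := by simp [hσ]
  have hcI : ∀ w : ℂ, cayley C w I = σ + star w * γ := fun w => by
    have hd : 2 + C I 0 0 + C I 1 1 = (t₀ : ℂ) := by
      rw [h00, h11, ht₀]; push_cast; ring
    have hn : C I 0 0 - C I 1 1 - w * C I 0 1 + star w * C I 1 0 = (s : ℂ) + star w * c₀ := by
      rw [h00, h11, hs, hC.zero]; push_cast; ring
    rw [cayley, hd, hn, hσ, hγ, add_div, mul_div_assoc]
  have haff' : ∀ w : ℂ, aff w = (star w * γ - w * star γ) / 2 -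
      I * z * (σ + (star w * γ + w * star γ) / 2) := fun w => by
    simp only [haff, hcI, star_add, star_mul', star_star, hσs]
    ring
  clear_value σ γ
  have a1 := happ 1 n1
  have a2 := happ (-1) n2
  have a3 := happ I n3
  have a4 := happ (-I) n4
  rw [haff'] at a1 a2 a3 a4
  simp only [star_one, star_neg, hstarI, neg_neg] at a1 a2 a3 a4
  have dφ : ‖φ - -(I * z * σ)‖ ≤ e := by
    have := (norm_le_half a1 a2).1
    convert! this using 2
    rw [hφ]; ring
  have dx : ‖x - ((γ - star γ) / 2 - I * z * ((γ + star γ) / 2))‖ ≤ e := by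
    have := (norm_le_half a1 a2).2
    convert! this using 2
    rw [hx]; ring
  have dy : ‖y - ((γ + star γ) / 2 - I * z * ((γ - star γ) / 2))‖ ≤ e := by
    have := (norm_le_half a3 a4).2
    rw [← one_mul ‖_ / 2‖, ← norm_I, ← norm_mul] at this
    convert! this using 2
    rw [hy]
    linear_combination -((γ + star γ) / 2 - I * z * ((γ - star γ) / 2)) * I_sq
  have hsσ : (t₀ : ℂ) * σ = s := by rw [hσ]; field_simp
  have hcγ : (t₀ : ℂ) * γ = c₀ := by rw [hγ]; field_simp
  have hcγ' : (t₀ : ℂ) * star γ = star c₀ := by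
    rw [← hcγ, star_mul', star_def, conj_ofReal]
  have h := norm_entries_sub_le ht ht0 ht5 hdet e1 e2 e3 bφ bx hy_le bσ bγ
    (ht₀5.trans (by nlinarith)) hsδ hsσ dφ dx dy
  rwa [hcγ, hcγ'] at h

/-- A `j`-inner function that is close to the identity on a large disc is, up to a small multiple
of its mass, determined by its value at `i`. -/
theorem exists_norm_sub_affine_le (z : ℂ) {ε : ℝ} (hε : 0 < ε) :
    ∃ R > 0, ∃ δ₀ > 0, ∀ C : ℂ → Mat2, IsArovInner C → NearOne R C → mass C ≤ δ₀ →
      ‖C z 0 0 - 1 + I * z * mass C‖ ≤ ε * mass C ∧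
      ‖C z 1 1 - 1 - I * z * mass C‖ ≤ ε * mass C ∧
      ‖C z 0 1 - star (C I 1 0) * (1 + I * z) / 2‖ ≤ ε * mass C ∧
      ‖C z 1 0 - C I 1 0 * (1 - I * z) / 2‖ ≤ ε * mass C := by
  have hzn := norm_nonneg z
  set k := 1 + ‖z‖ with hk
  have hk1 : 1 ≤ k := by linarith
  -- 48000 = 2 · 5 · 4800 makes the linear error at most half of ε times the mass. Once ρ is fixed,
  -- A collects the quadratic errors, and mass ≤ ε/(2A) absorbs them into the other half.
  set ρ := max (4 * k) (48000 * k ^ 2 / ε) with hρ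
  have hρ1 : 4 * k ≤ ρ := le_max_left _ _
  have hρ2 : 48000 * k ^ 2 / ε ≤ ρ := le_max_right _ _
  have hρ0 : 0 < ρ := by linarith
  set A := 40 * k * (300 * ρ) ^ 2 + k with hA
  have hA0 : 0 < A := by positivity
  refine ⟨4 * ρ, by linarith, min 1 (ε / (2 * A)), by positivity, fun C hC hR hm => ?_⟩
  have hm0 := hC.mass_nonneg
  have hm1 : mass C ≤ 1 := hm.trans (min_le_left _ _)
  have hm2 : mass C ≤ ε / (2 * A) := hm.trans (min_le_right _ _)
  have h := hC.norm_sub_affine_le (by linarith) hR hm1 (z := z) (by linarith)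
  have hη : 5 * (4800 * (1 + ‖z‖) ^ 2 * mass C / ρ) +
      40 * (1 + ‖z‖) * (300 * ρ * mass C) ^ 2 + (1 + ‖z‖) * mass C ^ 2 ≤ ε * mass C := by
    have h1 : 5 * (4800 * k ^ 2 * mass C / ρ) ≤ ε / 2 * mass C := by
      have : 48000 * k ^ 2 / ρ ≤ ε := by
        rw [div_le_iff₀ hρ0, ← div_le_iff₀' hε]
        exact hρ2
      calc 5 * (4800 * k ^ 2 * mass C / ρ) = 48000 * k ^ 2 / ρ / 2 * mass C := by ring
        _ ≤ ε / 2 * mass C := by gcongr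
    have h2 : A * mass C * mass C ≤ ε / 2 * mass C := by
      gcongr
      rw [le_div_iff₀ (by positivity)] at hm2
      linarith
    calc _ = 5 * (4800 * k ^ 2 * mass C / ρ) + A * mass C * mass C := by rw [hA]; ring
      _ ≤ ε / 2 * mass C + ε / 2 * mass C := add_le_add h1 h2
      _ = ε * mass C := by ring
  exact ⟨h.1.trans hη, h.2.1.trans hη, h.2.2.1.trans hη, h.2.2.2.trans hη⟩

end IsArovInner

/-! ### Monotonic families in Arov gauge -/

/-- Cauchy's estimate on unit circles bounds the derivative by the bound on the enlarged disc. -/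
theorem lipschitzOnWith_of_norm_le {f : ℂ → ℂ} (hf : Differentiable ℂ f) {R : ℝ} {B : NNReal}
    (hb : ∀ z : ℂ, ‖z‖ ≤ R + 1 → ‖f z‖ ≤ B) : LipschitzOnWith B f (closedBall 0 R) := by
  refine (convex_closedBall (0 : ℂ) R).lipschitzOnWith_of_nnnorm_deriv_le
    (fun z _ => hf z) fun z hz => ?_
  have h := norm_deriv_le_of_forall_mem_sphere_norm_le (c := z) (R := 1) (C := B) one_pos
    hf.diffContOnCl fun w hw => hb w ?_
  · rw [div_one] at h
    exact h
  · rw [mem_sphere, dist_eq_norm] at hw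
    rw [mem_closedBall, dist_zero_right] at hz
    have : ‖w‖ ≤ ‖w - z‖ + ‖z‖ := by simpa using norm_add_le (w - z) z
    linarith

/-- A continuous `j`-monotonic family in Arov gauge, normalized at `0`. -/
structure IsArovFamily (S : Set ℝ) (𝔄 : ℂ → ℝ → Mat2) : Prop where
  ordConnected : S.OrdConnected
  zero_mem : (0 : ℝ) ∈ S
  mono : IsJMonotonic jMat S 𝔄
  cont : IsContinuousFamily S 𝔄
  gauge : InArovGauge S 𝔄
  det : ∀ z, ∀ ℓ ∈ S, (𝔄 z ℓ).det = 1
  apply_zero : ∀ z, 𝔄 z 0 = 1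

/-- The transfer matrix between two parameters. -/
def transfer (𝔄 : ℂ → ℝ → Mat2) (s t : ℝ) (z : ℂ) : Mat2 := (𝔄 z s)⁻¹ * 𝔄 z t

/-- The logarithm of the upper diagonal entry at `i`. -/
def logDiag (𝔄 : ℂ → ℝ → Mat2) (t : ℝ) : ℝ := Real.log (𝔄 I t 0 0).re

/-- The normalized off-diagonal entry at `i`. -/
def offDiag (𝔄 : ℂ → ℝ → Mat2) (t : ℝ) : ℂ := -(𝔄 I t 1 0) * (Real.exp (-logDiag 𝔄 t) : ℂ)

theorem inv_eq_of_det_eq_one {X : Mat2} (h : X.det = 1) :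
    X⁻¹ = !![X 1 1, -X 0 1; -X 1 0, X 0 0] := by
  rw [Matrix.inv_def, h, Ring.inverse_one, one_smul, Matrix.adjugate_fin_two]

namespace IsArovFamily

variable {S : Set ℝ} {𝔄 : ℂ → ℝ → Mat2}

theorem mul_transfer (h : IsArovFamily S 𝔄) {s : ℝ} (hs : s ∈ S) (t : ℝ) (z : ℂ) :
    𝔄 z s * transfer 𝔄 s t z = 𝔄 z t := by
  rw [transfer, Matrix.mul_nonsing_inv_cancel_left]
  rw [h.det z s hs]
  exact isUnit_one

theorem transfer_entries (h : IsArovFamily S 𝔄) {s : ℝ} (hs : s ∈ S) (t : ℝ) (z : ℂ) :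
    transfer 𝔄 s t z 0 0 = 𝔄 z s 1 1 * 𝔄 z t 0 0 - 𝔄 z s 0 1 * 𝔄 z t 1 0 ∧
    transfer 𝔄 s t z 0 1 = 𝔄 z s 1 1 * 𝔄 z t 0 1 - 𝔄 z s 0 1 * 𝔄 z t 1 1 ∧
    transfer 𝔄 s t z 1 0 = -𝔄 z s 1 0 * 𝔄 z t 0 0 + 𝔄 z s 0 0 * 𝔄 z t 1 0 ∧
    transfer 𝔄 s t z 1 1 = -𝔄 z s 1 0 * 𝔄 z t 0 1 + 𝔄 z s 0 0 * 𝔄 z t 1 1 := by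
  rw [transfer, inv_eq_of_det_eq_one (h.det z s hs)]
  refine ⟨?_, ?_, ?_, ?_⟩ <;> simp [Matrix.mul_apply, Fin.sum_univ_two] <;> ring

theorem isArovInner_transfer (h : IsArovFamily S 𝔄) {s t : ℝ} (hs : s ∈ S) (ht : t ∈ S)
    (hst : s ≤ t) : IsArovInner (transfer 𝔄 s t) where
  inner := by
    rcases hst.eq_or_lt with rfl | hlt
    · have : transfer 𝔄 s s = fun _ => 1 := by
        funext z
        rw [transfer, Matrix.nonsing_inv_mul]
        rw [h.det z s hs]
        exact isUnit_one
      rw [this]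
      refine ⟨fun i k => differentiable_const _, fun z _ => ?_, fun x => ?_⟩
      · simpa using Matrix.PosSemidef.zero
      · simp
    · exact h.mono s hs t ht hlt
  det z := by
    rw [transfer, Matrix.det_mul, h.det z t ht, mul_one, Matrix.det_nonsing_inv, h.det z s hs,
      Ring.inverse_one]
  zero := by
    rw [(h.transfer_entries hs t I).2.1, (h.gauge s hs).1, (h.gauge t ht).1]
    ring
  pos := by
    rw [(h.transfer_entries hs t I).1, (h.gauge s hs).1, zero_mul, sub_zero]
    exact mul_pos (h.gauge s hs).2.2 (h.gauge t ht).2.1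

theorem apply_I_zero_zero (h : IsArovFamily S 𝔄) {t : ℝ} (ht : t ∈ S) :
    𝔄 I t 0 0 = (Real.exp (logDiag 𝔄 t) : ℂ) := by
  have hp := Complex.lt_def.1 (h.gauge t ht).2.1
  rw [logDiag, Real.exp_log hp.1]
  exact Complex.ext rfl (by simpa using hp.2.symm)

theorem apply_I_one_one (h : IsArovFamily S 𝔄) {t : ℝ} (ht : t ∈ S) :
    𝔄 I t 1 1 = (Real.exp (-logDiag 𝔄 t) : ℂ) := by
  have hd := h.det I t ht
  rw [Matrix.det_fin_two, (h.gauge t ht).1, zero_mul, sub_zero, h.apply_I_zero_zero ht] at hd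
  rw [Real.exp_neg, ofReal_inv]
  exact eq_inv_of_mul_eq_one_right hd

theorem apply_I_one_zero (𝔄 : ℂ → ℝ → Mat2) (t : ℝ) :
    𝔄 I t 1 0 = -((Real.exp (logDiag 𝔄 t) : ℂ) * offDiag 𝔄 t) := by
  have : (Real.exp (logDiag 𝔄 t) : ℂ) ≠ 0 := by exact_mod_cast (Real.exp_pos _).ne'
  rw [offDiag, Real.exp_neg, ofReal_inv]
  field_simp

theorem logDiag_zero (h : IsArovFamily S 𝔄) : logDiag 𝔄 0 = 0 := by
  simp [logDiag, h.apply_zero]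

theorem offDiag_zero (h : IsArovFamily S 𝔄) : offDiag 𝔄 0 = 0 := by
  simp [offDiag, h.apply_zero]

theorem transfer_I_zero_zero (h : IsArovFamily S 𝔄) {s t : ℝ} (hs : s ∈ S) (ht : t ∈ S) :
    transfer 𝔄 s t I 0 0 = (Real.exp (logDiag 𝔄 t - logDiag 𝔄 s) : ℂ) := by
  rw [(h.transfer_entries hs t I).1, (h.gauge s hs).1, zero_mul, sub_zero, h.apply_I_one_one hs,
    h.apply_I_zero_zero ht, ← ofReal_mul, ← Real.exp_add]
  congr 2
  ring

theorem transfer_I_one_zero (h : IsArovFamily S 𝔄) {s t : ℝ} (hs : s ∈ S) (ht : t ∈ S) :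
    transfer 𝔄 s t I 1 0 =
      -((Real.exp (logDiag 𝔄 s + logDiag 𝔄 t) : ℂ) * (offDiag 𝔄 t - offDiag 𝔄 s)) := by
  rw [(h.transfer_entries hs t I).2.2.1, h.apply_I_zero_zero hs, h.apply_I_zero_zero ht,
    apply_I_one_zero 𝔄 s, apply_I_one_zero 𝔄 t, Real.exp_add, ofReal_mul]
  ring

theorem mass_transfer (h : IsArovFamily S 𝔄) {s t : ℝ} (hs : s ∈ S) (ht : t ∈ S) :
    mass (transfer 𝔄 s t) = logDiag 𝔄 t - logDiag 𝔄 s := by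
  rw [mass, h.transfer_I_zero_zero hs ht, norm_real, Real.norm_of_nonneg (Real.exp_pos _).le,
    Real.log_exp]

theorem monotoneOn_logDiag (h : IsArovFamily S 𝔄) : MonotoneOn (logDiag 𝔄) S := by
  intro s hs t ht hst
  have := (h.isArovInner_transfer hs ht hst).mass_nonneg
  rw [h.mass_transfer hs ht] at this
  linarith

/-- This is |C₁₀(i)| ≤ p - 1/p for the transfer matrix, divided by exp(m(s) + m(t)), where p =
exp(m(t) - m(s)). It is the source of both the absolute continuity of κ and the bound |𝔞| ≤ 1. -/
theorem norm_offDiag_sub_le (h : IsArovFamily S 𝔄) {s t : ℝ} (hs : s ∈ S) (ht : t ∈ S)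
    (hst : s ≤ t) : ‖offDiag 𝔄 t - offDiag 𝔄 s‖ ≤
      Real.exp (-2 * logDiag 𝔄 s) - Real.exp (-2 * logDiag 𝔄 t) := by
  obtain ⟨p, hp1, hp, -, -, hle⟩ := (h.isArovInner_transfer hs ht hst).exists_upper_entry
  rw [h.transfer_I_zero_zero hs ht, ofReal_inj] at hp
  rw [h.transfer_I_one_zero hs ht, norm_neg, norm_mul, norm_real,
    Real.norm_of_nonneg (Real.exp_pos _).le, ← hp, ← Real.exp_neg, mul_comm,
    ← le_div_iff₀ (Real.exp_pos _)] at hle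
  refine hle.trans_eq ?_
  rw [sub_div, ← Real.exp_sub, ← Real.exp_sub]
  congr 2 <;> ring

theorem continuousOn_entry (h : IsArovFamily S 𝔄) (z : ℂ) (i k : Fin 2) :
    ContinuousOn (fun t => 𝔄 z t i k) S :=
  (continuous_apply_apply i k).comp_continuousOn (h.cont z)

theorem continuousOn_logDiag (h : IsArovFamily S 𝔄) : ContinuousOn (logDiag 𝔄) S := by
  refine ContinuousOn.log ?_ fun t ht => (Complex.lt_def.1 (h.gauge t ht).2.1).1.ne'
  exact continuous_re.comp_continuousOn (h.continuousOn_entry I 0 0)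

theorem entries_of_nonneg (h : IsArovFamily S 𝔄) (t : ℝ) (z : ℂ) :
    transfer 𝔄 0 t z = 𝔄 z t := by
  have := h.mul_transfer h.zero_mem t z
  rwa [h.apply_zero, one_mul] at this

/-- The transfer matrix from t to 0 is 𝔄(z,t)⁻¹, the adjugate. For negative t it is this inverse
that is known to be j-inner. -/
theorem entries_of_nonpos (h : IsArovFamily S 𝔄) {t : ℝ} (ht : t ∈ S) (z : ℂ) :
    𝔄 z t 0 0 = transfer 𝔄 t 0 z 1 1 ∧ 𝔄 z t 1 1 = transfer 𝔄 t 0 z 0 0 ∧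
      𝔄 z t 0 1 = -transfer 𝔄 t 0 z 0 1 ∧ 𝔄 z t 1 0 = -transfer 𝔄 t 0 z 1 0 := by
  obtain ⟨h1, h2, h3, h4⟩ := h.transfer_entries ht 0 z
  rw [h.apply_zero] at h1 h2 h3 h4
  rw [h1, h2, h3, h4]
  simp

theorem differentiable_entry (h : IsArovFamily S 𝔄) {t : ℝ} (ht : t ∈ S) (i k : Fin 2) :
    Differentiable ℂ fun z => 𝔄 z t i k := by
  rcases le_total 0 t with h0 | h0
  · have := (h.isArovInner_transfer h.zero_mem ht h0).inner.entire i k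
    simpa only [h.entries_of_nonneg] using this
  · have he := (h.isArovInner_transfer ht h.zero_mem h0).inner.entire
    fin_cases i <;> fin_cases k
    · exact (congrArg (Differentiable ℂ) (funext fun z => (h.entries_of_nonpos ht z).1)).mpr
        (he 1 1)
    · exact (congrArg (Differentiable ℂ) (funext fun z => (h.entries_of_nonpos ht z).2.2.1)).mpr
        (he 0 1).neg
    · exact (congrArg (Differentiable ℂ) (funext fun z => (h.entries_of_nonpos ht z).2.2.2)).mpr
        (he 1 0).neg
    · exact (congrArg (Differentiable ℂ) (funext fun z => (h.entries_of_nonpos ht z).2.1)).mpr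
        (he 0 0)

theorem norm_entry_le (h : IsArovFamily S 𝔄) {t : ℝ} (ht : t ∈ S) {ρ : ℝ} (hρ : 1 ≤ ρ) {z : ℂ}
    (hz : ‖z‖ ≤ ρ / 4) (i k : Fin 2) :
    ‖𝔄 z t i k‖ ≤ Real.exp (896 * ρ * (|logDiag 𝔄 t| + 1)) := by
  rcases le_total 0 t with h0 | h0
  · have hi := h.isArovInner_transfer h.zero_mem ht h0
    have hb := hi.norm_le_exp hρ hz i k
    have hm := hi.mass_nonneg
    rw [h.mass_transfer h.zero_mem ht, h.logDiag_zero, sub_zero] at hb hm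
    rwa [h.entries_of_nonneg, ← abs_of_nonneg hm] at hb
  · have hi := h.isArovInner_transfer ht h.zero_mem h0
    have hb := hi.norm_le_exp hρ hz
    have hm := hi.mass_nonneg
    rw [h.mass_transfer ht h.zero_mem, h.logDiag_zero, zero_sub] at hb hm
    rw [← abs_of_nonneg hm, abs_neg] at hb
    obtain ⟨e1, e2, e3, e4⟩ := h.entries_of_nonpos ht z
    fin_cases i <;> fin_cases k
    · exact (congrArg norm e1).trans_le (hb 1 1)
    · exact (congrArg norm e3).trans_le ((norm_neg _).trans_le (hb 0 1))
    · exact (congrArg norm e4).trans_le ((norm_neg _).trans_le (hb 1 0))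
    · exact (congrArg norm e2).trans_le (hb 0 0)

theorem exists_norm_entry_le (h : IsArovFamily S 𝔄) {a b : ℝ} (hab : Icc a b ⊆ S) (R : ℝ) :
    ∃ B : NNReal, ∀ t ∈ Icc a b, ∀ z : ℂ, ‖z‖ ≤ R → ∀ i k, ‖𝔄 z t i k‖ ≤ B := by
  obtain ⟨M, hM⟩ := isCompact_Icc.exists_bound_of_continuousOn (h.continuousOn_logDiag.mono hab)
  set ρ := max 1 (4 * R)
  refine ⟨⟨Real.exp (896 * ρ * (M + 1)), (Real.exp_pos _).le⟩, fun t ht z hz i k => ?_⟩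
  have hR : 4 * R ≤ ρ := le_max_right _ _
  refine (h.norm_entry_le (hab ht) (le_max_left 1 (4 * R)) (hz.trans (by linarith)) i k).trans ?_
  refine Real.exp_le_exp.2 ?_
  have : |logDiag 𝔄 t| ≤ M := hM t ht
  gcongr

/-- Continuity in t for each z, together with a Lipschitz bound in z uniform in t, gives joint
continuity, hence uniform continuity on compact sets. -/
theorem exists_forall_norm_sub_lt (h : IsArovFamily S 𝔄) {a b : ℝ} (hab : Icc a b ⊆ S) (R : ℝ)
    {η : ℝ} (hη : 0 < η) : ∃ r > 0, ∀ s ∈ Icc a b, ∀ t ∈ Icc a b, |t - s| < r →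
      ∀ z : ℂ, ‖z‖ ≤ R → ∀ i k, ‖𝔄 z t i k - 𝔄 z s i k‖ < η := by
  obtain ⟨B, hB⟩ := h.exists_norm_entry_le hab (R + 1)
  have hunif : ∀ i k : Fin 2, ∃ r > 0, ∀ s ∈ Icc a b, ∀ t ∈ Icc a b, |t - s| < r →
      ∀ z : ℂ, ‖z‖ ≤ R → ‖𝔄 z t i k - 𝔄 z s i k‖ < η := by
    intro i k
    have hc : ContinuousOn (fun q : ℂ × ℝ => 𝔄 q.1 q.2 i k) (closedBall 0 R ×ˢ Icc a b) := by
      refine continuousOn_prod_of_continuousOn_lipschitzOnWith _ B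
        (fun z _ => (h.continuousOn_entry z i k).mono hab) fun t ht => ?_
      exact lipschitzOnWith_of_norm_le (h.differentiable_entry (hab ht) i k)
        fun z hz => hB t ht z hz i k
    have hu := ((isCompact_closedBall (0 : ℂ) R).prod (isCompact_Icc (a := a) (b := b))
      ).uniformContinuousOn_of_continuous hc
    rw [Metric.uniformContinuousOn_iff] at hu
    obtain ⟨r, hr, hr'⟩ := hu η hη
    refine ⟨r, hr, fun s hs t ht hst z hz => ?_⟩
    have hzm : z ∈ closedBall (0 : ℂ) R := by rwa [mem_closedBall, dist_zero_right]
    have := hr' (z, t) ⟨hzm, ht⟩ (z, s) ⟨hzm, hs⟩ (by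
      rw [Prod.dist_eq, dist_self, max_eq_right dist_nonneg]
      exact hst)
    rwa [dist_eq_norm] at this
  choose r hr hr' using hunif
  refine ⟨min (min (r 0 0) (r 0 1)) (min (r 1 0) (r 1 1)), ?_, fun s hs t ht hst z hz i k => ?_⟩
  · exact lt_min (lt_min (hr 0 0) (hr 0 1)) (lt_min (hr 1 0) (hr 1 1))
  · simp only [lt_min_iff] at hst
    fin_cases i <;> fin_cases k
    · exact hr' 0 0 s hs t ht hst.1.1 z hz
    · exact hr' 0 1 s hs t ht hst.1.2 z hz
    · exact hr' 1 0 s hs t ht hst.2.1 z hz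
    · exact hr' 1 1 s hs t ht hst.2.2 z hz

theorem exists_nearOne (h : IsArovFamily S 𝔄) {a b : ℝ} (hab : Icc a b ⊆ S) (R : ℝ) :
    ∃ r > 0, ∀ s ∈ Icc a b, ∀ t ∈ Icc a b, |t - s| < r → NearOne R (transfer 𝔄 s t) := by
  obtain ⟨B, hB⟩ := h.exists_norm_entry_le hab R
  -- Each entry of 𝔄(z,s)⁻¹(𝔄(z,t) - 𝔄(z,s)) is a sum of two products bounded by Bη ≤ 1/20, which
  -- yields the 1/10 of `NearOne`.
  set η : ℝ := 1 / (20 * (B + 1)) with hη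
  have hη0 : 0 < η := by positivity
  obtain ⟨r, hr, hr'⟩ := h.exists_forall_norm_sub_lt hab R hη0
  refine ⟨r, hr, fun s hs t ht hst z hz i k => ?_⟩
  rw [mem_ball, dist_zero_right] at hz
  have hd := hr' s hs t ht hst z hz.le
  have hb := hB s hs z hz.le
  have hone : transfer 𝔄 s t z - 1 = (𝔄 z s)⁻¹ * (𝔄 z t - 𝔄 z s) := by
    rw [mul_sub, transfer, Matrix.nonsing_inv_mul]
    rw [h.det z s (hab hs)]
    exact isUnit_one
  have hinv : ∀ i k, ‖(𝔄 z s)⁻¹ i k‖ ≤ B := by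
    intro i k
    rw [inv_eq_of_det_eq_one (h.det z s (hab hs))]
    fin_cases i <;> fin_cases k
    · simpa using hb 1 1
    · simpa using hb 0 1
    · simpa using hb 1 0
    · simpa using hb 0 0
  rw [← Matrix.sub_apply, hone, Matrix.mul_apply, Fin.sum_univ_two]
  have hterm : ∀ l : Fin 2, ‖(𝔄 z s)⁻¹ i l * (𝔄 z t - 𝔄 z s) l k‖ ≤ B * η := fun l => by
    rw [norm_mul, Matrix.sub_apply]
    exact mul_le_mul (hinv i l) (hd l k).le (norm_nonneg _) B.2
  have hBη : B * η ≤ 1 / 20 := by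
    rw [hη, mul_one_div, div_le_div_iff₀ (by positivity) (by norm_num)]
    linarith [B.2]
  linarith [norm_add_le ((𝔄 z s)⁻¹ i 0 * (𝔄 z t - 𝔄 z s) 0 k)
    ((𝔄 z s)⁻¹ i 1 * (𝔄 z t - 𝔄 z s) 1 k), hterm 0, hterm 1]

/-- On short subintervals the transfer matrix is nearly affine in the spectral parameter. -/
theorem exists_transfer_approx (h : IsArovFamily S 𝔄) {a b : ℝ} (hab : Icc a b ⊆ S) (z : ℂ) {ε : ℝ}
    (hε : 0 < ε) : ∃ r > 0, ∀ s ∈ Icc a b, ∀ t ∈ Icc a b, s ≤ t → t - s < r →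
      ‖transfer 𝔄 s t z 0 0 - 1 + I * z * mass (transfer 𝔄 s t)‖ ≤
        ε * mass (transfer 𝔄 s t) ∧
      ‖transfer 𝔄 s t z 1 1 - 1 - I * z * mass (transfer 𝔄 s t)‖ ≤
        ε * mass (transfer 𝔄 s t) ∧
      ‖transfer 𝔄 s t z 0 1 - star (transfer 𝔄 s t I 1 0) * (1 + I * z) / 2‖ ≤
        ε * mass (transfer 𝔄 s t) ∧
      ‖transfer 𝔄 s t z 1 0 - transfer 𝔄 s t I 1 0 * (1 - I * z) / 2‖ ≤
        ε * mass (transfer 𝔄 s t) := by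
  obtain ⟨R, hR, δ₀, hδ₀, key⟩ := IsArovInner.exists_norm_sub_affine_le z hε
  obtain ⟨r₁, hr₁, hnear⟩ := h.exists_nearOne hab R
  have hu := isCompact_Icc.uniformContinuousOn_of_continuous (h.continuousOn_logDiag.mono hab)
  rw [Metric.uniformContinuousOn_iff] at hu
  obtain ⟨r₂, hr₂, hm⟩ := hu δ₀ hδ₀
  refine ⟨min r₁ r₂, lt_min hr₁ hr₂, fun s hs t ht hst hlt => ?_⟩
  have habs : |t - s| = t - s := abs_of_nonneg (by linarith)
  refine key _ (h.isArovInner_transfer (hab hs) (hab ht) hst)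
    (hnear s hs t ht (by rw [habs]; exact hlt.trans_le (min_le_left _ _))) ?_
  rw [h.mass_transfer (hab hs) (hab ht)]
  have := hm t ht s hs (by rw [Real.dist_eq, habs]; exact hlt.trans_le (min_le_right _ _))
  rw [Real.dist_eq] at this
  exact (le_abs_self _).trans this.le

end IsArovFamily

/-! ### Functions with negligible increments -/

/-- If the increments of `Φ` are uniformly small compared to those of `g`, then `Φ` takes the
same value at both end points. -/
theorem eq_of_increments_le {E : Type*} [NormedAddCommGroup E] {Φ : ℝ → E} {g : ℝ → ℝ} {a b : ℝ}
    (hab : a ≤ b)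
    (h : ∀ ε > 0, ∃ r > 0, ∀ s ∈ Icc a b, ∀ t ∈ Icc a b, s ≤ t → t - s < r →
      ‖Φ t - Φ s‖ ≤ ε * (g t - g s)) : Φ b = Φ a := by
  have key : ∀ ε > 0, ‖Φ b - Φ a‖ ≤ ε * (g b - g a) := by
    intro ε hε
    obtain ⟨r, hr, hr'⟩ := h ε hε
    -- A uniform partition of mesh below r; the increments of both Φ and g telescope.
    obtain ⟨n, hn⟩ := exists_nat_gt ((b - a) / r)
    have hn0 : (0 : ℝ) < n := lt_of_le_of_lt (div_nonneg (by linarith) hr.le) hn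
    set p : ℕ → ℝ := fun k => a + k * ((b - a) / n) with hp
    have hp0 : p 0 = a := by simp [hp]
    have hpn : p n = b := by simp only [hp]; field_simp; ring
    have hstep : ∀ k, p (k + 1) - p k = (b - a) / n := fun k => by
      simp only [hp]; push_cast; ring
    have hmem : ∀ k ≤ n, p k ∈ Icc a b := fun k hk => by
      have hk' : (k : ℝ) ≤ n := by exact_mod_cast hk
      have h0 : 0 ≤ (b - a) / n := div_nonneg (by linarith) hn0.le
      refine ⟨by simp only [hp]; nlinarith [(Nat.cast_nonneg k : (0 : ℝ) ≤ k)], ?_⟩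
      calc p k ≤ a + n * ((b - a) / n) := by simp only [hp]; gcongr
        _ = b := hpn
    have hsum : ‖∑ k ∈ Finset.range n, (Φ (p (k + 1)) - Φ (p k))‖ ≤
        ∑ k ∈ Finset.range n, ε * (g (p (k + 1)) - g (p k)) := by
      refine (norm_sum_le _ _).trans (Finset.sum_le_sum fun k hk => ?_)
      have hk' := Finset.mem_range.1 hk
      have h0 : 0 ≤ (b - a) / n := div_nonneg (by linarith) hn0.le
      refine hr' _ (hmem k hk'.le) _ (hmem (k + 1) hk') (by linarith [hstep k]) ?_
      rw [hstep, div_lt_iff₀ hn0]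
      rwa [div_lt_iff₀ hr, mul_comm] at hn
    rwa [Finset.sum_range_sub (fun k => Φ (p k)), ← Finset.mul_sum,
      Finset.sum_range_sub (fun k => g (p k)), hp0, hpn] at hsum
  have hlim : Tendsto (fun ε : ℝ => ε * (g b - g a)) (𝓝[>] 0) (𝓝 0) := by
    have : Continuous fun ε : ℝ => ε * (g b - g a) := by fun_prop
    simpa using (this.tendsto 0).mono_left nhdsWithin_le_nhds
  have hle : ‖Φ b - Φ a‖ ≤ 0 :=
    ge_of_tendsto hlim (eventually_nhdsWithin_of_forall fun ε hε => key ε hε)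
  exact sub_eq_zero.1 (norm_le_zero_iff.1 hle)

/-! ### Continuous measures on an interval -/

/-- A Borel measure carried by `S`, without atoms and finite on compact subintervals of `S`. -/
structure IsContinuousMeasure (S : Set ℝ) (μ : Measure ℝ) : Prop where
  carried : μ Sᶜ = 0
  continuous : ∀ t, μ {t} = 0
  finite : ∀ a ∈ S, ∀ b ∈ S, μ (Icc a b) < ⊤

/-- The fundamental theorem of calculus for complex valued Lipschitz functions. -/
theorem integral_deriv_eq_sub_of_lipschitzOnWith {k : ℝ → ℂ} {K : NNReal} {a b : ℝ}
    (hk : LipschitzOnWith K k (uIcc a b)) : ∫ x in a..b, deriv k x = k b - k a := by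
  have h1 : AbsolutelyContinuousOnInterval (fun x => (k x).re) a b :=
    LipschitzOnWith.absolutelyContinuousOnInterval (K := 1 * K)
      (reCLM.lipschitz.weaken (by simp)|>.comp_lipschitzOnWith hk)
  have h2 : AbsolutelyContinuousOnInterval (fun x => (k x).im) a b :=
    LipschitzOnWith.absolutelyContinuousOnInterval (K := 1 * K)
      (imCLM.lipschitz.weaken (by simp)|>.comp_lipschitzOnWith hk)
  have hae : ∫ x in a..b, deriv k x =
      ∫ x in a..b, (((deriv (fun x => (k x).re) x : ℝ) : ℂ) +
        ((deriv (fun x => (k x).im) x : ℝ) : ℂ) * I) := by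
    apply intervalIntegral.integral_congr_ae
    filter_upwards [h1.ae_differentiableAt, h2.ae_differentiableAt] with x hx1 hx2 hx
    have hx' := uIoc_subset_uIcc hx
    have hd := ((hx1 hx').hasDerivAt.ofReal_comp).add ((hx2 hx').hasDerivAt.ofReal_comp.mul_const I)
    refine HasDerivAt.deriv ?_
    convert! hd using 1
    funext y
    simp [re_add_im]
  rw [hae, intervalIntegral.integral_add, intervalIntegral.integral_mul_const,
    intervalIntegral.integral_ofReal, intervalIntegral.integral_ofReal,
    h1.integral_deriv_eq_sub, h2.integral_deriv_eq_sub]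
  · apply Complex.ext <;> simp
  · exact ⟨h1.intervalIntegrable_deriv.1.ofReal, h1.intervalIntegrable_deriv.2.ofReal⟩
  · exact IntervalIntegrable.mul_const
      ⟨h2.intervalIntegrable_deriv.1.ofReal, h2.intervalIntegrable_deriv.2.ofReal⟩ I

/-! ### Change of variable by a continuous monotone function -/

section Pullback

variable {S : Set ℝ} {m : ℝ → ℝ}

/-- The measure with distribution function `m`: the image of Lebesgue measure under an inverse
of `m`. -/
def pullbackMeasure (m : ℝ → ℝ) (S : Set ℝ) : Measure ℝ :=
  Measure.map (Function.invFunOn m S) (volume.restrict (m '' S))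

theorem ordConnected_image (hS : S.OrdConnected) (hc : ContinuousOn m S) :
    (m '' S).OrdConnected :=
  ((isPreconnected_iff_ordConnected.2 hS).image m hc).ordConnected

theorem monotoneOn_invFunOn (hm : MonotoneOn m S) :
    MonotoneOn (Function.invFunOn m S) (m '' S) := by
  intro x hx y hy hxy
  by_contra! hlt
  have h1 := hm (Function.invFunOn_mem hy) (Function.invFunOn_mem hx) hlt.le
  rw [Function.invFunOn_eq hx, Function.invFunOn_eq hy] at h1
  rw [le_antisymm hxy h1] at hlt
  exact lt_irrefl _ hlt

theorem aemeasurable_invFunOn (hS : S.OrdConnected) (hc : ContinuousOn m S) (hm : MonotoneOn m S) :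
    AEMeasurable (Function.invFunOn m S) (volume.restrict (m '' S)) :=
  aemeasurable_restrict_of_monotoneOn (ordConnected_image hS hc).measurableSet
    (monotoneOn_invFunOn hm)

theorem Icc_subset_image (hS : S.OrdConnected) (hc : ContinuousOn m S) {a b : ℝ} (ha : a ∈ S)
    (hb : b ∈ S) : Icc (m a) (m b) ⊆ m '' S :=
  (ordConnected_image hS hc).out (mem_image_of_mem m ha) (mem_image_of_mem m hb)

/-- The preimage of [a, b] under a right inverse of m lies between the open and the closed interval
from m(a) to m(b). Which point the inverse selects on a plateau of m affects only the end points, a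
null set. -/
theorem restrict_pullbackMeasure (hS : S.OrdConnected) (hc : ContinuousOn m S)
    (hm : MonotoneOn m S) {a b : ℝ} (ha : a ∈ S) (hb : b ∈ S) :
    (pullbackMeasure m S).restrict (Icc a b) =
      Measure.map (Function.invFunOn m S) (volume.restrict (Ioc (m a) (m b))) := by
  have hJ := (ordConnected_image hS hc).measurableSet
  rw [pullbackMeasure, Measure.restrict_map_of_aemeasurable (aemeasurable_invFunOn hS hc hm)
    measurableSet_Icc, Measure.restrict_restrict' hJ]
  congr 1
  refine Measure.restrict_congr_set ?_
  have hup : Function.invFunOn m S ⁻¹' Icc a b ∩ m '' S ⊆ Icc (m a) (m b) := by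
    rintro x ⟨hx, hxJ⟩
    have h1 := hm ha (Function.invFunOn_mem hxJ) hx.1
    have h2 := hm (Function.invFunOn_mem hxJ) hb hx.2
    rw [Function.invFunOn_eq hxJ] at h1 h2
    exact ⟨h1, h2⟩
  have hlow : Ioo (m a) (m b) ⊆ Function.invFunOn m S ⁻¹' Icc a b ∩ m '' S := by
    intro x hx
    have hxJ := Icc_subset_image hS hc ha hb (Ioo_subset_Icc_self hx)
    refine ⟨⟨?_, ?_⟩, hxJ⟩
    · by_contra! hlt
      have h := hm (Function.invFunOn_mem hxJ) ha hlt.le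
      rw [Function.invFunOn_eq hxJ] at h
      exact absurd hx.1 (not_lt.2 h)
    · by_contra! hlt
      have h := hm hb (Function.invFunOn_mem hxJ) hlt.le
      rw [Function.invFunOn_eq hxJ] at h
      exact absurd hx.2 (not_lt.2 h)
  refine EventuallyLE.antisymm ?_ ?_
  · exact (LE.le.eventuallyLE hup).trans Ioc_ae_eq_Icc.symm.le
  · exact Ioo_ae_eq_Ioc.symm.le.trans (LE.le.eventuallyLE hlow)

theorem pullbackMeasure_Icc (hS : S.OrdConnected) (hc : ContinuousOn m S)
    (hm : MonotoneOn m S) {a b : ℝ} (ha : a ∈ S) (hb : b ∈ S) :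
    pullbackMeasure m S (Icc a b) = ENNReal.ofReal (m b - m a) := by
  have h := congrArg (fun ν => ν univ) (restrict_pullbackMeasure hS hc hm ha hb)
  simp only [Measure.restrict_apply_univ] at h
  rw [h, Measure.map_apply_of_aemeasurable, preimage_univ, Measure.restrict_apply_univ,
    Real.volume_Ioc]
  · exact (aemeasurable_invFunOn hS hc hm).mono_measure (Measure.restrict_mono
      (Ioc_subset_Icc_self.trans (Icc_subset_image hS hc ha hb)) le_rfl)
  · exact MeasurableSet.univ

theorem isContinuousMeasure_pullbackMeasure (hS : S.OrdConnected) (hc : ContinuousOn m S)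
    (hm : MonotoneOn m S) : IsContinuousMeasure S (pullbackMeasure m S) := by
  have hcar : pullbackMeasure m S Sᶜ = 0 := by
    rw [pullbackMeasure, Measure.map_apply_of_aemeasurable (aemeasurable_invFunOn hS hc hm)
      hS.measurableSet.compl, Measure.restrict_apply' (ordConnected_image hS hc).measurableSet]
    have : Function.invFunOn m S ⁻¹' Sᶜ ∩ m '' S = ∅ := by
      rw [eq_empty_iff_forall_notMem]
      rintro x ⟨hx, hxJ⟩
      exact hx (Function.invFunOn_mem hxJ)
    rw [this, measure_empty]
  refine ⟨hcar, fun t => ?_, fun a ha b hb => ?_⟩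
  · by_cases ht : t ∈ S
    · rw [← Icc_self, pullbackMeasure_Icc hS hc hm ht ht, sub_self, ENNReal.ofReal_zero]
    · exact measure_mono_null (singleton_subset_iff.2 ht) hcar
  · rw [pullbackMeasure_Icc hS hc hm ha hb]
    exact ENNReal.ofReal_lt_top

theorem aemeasurable_comp_of_continuousOn (hS : S.OrdConnected) (hc : ContinuousOn m S)
    (μ : Measure ℝ) {G : ℝ → ℂ} (hG : Measurable G) {a b : ℝ} (ha : a ∈ S) (hb : b ∈ S) :
    AEMeasurable (fun t => G (m t)) (μ.restrict (Icc a b)) :=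
  hG.comp_aemeasurable ((hc.mono (hS.out ha hb)).aemeasurable measurableSet_Icc)

theorem integral_pullbackMeasure (hS : S.OrdConnected) (hc : ContinuousOn m S)
    (hm : MonotoneOn m S) {G : ℝ → ℂ} (hG : Measurable G) {a b : ℝ} (ha : a ∈ S) (hb : b ∈ S)
    (hab : a ≤ b) :
    ∫ t in a..b, G (m t) ∂(pullbackMeasure m S) = ∫ x in m a..m b, G x := by
  have hmab : m a ≤ m b := hm ha hb hab
  have : NullSingletonClass (pullbackMeasure m S) :=
    ⟨(isContinuousMeasure_pullbackMeasure hS hc hm).continuous⟩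
  have hσ : AEMeasurable (Function.invFunOn m S) (volume.restrict (Ioc (m a) (m b))) :=
    (aemeasurable_invFunOn hS hc hm).mono_measure (Measure.restrict_mono
      (Ioc_subset_Icc_self.trans (Icc_subset_image hS hc ha hb)) le_rfl)
  have hmeas := aemeasurable_comp_of_continuousOn hS hc (pullbackMeasure m S) hG ha hb
  rw [restrict_pullbackMeasure hS hc hm ha hb] at hmeas
  rw [intervalIntegral.integral_of_le hab, intervalIntegral.integral_of_le hmab,
    ← integral_Icc_eq_integral_Ioc, restrict_pullbackMeasure hS hc hm ha hb,
    integral_map hσ hmeas.aestronglyMeasurable]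
  refine setIntegral_congr_fun measurableSet_Ioc fun x hx => ?_
  rw [Function.invFunOn_eq (Icc_subset_image hS hc ha hb (Ioc_subset_Icc_self hx))]

end Pullback

/-! ### The parameters of a family -/

theorem exp_neg_two_mul_sub_le {x y : ℝ} :
    Real.exp (-2 * x) - Real.exp (-2 * y) ≤ 2 * Real.exp (-2 * x) * (y - x) := by
  have h1 : Real.exp (-2 * y) = Real.exp (-2 * x) * Real.exp (-2 * (y - x)) := by
    rw [← Real.exp_add]; congr 1; ring
  have h2 := Real.add_one_le_exp (-2 * (y - x))
  rw [h1]
  nlinarith [Real.exp_pos (-2 * x)]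

/-- Near x₀ the increments from x₀ have Lipschitz constant 2exp(-2(x₀ - η)); then η tends to 0. -/
theorem norm_deriv_le_of_norm_sub_le_exp {k : ℝ → ℂ} {J : Set ℝ} {x₀ : ℝ} (hJ : J ∈ 𝓝 x₀)
    (hk : ∀ x ∈ J, ∀ y ∈ J, x ≤ y → ‖k y - k x‖ ≤ Real.exp (-2 * x) - Real.exp (-2 * y)) :
    ‖deriv k x₀‖ ≤ 2 * Real.exp (-2 * x₀) := by
  have hx₀ : x₀ ∈ J := mem_of_mem_nhds hJ
  have key : ∀ η > 0, ‖deriv k x₀‖ ≤ 2 * Real.exp (-2 * (x₀ - η)) := by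
    intro η hη
    refine norm_deriv_le_of_lip' (by positivity) ?_
    filter_upwards [hJ, Metric.ball_mem_nhds x₀ hη] with x hx hxη
    rw [mem_ball, Real.dist_eq, abs_lt] at hxη
    rw [Real.norm_eq_abs]
    rcases le_total x x₀ with h | h
    · rw [norm_sub_rev, abs_of_nonpos (by linarith), neg_sub]
      refine (hk x hx x₀ hx₀ h).trans (exp_neg_two_mul_sub_le.trans ?_)
      exact mul_le_mul_of_nonneg_right (mul_le_mul_of_nonneg_left
        (Real.exp_le_exp.2 (by linarith [hxη.1])) zero_le_two) (by linarith)
    · rw [abs_of_nonneg (by linarith)]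
      refine (hk x₀ hx₀ x hx h).trans (exp_neg_two_mul_sub_le.trans ?_)
      exact mul_le_mul_of_nonneg_right (mul_le_mul_of_nonneg_left
        (Real.exp_le_exp.2 (by linarith)) zero_le_two) (by linarith)
  have hlim : Tendsto (fun η : ℝ => 2 * Real.exp (-2 * (x₀ - η))) (𝓝[>] 0)
      (𝓝 (2 * Real.exp (-2 * x₀))) := by
    have : Continuous fun η : ℝ => 2 * Real.exp (-2 * (x₀ - η)) := by fun_prop
    simpa using (this.tendsto 0).mono_left nhdsWithin_le_nhds
  exact ge_of_tendsto hlim (eventually_nhdsWithin_of_forall fun η hη => key η hη)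

/-- A density bounded by one for a function dominated by `exp (-2 x)`. -/
theorem exists_density {k : ℝ → ℂ} {J : Set ℝ} (hJ : J.OrdConnected)
    (hk : ∀ x ∈ J, ∀ y ∈ J, x ≤ y → ‖k y - k x‖ ≤ Real.exp (-2 * x) - Real.exp (-2 * y)) :
    ∃ f : ℝ → ℂ, Measurable f ∧ (∀ x, ‖f x‖ ≤ 1) ∧ ∀ x ∈ J, ∀ y ∈ J, x ≤ y →
      ∫ u in x..y, 2 * f u * (Real.exp (-2 * u) : ℂ) = k y - k x := by
  -- This solves 2g exp(-2u) = k′. The truncation to |g| ≤ 1 makes the bound hold everywhere and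
  -- changes nothing at interior points of J.
  set g : ℝ → ℂ := fun u => deriv k u * (Real.exp (2 * u) / 2 : ℝ) with hg
  have hgm : Measurable g := (measurable_deriv k).mul (by fun_prop)
  have hset : MeasurableSet {u | ‖g u‖ ≤ 1} := measurableSet_le hgm.norm measurable_const
  refine ⟨indicator {u | ‖g u‖ ≤ 1} g, hgm.indicator hset, fun x => ?_, fun x hx y hy hxy => ?_⟩
  · by_cases h : x ∈ {u | ‖g u‖ ≤ 1}
    · rw [indicator_of_mem h]
      exact h
    · rw [indicator_of_notMem h, norm_zero]
      exact zero_le_one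
  · have hsub : Icc x y ⊆ J := hJ.out hx hy
    have hlip : LipschitzOnWith (Real.toNNReal (2 * Real.exp (-2 * x))) k (uIcc x y) := by
      rw [uIcc_of_le hxy]
      have key : ∀ u ∈ Icc x y, ∀ v ∈ Icc x y, u ≤ v →
          ‖k v - k u‖ ≤ 2 * Real.exp (-2 * x) * (v - u) := fun u hu v hv huv => by
        refine (hk u (hsub hu) v (hsub hv) huv).trans (exp_neg_two_mul_sub_le.trans ?_)
        exact mul_le_mul_of_nonneg_right (mul_le_mul_of_nonneg_left
          (Real.exp_le_exp.2 (by linarith [hu.1])) zero_le_two) (by linarith)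
      refine LipschitzOnWith.of_dist_le_mul fun u hu v hv => ?_
      rw [Real.coe_toNNReal _ (by positivity)]
      rcases le_total u v with h | h
      · rw [dist_comm, dist_eq_norm, dist_comm u, Real.dist_eq, abs_of_nonneg (by linarith)]
        exact key u hu v hv h
      · rw [dist_eq_norm, Real.dist_eq, abs_of_nonneg (by linarith)]
        exact key v hv u hu h
    rw [← integral_deriv_eq_sub_of_lipschitzOnWith hlip]
    rw [intervalIntegral.integral_of_le hxy, intervalIntegral.integral_of_le hxy,
      integral_Ioc_eq_integral_Ioo, integral_Ioc_eq_integral_Ioo]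
    refine setIntegral_congr_fun measurableSet_Ioo fun u hu => ?_
    have hd := norm_deriv_le_of_norm_sub_le_exp
      (mem_of_superset (Icc_mem_nhds hu.1 hu.2) hsub) hk
    have hee : Real.exp (-2 * u) * Real.exp (2 * u) = 1 := by
      rw [← Real.exp_add]; simp
    have hmem : u ∈ {u | ‖g u‖ ≤ 1} := by
      simp only [mem_ofPred_eq, hg, norm_mul, norm_real]
      rw [Real.norm_of_nonneg (by positivity)]
      calc ‖deriv k u‖ * (Real.exp (2 * u) / 2)
          ≤ 2 * Real.exp (-2 * u) * (Real.exp (2 * u) / 2) := by gcongr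
        _ = 1 := by linarith
    have hee' : (Real.exp (-2 * u) : ℂ) * (Real.exp (2 * u) : ℂ) = 1 := by
      exact_mod_cast hee
    have hind : indicator {u | ‖g u‖ ≤ 1} g u = deriv k u * (Real.exp (2 * u) / 2 : ℝ) :=
      indicator_of_mem hmem g
    rw [hind]
    push_cast at hee' ⊢
    linear_combination deriv k u * hee'

/-- Parameters `(μ, 𝔞)` matching the values at `i` of a family. -/
structure IsParameter (S : Set ℝ) (𝔄 : ℂ → ℝ → Mat2) (μ : Measure ℝ) (𝔞 : ℝ → ℂ) : Prop where
  measure : IsContinuousMeasure S μ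
  measure_Icc : ∀ a ∈ S, ∀ b ∈ S, a ≤ b → μ.real (Icc a b) = logDiag 𝔄 b - logDiag 𝔄 a
  norm_le : ∀ t, ‖𝔞 t‖ ≤ 1
  aemeasurable : ∀ a ∈ S, ∀ b ∈ S, AEMeasurable 𝔞 (μ.restrict (Icc a b))
  integral : ∀ a ∈ S, ∀ b ∈ S, a ≤ b →
    ∫ t in a..b, 2 * 𝔞 t * (Real.exp (-2 * logDiag 𝔄 t) : ℂ) ∂μ = offDiag 𝔄 b - offDiag 𝔄 a

/-- With x = m(t) as variable, κ becomes a function with a density f against 2exp(-2x)dx. The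
parameters are the pullback of Lebesgue measure and 𝔞 = f ∘ m. -/
theorem IsArovFamily.exists_isParameter {S : Set ℝ} {𝔄 : ℂ → ℝ → Mat2} (h : IsArovFamily S 𝔄) :
    ∃ μ 𝔞, IsParameter S 𝔄 μ 𝔞 := by
  set m := logDiag 𝔄 with hmdef
  have hS := h.ordConnected
  have hc : ContinuousOn m S := h.continuousOn_logDiag
  have hm : MonotoneOn m S := h.monotoneOn_logDiag
  set σ := Function.invFunOn m S
  have hσS : ∀ x ∈ m '' S, σ x ∈ S := fun x hx => Function.invFunOn_mem hx
  have hσm : ∀ x ∈ m '' S, m (σ x) = x := fun x hx => Function.invFunOn_eq hx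
  obtain ⟨f, hfm, hf1, hfi⟩ := exists_density (k := fun x => offDiag 𝔄 (σ x))
    (ordConnected_image hS hc) fun x hx y hy hxy => by
      have := h.norm_offDiag_sub_le (hσS x hx) (hσS y hy) (monotoneOn_invFunOn hm hx hy hxy)
      rwa [← hmdef, hσm x hx, hσm y hy] at this
  -- κ is constant wherever m is, so it does factor through m although m need not be injective.
  have hoff : ∀ t ∈ S, offDiag 𝔄 (σ (m t)) = offDiag 𝔄 t := fun t ht => by
    have hmt := mem_image_of_mem m ht
    rcases le_total (σ (m t)) t with hle | hle
    · have := h.norm_offDiag_sub_le (hσS _ hmt) ht hle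
      rw [← hmdef, hσm _ hmt, sub_self] at this
      exact (sub_eq_zero.1 (norm_le_zero_iff.1 this)).symm
    · have := h.norm_offDiag_sub_le ht (hσS _ hmt) hle
      rw [← hmdef, hσm _ hmt, sub_self] at this
      exact sub_eq_zero.1 (norm_le_zero_iff.1 this)
  refine ⟨pullbackMeasure m S, fun t => f (m t), isContinuousMeasure_pullbackMeasure hS hc hm,
    fun a ha b hb hab => ?_, fun t => hf1 _, fun a ha b hb =>
      aemeasurable_comp_of_continuousOn hS hc _ hfm ha hb, fun a ha b hb hab => ?_⟩
  · rw [measureReal_def, pullbackMeasure_Icc hS hc hm ha hb, ENNReal.toReal_ofReal]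
    exact sub_nonneg.2 (hm ha hb hab)
  · have hG : Measurable fun x : ℝ => 2 * f x * (Real.exp (-2 * x) : ℂ) :=
      (hfm.const_mul 2).mul (by fun_prop)
    rw [integral_pullbackMeasure hS hc hm hG ha hb hab, hfi _ (mem_image_of_mem m ha) _
      (mem_image_of_mem m hb) (hm ha hb hab), hoff a ha, hoff b hb]

/-! ### The canonical system solved by a family -/

/-- The coefficient matrix `i z A - B` of the canonical system. -/
def coeffM (𝔞 : ℝ → ℂ) (z : ℂ) (t : ℝ) : Mat2 := (I * z) • coeffA 𝔞 t - coeffB 𝔞 t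

theorem coeffM_apply (𝔞 : ℝ → ℂ) (z : ℂ) (t : ℝ) :
    coeffM 𝔞 z t 0 0 = I * z ∧ coeffM 𝔞 z t 0 1 = -(1 + I * z) * star (𝔞 t) ∧
      coeffM 𝔞 z t 1 0 = (1 - I * z) * 𝔞 t ∧ coeffM 𝔞 z t 1 1 = I * z := by
  refine ⟨?_, ?_, ?_, ?_⟩ <;> simp [coeffM, coeffA, coeffB] <;> ring

theorem norm_coeffM_le {𝔞 : ℝ → ℂ} {t : ℝ} (h : ‖𝔞 t‖ ≤ 1) (z : ℂ) (i k : Fin 2) :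
    ‖coeffM 𝔞 z t i k‖ ≤ 1 + ‖z‖ := by
  obtain ⟨h00, h01, h10, h11⟩ := coeffM_apply 𝔞 z t
  have hI : ‖I * z‖ = ‖z‖ := by rw [norm_mul, norm_I, one_mul]
  have hplus : ‖1 + I * z‖ ≤ 1 + ‖z‖ := by simpa [hI] using norm_add_le 1 (I * z)
  have hminus : ‖1 - I * z‖ ≤ 1 + ‖z‖ := by simpa [hI] using norm_sub_le 1 (I * z)
  have hz := norm_nonneg z
  fin_cases i <;> fin_cases k
  · exact (congrArg norm h00).trans_le (by rw [hI]; linarith)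
  · refine (congrArg norm h01).trans_le ?_
    rw [norm_mul, norm_neg, norm_star]
    exact (mul_le_of_le_one_right (norm_nonneg _) h).trans hplus
  · refine (congrArg norm h10).trans_le ?_
    rw [norm_mul]
    exact (mul_le_of_le_one_right (norm_nonneg _) h).trans hminus
  · exact (congrArg norm h11).trans_le (by rw [hI]; linarith)

theorem aemeasurable_coeffM {𝔞 : ℝ → ℂ} {ν : Measure ℝ} (h : AEMeasurable 𝔞 ν) (z : ℂ)
    (i k : Fin 2) : AEMeasurable (fun t => coeffM 𝔞 z t i k) ν := by
  have hstar : AEMeasurable (fun t => star (𝔞 t)) ν := continuous_star.measurable.comp_aemeasurable h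
  fin_cases i <;> fin_cases k
  · exact aemeasurable_const.congr (ae_of_all _ fun t => (coeffM_apply 𝔞 z t).1.symm)
  · exact (hstar.const_mul _).congr (ae_of_all _ fun t => (coeffM_apply 𝔞 z t).2.1.symm)
  · exact (h.const_mul _).congr (ae_of_all _ fun t => (coeffM_apply 𝔞 z t).2.2.1.symm)
  · exact aemeasurable_const.congr (ae_of_all _ fun t => (coeffM_apply 𝔞 z t).2.2.2.symm)

namespace IsContinuousMeasure

variable {S : Set ℝ} {μ : Measure ℝ}

theorem nullSingletonClass (hμ : IsContinuousMeasure S μ) : NullSingletonClass μ :=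
  ⟨hμ.continuous⟩

theorem integrableOn_of_norm_le (hμ : IsContinuousMeasure S μ) {a b : ℝ} (ha : a ∈ S) (hb : b ∈ S)
    {f : ℝ → ℂ} (hf : AEMeasurable f (μ.restrict (Icc a b))) {B : ℝ}
    (hB : ∀ t ∈ Icc a b, ‖f t‖ ≤ B) : IntegrableOn f (Icc a b) μ := by
  have : IsFiniteMeasure (μ.restrict (Icc a b)) :=
    ⟨by rw [Measure.restrict_apply_univ]; exact hμ.finite a ha b hb⟩
  exact Integrable.of_bound hf.aestronglyMeasurable B
    ((ae_restrict_iff' measurableSet_Icc).2 (ae_of_all _ hB))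

theorem intervalIntegrable {f : ℝ → ℂ}
    (hf : ∀ a ∈ S, ∀ b ∈ S, IntegrableOn f (Icc a b) μ) {a b : ℝ} (ha : a ∈ S) (hb : b ∈ S) :
    IntervalIntegrable f μ a b :=
  ⟨(hf a ha b hb).mono_set Ioc_subset_Icc_self, (hf b hb a ha).mono_set Ioc_subset_Icc_self⟩

theorem norm_integral_le (hμ : IsContinuousMeasure S μ) {a b : ℝ} (ha : a ∈ S) (hb : b ∈ S)
    (hab : a ≤ b) {f : ℝ → ℂ} {B : ℝ} (hB : ∀ t ∈ Icc a b, ‖f t‖ ≤ B) :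
    ‖∫ t in a..b, f t ∂μ‖ ≤ B * μ.real (Icc a b) := by
  have := hμ.nullSingletonClass
  rw [intervalIntegral.integral_of_le hab, ← integral_Icc_eq_integral_Ioc]
  exact norm_setIntegral_le_of_norm_le_const (hμ.finite a ha b hb) hB

theorem integral_const (hμ : IsContinuousMeasure S μ) {a b : ℝ} (hab : a ≤ b) (c : ℂ) :
    ∫ _ in a..b, c ∂μ = μ.real (Icc a b) * c := by
  have := hμ.nullSingletonClass
  rw [intervalIntegral.integral_of_le hab, ← integral_Icc_eq_integral_Ioc, setIntegral_const,
    real_smul]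

end IsContinuousMeasure

namespace IsParameter

variable {S : Set ℝ} {𝔄 : ℂ → ℝ → Mat2} {μ : Measure ℝ} {𝔞 : ℝ → ℂ}

theorem integrableOn_coeffM (hp : IsParameter S 𝔄 μ 𝔞) (z : ℂ) (i k : Fin 2) :
    ∀ a ∈ S, ∀ b ∈ S, IntegrableOn (fun t => coeffM 𝔞 z t i k) (Icc a b) μ := fun a ha b hb =>
  hp.measure.integrableOn_of_norm_le ha hb (aemeasurable_coeffM (hp.aemeasurable a ha b hb) z i k)
    fun t _ => norm_coeffM_le (hp.norm_le t) z i k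

theorem integrableOn_mul_coeffM (hp : IsParameter S 𝔄 μ 𝔞) (h : IsArovFamily S 𝔄) (z : ℂ)
    (i l k : Fin 2) :
    ∀ a ∈ S, ∀ b ∈ S, IntegrableOn (fun t => 𝔄 z t i l * coeffM 𝔞 z t l k) (Icc a b) μ := by
  intro a ha b hb
  have hab := h.ordConnected.out ha hb
  obtain ⟨B, hB⟩ := h.exists_norm_entry_le hab ‖z‖
  refine hp.measure.integrableOn_of_norm_le ha hb (B := B * (1 + ‖z‖)) ?_ fun t ht => ?_
  · exact (((h.continuousOn_entry z i l).mono hab).aemeasurable measurableSet_Icc).mul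
      (aemeasurable_coeffM (hp.aemeasurable a ha b hb) z l k)
  · rw [norm_mul]
    exact mul_le_mul (hB t ht z le_rfl i l) (norm_coeffM_le (hp.norm_le t) z l k) (norm_nonneg _)
      B.2

theorem integrableOn_param (hp : IsParameter S 𝔄 μ 𝔞) :
    ∀ a ∈ S, ∀ b ∈ S, IntegrableOn 𝔞 (Icc a b) μ := fun a ha b hb =>
  hp.measure.integrableOn_of_norm_le ha hb (hp.aemeasurable a ha b hb) fun t _ => hp.norm_le t

theorem intervalIntegral_star (μ : Measure ℝ) (𝔞 : ℝ → ℂ) (s t : ℝ) :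
    ∫ ξ in s..t, star (𝔞 ξ) ∂μ = star (∫ ξ in s..t, 𝔞 ξ ∂μ) := by
  simp only [intervalIntegral, star_def, integral_conj, map_sub]

/-- The off-diagonal entry at `i` of a transfer matrix is approximately `-2 ∫ 𝔞 dμ`. -/
theorem norm_transfer_add_integral_le (hp : IsParameter S 𝔄 μ 𝔞) (h : IsArovFamily S 𝔄) {s t : ℝ}
    (hs : s ∈ S) (ht : t ∈ S) (hst : s ≤ t) (h1 : logDiag 𝔄 t - logDiag 𝔄 s ≤ 1) :
    ‖transfer 𝔄 s t I 1 0 / 2 + ∫ ξ in s..t, 𝔞 ξ ∂μ‖ ≤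
      2 * (logDiag 𝔄 t - logDiag 𝔄 s) * (logDiag 𝔄 t - logDiag 𝔄 s) := by
  set m := logDiag 𝔄 with hm
  have hsub := h.ordConnected.out hs ht
  have hmono : ∀ ξ ∈ Icc s t, m s ≤ m ξ ∧ m ξ ≤ m t := fun ξ hξ =>
    ⟨h.monotoneOn_logDiag hs (hsub hξ) hξ.1, h.monotoneOn_logDiag (hsub hξ) ht hξ.2⟩
  have hint1 : IntervalIntegrable 𝔞 μ s t :=
    IsContinuousMeasure.intervalIntegrable hp.integrableOn_param hs ht
  have hint2 : IntervalIntegrable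
      (fun ξ => -(𝔞 ξ * (Real.exp (m s + m t - 2 * m ξ) : ℂ))) μ s t := by
    refine IsContinuousMeasure.intervalIntegrable (S := S) (fun a ha b hb => ?_) hs ht
    have hab := h.ordConnected.out ha hb
    obtain ⟨M, hM⟩ := isCompact_Icc.exists_bound_of_continuousOn
      (h.continuousOn_logDiag.mono hab)
    refine hp.measure.integrableOn_of_norm_le ha hb
      (B := 1 * Real.exp (m s + m t + 2 * M)) ?_ fun ξ hξ => ?_
    · refine ((hp.aemeasurable a ha b hb).mul ?_).neg
      have hmm : AEMeasurable m (μ.restrict (Icc a b)) :=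
        (h.continuousOn_logDiag.mono hab).aemeasurable measurableSet_Icc
      exact (Complex.measurable_ofReal.comp Real.measurable_exp).comp_aemeasurable
        (aemeasurable_const.sub (hmm.const_mul 2))
    · rw [norm_neg, norm_mul, norm_real, Real.norm_of_nonneg (Real.exp_pos _).le]
      refine mul_le_mul (hp.norm_le ξ) (Real.exp_le_exp.2 ?_) (Real.exp_pos _).le zero_le_one
      have := (abs_le.1 (hM ξ hξ)).1
      linarith
  -- Half the entry is -∫ 𝔞(ξ) exp(m(s) + m(t) - 2m(ξ)) dμ. The exponent is at most m(t) - m(s) in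
  -- modulus, so the difference is of second order.
  have hid : transfer 𝔄 s t I 1 0 / 2 + ∫ ξ in s..t, 𝔞 ξ ∂μ =
      ∫ ξ in s..t, (𝔞 ξ + -(𝔞 ξ * (Real.exp (m s + m t - 2 * m ξ) : ℂ))) ∂μ := by
    rw [intervalIntegral.integral_add hint1 hint2, intervalIntegral.integral_neg,
      h.transfer_I_one_zero hs ht, ← hp.integral s hs t ht hst, ← hm,
      ← intervalIntegral.integral_const_mul, add_comm, neg_div,
      ← intervalIntegral.integral_div]
    congr 2
    refine intervalIntegral.integral_congr fun ξ _ => ?_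
    have : Real.exp (m s + m t - 2 * m ξ) = Real.exp (m s + m t) * Real.exp (-2 * m ξ) := by
      rw [← Real.exp_add]; congr 1; ring
    simp only [this, ofReal_mul]
    ring
  have hmst := (hmono s ⟨le_rfl, hst⟩).2
  rw [hid]
  have hb := hp.measure.norm_integral_le hs ht hst (B := 2 * (m t - m s))
    (f := fun ξ => 𝔞 ξ + -(𝔞 ξ * (Real.exp (m s + m t - 2 * m ξ) : ℂ))) fun ξ hξ => by
      obtain ⟨u1, u2⟩ := hmono ξ hξ
      have habs : |m s + m t - 2 * m ξ| ≤ m t - m s := by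
        rw [abs_le]; constructor <;> linarith
      have he := Real.abs_exp_sub_one_le (habs.trans h1)
      have : 𝔞 ξ + -(𝔞 ξ * (Real.exp (m s + m t - 2 * m ξ) : ℂ)) =
          -(𝔞 ξ * ((Real.exp (m s + m t - 2 * m ξ) - 1 : ℝ) : ℂ)) := by push_cast; ring
      rw [this, norm_neg, norm_mul, norm_real, Real.norm_eq_abs]
      calc ‖𝔞 ξ‖ * |Real.exp (m s + m t - 2 * m ξ) - 1| ≤ 1 * (2 * (m t - m s)) := by
            refine mul_le_mul (hp.norm_le ξ) (he.trans ?_) (abs_nonneg _) zero_le_one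
            linarith
        _ = 2 * (m t - m s) := one_mul _
  rwa [hp.measure_Icc s hs t ht hst] at hb

/-- The affine approximation has the shape of izA - B with -∫𝔞 dμ in place of half the (1,0) entry
at i. The diagonal needs nothing more; off the diagonal the replacement costs (1 + |z|) · 2δ², with
δ the increment of m. -/
theorem exists_coeff_increment (hp : IsParameter S 𝔄 μ 𝔞) (h : IsArovFamily S 𝔄) {a b : ℝ}
    (hab : Icc a b ⊆ S) (z : ℂ) {ε : ℝ} (hε : 0 < ε) :
    ∃ r > 0, ∀ s ∈ Icc a b, ∀ t ∈ Icc a b, s ≤ t → t - s < r → ∀ l k : Fin 2,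
      ‖((transfer 𝔄 s t z - 1) * jMat) l k - ∫ ξ in s..t, coeffM 𝔞 z ξ l k ∂μ‖ ≤
        ε * (logDiag 𝔄 t - logDiag 𝔄 s) := by
  obtain ⟨r₁, hr₁, key⟩ := h.exists_transfer_approx hab z (half_pos hε)
  have hu := isCompact_Icc.uniformContinuousOn_of_continuous (h.continuousOn_logDiag.mono hab)
  rw [Metric.uniformContinuousOn_iff] at hu
  -- Makes (1 + |z|) · 2δ² ≤ (ε/2)δ; the other half of ε is spent on the affine approximation.
  set δ₀ := min 1 (ε / (4 * (1 + ‖z‖))) with hδ₀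
  have hz := norm_nonneg z
  have hδ₀0 : 0 < δ₀ := lt_min one_pos (by positivity)
  obtain ⟨r₂, hr₂, hm⟩ := hu δ₀ hδ₀0
  refine ⟨min r₁ r₂, lt_min hr₁ hr₂, fun s hs t ht hst hlt => ?_⟩
  obtain ⟨k00, k11, k01, k10⟩ := key s hs t ht hst (hlt.trans_le (min_le_left _ _))
  rw [h.mass_transfer (hab hs) (hab ht)] at k00 k11 k01 k10
  have hmono := h.monotoneOn_logDiag (hab hs) (hab ht) hst
  have hδ := hm t ht s hs (by
    rw [Real.dist_eq, abs_of_nonneg (by linarith)]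
    exact hlt.trans_le (min_le_right _ _))
  rw [Real.dist_eq, abs_of_nonneg (by linarith)] at hδ
  have hδ1 : logDiag 𝔄 t - logDiag 𝔄 s ≤ 1 := hδ.le.trans (min_le_left _ _)
  have hδ2 : logDiag 𝔄 t - logDiag 𝔄 s ≤ ε / (4 * (1 + ‖z‖)) := hδ.le.trans (min_le_right _ _)
  have hq := hp.norm_transfer_add_integral_le h (hab hs) (hab ht) hst hδ1
  have hconst := hp.measure.integral_const hst (I * z)
  rw [hp.measure_Icc s (hab hs) t (hab ht) hst] at hconst
  have hstar := intervalIntegral_star μ 𝔞 s t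
  set δ := logDiag 𝔄 t - logDiag 𝔄 s with hδdef
  have hδ0 : 0 ≤ δ := by linarith
  set Q := ∫ ξ in s..t, 𝔞 ξ ∂μ with hQ
  set C := transfer 𝔄 s t z with hC
  set c₀ := transfer 𝔄 s t I 1 0 with hc₀
  have i00 : ∫ ξ in s..t, coeffM 𝔞 z ξ 0 0 ∂μ = δ * (I * z) := by
    rw [← hconst]
    exact intervalIntegral.integral_congr fun ξ _ => (coeffM_apply 𝔞 z ξ).1
  have i11 : ∫ ξ in s..t, coeffM 𝔞 z ξ 1 1 ∂μ = δ * (I * z) := by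
    rw [← hconst]
    exact intervalIntegral.integral_congr fun ξ _ => (coeffM_apply 𝔞 z ξ).2.2.2
  have i10 : ∫ ξ in s..t, coeffM 𝔞 z ξ 1 0 ∂μ = (1 - I * z) * Q := by
    rw [hQ, ← intervalIntegral.integral_const_mul]
    exact intervalIntegral.integral_congr fun ξ _ => (coeffM_apply 𝔞 z ξ).2.2.1
  have i01 : ∫ ξ in s..t, coeffM 𝔞 z ξ 0 1 ∂μ = -(1 + I * z) * star Q := by
    rw [← hstar, ← intervalIntegral.integral_const_mul]
    exact intervalIntegral.integral_congr fun ξ _ => (coeffM_apply 𝔞 z ξ).2.1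
  have hI : ‖I * z‖ = ‖z‖ := by rw [norm_mul, norm_I, one_mul]
  have hplus : ‖1 + I * z‖ ≤ 1 + ‖z‖ := by simpa [hI] using norm_add_le 1 (I * z)
  have hminus : ‖1 - I * z‖ ≤ 1 + ‖z‖ := by simpa [hI] using norm_sub_le 1 (I * z)
  have hsmall : (1 + ‖z‖) * (2 * δ * δ) ≤ ε / 2 * δ := by
    rw [le_div_iff₀ (by positivity)] at hδ2
    nlinarith
  have hεδ : ε / 2 * δ ≤ ε * δ := by nlinarith
  intro l k
  fin_cases l <;> fin_cases k
  · have : ((C - 1) * jMat) 0 0 - δ * (I * z) = -(C 0 0 - 1 + I * z * δ) := by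
      simp [jMat, Matrix.mul_apply, Fin.sum_univ_two]
      ring
    change ‖((C - 1) * jMat) 0 0 - ∫ ξ in s..t, coeffM 𝔞 z ξ 0 0 ∂μ‖ ≤ ε * δ
    rw [i00, this, norm_neg]
    linarith
  · have : ((C - 1) * jMat) 0 1 - -(1 + I * z) * star Q =
        (C 0 1 - star c₀ * (1 + I * z) / 2) + (1 + I * z) * star (c₀ / 2 + Q) := by
      have h2 : star (c₀ / 2 + Q) = star c₀ / 2 + star Q := by
        rw [star_add, star_div₀, star_ofNat]
      rw [h2]
      simp [jMat, Matrix.mul_apply, Fin.sum_univ_two]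
      ring
    change ‖((C - 1) * jMat) 0 1 - ∫ ξ in s..t, coeffM 𝔞 z ξ 0 1 ∂μ‖ ≤ ε * δ
    rw [i01, this]
    refine (norm_add_le _ _).trans ?_
    have h3 : ‖(1 + I * z) * star (c₀ / 2 + Q)‖ ≤ (1 + ‖z‖) * (2 * δ * δ) := by
      rw [norm_mul, norm_star]
      gcongr
    linarith
  · have : ((C - 1) * jMat) 1 0 - (1 - I * z) * Q =
        -((C 1 0 - c₀ * (1 - I * z) / 2) + (1 - I * z) * (c₀ / 2 + Q)) := by
      simp [jMat, Matrix.mul_apply, Fin.sum_univ_two]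
      ring
    change ‖((C - 1) * jMat) 1 0 - ∫ ξ in s..t, coeffM 𝔞 z ξ 1 0 ∂μ‖ ≤ ε * δ
    rw [i10, this, norm_neg]
    refine (norm_add_le _ _).trans ?_
    have h3 : ‖(1 - I * z) * (c₀ / 2 + Q)‖ ≤ (1 + ‖z‖) * (2 * δ * δ) := by
      rw [norm_mul]
      gcongr
    linarith
  · have : ((C - 1) * jMat) 1 1 - δ * (I * z) = C 1 1 - 1 - I * z * δ := by
      simp [jMat, Matrix.mul_apply, Fin.sum_univ_two]
      ring
    change ‖((C - 1) * jMat) 1 1 - ∫ ξ in s..t, coeffM 𝔞 z ξ 1 1 ∂μ‖ ≤ ε * δ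
    rw [i11, this]
    linarith

theorem increment_eq (h : IsArovFamily S 𝔄) {s t : ℝ} (hs : s ∈ S) (z : ℂ) (i k : Fin 2) :
    (𝔄 z t * jMat) i k - (𝔄 z s * jMat) i k =
      𝔄 z s i 0 * ((transfer 𝔄 s t z - 1) * jMat) 0 k +
        𝔄 z s i 1 * ((transfer 𝔄 s t z - 1) * jMat) 1 k := by
  have hmat : 𝔄 z t * jMat - 𝔄 z s * jMat = 𝔄 z s * ((transfer 𝔄 s t z - 1) * jMat) := by
    rw [← mul_assoc, mul_sub, h.mul_transfer hs, mul_one, sub_mul]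
  rw [← Matrix.sub_apply, hmat, Matrix.mul_apply, Fin.sum_univ_two]

theorem integral_mul_coeffM (hp : IsParameter S 𝔄 μ 𝔞) (h : IsArovFamily S 𝔄) (z : ℂ) {s t : ℝ}
    (hs : s ∈ S) (ht : t ∈ S) (i k : Fin 2) :
    ∫ ξ in s..t, (𝔄 z ξ * coeffM 𝔞 z ξ) i k ∂μ =
      ∫ ξ in s..t, 𝔄 z ξ i 0 * coeffM 𝔞 z ξ 0 k ∂μ +
        ∫ ξ in s..t, 𝔄 z ξ i 1 * coeffM 𝔞 z ξ 1 k ∂μ := by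
  rw [← intervalIntegral.integral_add
    (IsContinuousMeasure.intervalIntegrable (hp.integrableOn_mul_coeffM h z i 0 k) hs ht)
    (IsContinuousMeasure.intervalIntegrable (hp.integrableOn_mul_coeffM h z i 1 k) hs ht)]
  refine intervalIntegral.integral_congr fun ξ _ => ?_
  simp only [Matrix.mul_apply, Fin.sum_univ_two]

/-- The difference of the two sides, as a function of the upper end point, has increments negligible
against those of m. On a short interval 𝔄 is frozen at the left end: one error comes from the
transfer matrix, the other from the oscillation of 𝔄. -/
theorem increment_eq_integral (hp : IsParameter S 𝔄 μ 𝔞) (h : IsArovFamily S 𝔄) (z : ℂ) {a b : ℝ}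
    (ha : a ∈ S) (hb : b ∈ S) (hab : a ≤ b) (i k : Fin 2) :
    (𝔄 z b * jMat) i k - (𝔄 z a * jMat) i k =
      ∫ ξ in a..b, (𝔄 z ξ * coeffM 𝔞 z ξ) i k ∂μ := by
  have hsub := h.ordConnected.out ha hb
  have hF : ∀ s ∈ S, ∀ t ∈ S, IntervalIntegrable (fun ξ => (𝔄 z ξ * coeffM 𝔞 z ξ) i k) μ s t := by
    intro s hs t ht
    refine ((IsContinuousMeasure.intervalIntegrable (hp.integrableOn_mul_coeffM h z i 0 k) hs
      ht).add (IsContinuousMeasure.intervalIntegrable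
        (hp.integrableOn_mul_coeffM h z i 1 k) hs ht)).congr fun ξ _ => ?_
    simp only [Matrix.mul_apply, Fin.sum_univ_two]
  have key := eq_of_increments_le (g := logDiag 𝔄) (Φ := fun t => (𝔄 z t * jMat) i k -
    ∫ ξ in a..t, (𝔄 z ξ * coeffM 𝔞 z ξ) i k ∂μ) hab ?_
  · simp only [intervalIntegral.integral_same, sub_zero] at key
    linear_combination key
  intro ε hε
  obtain ⟨B, hB⟩ := h.exists_norm_entry_le hsub ‖z‖
  have hB0 : (0 : ℝ) ≤ B := B.2
  have hz := norm_nonneg z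
  obtain ⟨r₁, hr₁, hinc⟩ := hp.exists_coeff_increment h hsub z
    (ε := ε / (4 * (B + 1))) (by positivity)
  obtain ⟨r₂, hr₂, hcont⟩ := h.exists_forall_norm_sub_lt hsub ‖z‖
    (η := ε / (4 * (1 + ‖z‖))) (by positivity)
  refine ⟨min r₁ r₂, lt_min hr₁ hr₂, fun s hs t ht hst hlt => ?_⟩
  have hmono := h.monotoneOn_logDiag (hsub hs) (hsub ht) hst
  set δ := logDiag 𝔄 t - logDiag 𝔄 s with hδ
  have hδ0 : 0 ≤ δ := by linarith
  have hsplit := intervalIntegral.integral_interval_sub_left (hF a ha t (hsub ht))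
    (hF a ha s (hsub hs))
  have hterm : ∀ l : Fin 2, ‖𝔄 z s i l * ((transfer 𝔄 s t z - 1) * jMat) l k -
      ∫ ξ in s..t, 𝔄 z ξ i l * coeffM 𝔞 z ξ l k ∂μ‖ ≤ ε / 2 * δ := by
    intro l
    have hI1 := IsContinuousMeasure.intervalIntegrable (hp.integrableOn_mul_coeffM h z i l k)
      (hsub hs) (hsub ht)
    have hI2 := (IsContinuousMeasure.intervalIntegrable (hp.integrableOn_coeffM z l k)
      (hsub hs) (hsub ht)).const_mul (𝔄 z s i l)
    have hid : 𝔄 z s i l * ((transfer 𝔄 s t z - 1) * jMat) l k -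
        ∫ ξ in s..t, 𝔄 z ξ i l * coeffM 𝔞 z ξ l k ∂μ =
        𝔄 z s i l * (((transfer 𝔄 s t z - 1) * jMat) l k - ∫ ξ in s..t, coeffM 𝔞 z ξ l k ∂μ) -
        ∫ ξ in s..t, (𝔄 z ξ i l * coeffM 𝔞 z ξ l k - 𝔄 z s i l * coeffM 𝔞 z ξ l k) ∂μ := by
      rw [intervalIntegral.integral_sub hI1 hI2, intervalIntegral.integral_const_mul]
      ring
    rw [hid]
    refine (norm_sub_le _ _).trans ?_
    have b1 : ‖𝔄 z s i l * (((transfer 𝔄 s t z - 1) * jMat) l k -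
        ∫ ξ in s..t, coeffM 𝔞 z ξ l k ∂μ)‖ ≤ ε / 4 * δ := by
      rw [norm_mul]
      calc _ ≤ (B + 1) * (ε / (4 * (B + 1)) * δ) := by
            refine mul_le_mul ((hB s hs z le_rfl i l).trans (by linarith))
              (hinc s hs t ht hst (hlt.trans_le (min_le_left _ _)) l k) (norm_nonneg _)
              (by linarith)
        _ = ε / 4 * δ := by field_simp
    have b2 : ‖∫ ξ in s..t, (𝔄 z ξ i l * coeffM 𝔞 z ξ l k - 𝔄 z s i l * coeffM 𝔞 z ξ l k) ∂μ‖ ≤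
        ε / 4 * δ := by
      have hb2 := hp.measure.norm_integral_le (hsub hs) (hsub ht) hst (B := ε / 4)
        (f := fun ξ => 𝔄 z ξ i l * coeffM 𝔞 z ξ l k - 𝔄 z s i l * coeffM 𝔞 z ξ l k)
        fun ξ hξ => by
          rw [← sub_mul, norm_mul]
          have hξ' : ξ ∈ Icc a b := ⟨hs.1.trans hξ.1, hξ.2.trans ht.2⟩
          calc _ ≤ ε / (4 * (1 + ‖z‖)) * (1 + ‖z‖) := by
                refine mul_le_mul (hcont s hs ξ hξ' ?_ z le_rfl i l).le
                  (norm_coeffM_le (hp.norm_le ξ) z l k) (norm_nonneg _) (by positivity)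
                rw [abs_of_nonneg (by linarith [hξ.1])]
                have := min_le_right r₁ r₂
                linarith [hξ.2]
            _ = ε / 4 := by field_simp
      rwa [hp.measure_Icc s (hsub hs) t (hsub ht) hst] at hb2
    linarith
  have hid : ((𝔄 z t * jMat) i k - ∫ ξ in a..t, (𝔄 z ξ * coeffM 𝔞 z ξ) i k ∂μ) -
      ((𝔄 z s * jMat) i k - ∫ ξ in a..s, (𝔄 z ξ * coeffM 𝔞 z ξ) i k ∂μ) =
      (𝔄 z s i 0 * ((transfer 𝔄 s t z - 1) * jMat) 0 k -
        ∫ ξ in s..t, 𝔄 z ξ i 0 * coeffM 𝔞 z ξ 0 k ∂μ) +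
      (𝔄 z s i 1 * ((transfer 𝔄 s t z - 1) * jMat) 1 k -
        ∫ ξ in s..t, 𝔄 z ξ i 1 * coeffM 𝔞 z ξ 1 k ∂μ) := by
    have e1 := increment_eq h (t := t) (hsub hs) z i k
    have e2 := hp.integral_mul_coeffM h z (hsub hs) (hsub ht) i k
    rw [e2] at hsplit
    linear_combination e1 - hsplit
  rw [hid]
  refine (norm_add_le _ _).trans ?_
  linarith [hterm 0, hterm 1]

theorem posSemidef_coeffA {t : ℝ} (ht : ‖𝔞 t‖ ≤ 1) : (coeffA 𝔞 t).PosSemidef := by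
  -- A = diag(1 - |𝔞|², 0) + vv* with v = (-𝔞̄, 1).
  have hsum : coeffA 𝔞 t = Matrix.diagonal ![((1 - ‖𝔞 t‖ ^ 2 : ℝ) : ℂ), 0] +
      Matrix.vecMulVec ![-star (𝔞 t), 1] (star ![-star (𝔞 t), 1]) := by
    have hsq : star (𝔞 t) * 𝔞 t = ((‖𝔞 t‖ ^ 2 : ℝ) : ℂ) := by
      rw [mul_comm, star_def, mul_conj, normSq_eq_norm_sq]
    ext i k
    fin_cases i <;> fin_cases k
    · simp only [Matrix.add_apply, Matrix.vecMulVec_apply, coeffA]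
      simp at hsq ⊢
      rw [hsq]
      ring
    all_goals
      simp only [Matrix.add_apply, Matrix.vecMulVec_apply, coeffA]
      simp
  rw [hsum]
  refine Matrix.PosSemidef.add ?_ (Matrix.posSemidef_vecMulVec_self_star _)
  refine Matrix.posSemidef_diagonal_iff.2 fun i => ?_
  fin_cases i
  · have : ‖𝔞 t‖ ^ 2 ≤ 1 := pow_le_one₀ (norm_nonneg _) ht
    exact Complex.zero_le_real.2 (sub_nonneg.2 this)
  · simp

theorem isArovSolution (hp : IsParameter S 𝔄 μ 𝔞) (h : IsArovFamily S 𝔄) :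
    IsArovSolution S μ 𝔞 𝔄 where
  system :=
    { carried := hp.measure.carried
      continuous := hp.measure.continuous
      finite := hp.measure.finite
      locInt_P := fun a ha b hb i k => by
        -- The matrix izA - B equals -B at z = 0 and A - B at z = -i, so A is the difference of the
        -- two.
        have h1 := hp.integrableOn_coeffM 0 i k a ha b hb
        have h2 := hp.integrableOn_coeffM (-I) i k a ha b hb
        refine (h2.sub h1).congr (ae_of_all _ fun t => ?_)
        simp [coeffM]
      locInt_Q := fun a ha b hb i k => by
        have h1 := hp.integrableOn_coeffM 0 i k a ha b hb
        refine h1.neg.congr (ae_of_all _ fun t => ?_)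
        simp [coeffM]
      nonneg := ae_of_all _ fun t => posSemidef_coeffA (hp.norm_le t)
      skew := ae_of_all _ fun t => by
        ext i k
        fin_cases i <;> fin_cases k <;> simp [coeffB]
      trace_P := ae_of_all _ fun t => by
        simp [jMat, coeffA, Matrix.trace_fin_two]
      trace_Q := ae_of_all _ fun t => by
        simp [jMat, coeffB, Matrix.trace_fin_two] }
  gauge := ae_of_all _ fun t => by simp [coeffA, coeffB, Matrix.trace_fin_two]
  solves := fun z => by
    refine ⟨fun a ha b hb i k => ?_, fun t ht => ?_⟩
    · refine ((hp.integrableOn_mul_coeffM h z i 0 k a ha b hb).add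
        (hp.integrableOn_mul_coeffM h z i 1 k a ha b hb)).congr (ae_of_all _ fun t => ?_)
      simp only [Pi.add_apply, Matrix.mul_apply, Fin.sum_univ_two, coeffM]
    · ext i k
      have h0 : (𝔄 z 0 * jMat) i k = jMat i k := by rw [h.apply_zero, one_mul]
      rw [Matrix.add_apply, matIntegral, Matrix.of_apply]
      change (𝔄 z t * jMat) i k = jMat i k + ∫ ξ in (0 : ℝ)..t, (𝔄 z ξ * coeffM 𝔞 z ξ) i k ∂μ
      rcases le_total 0 t with hle | hle
      · have := hp.increment_eq_integral h z h.zero_mem ht hle i k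
        linear_combination this + h0
      · have := hp.increment_eq_integral h z ht h.zero_mem hle i k
        rw [intervalIntegral.integral_symm]
        linear_combination h0 - this

end IsParameter

/-! ### Uniqueness of densities -/

/-- Initial segments form a π-system generating the Borel sets, so the integral vanishes over every
measurable set. -/
theorem ae_eq_zero_of_integral_Icc_eq_zero {ν : Measure ℝ} {g : ℝ → ℂ} {a b : ℝ}
    (hg : IntegrableOn g (Icc a b) ν) (h0 : ∀ c ∈ Icc a b, ∫ t in Icc a c, g t ∂ν = 0) :
    ∀ᵐ t ∂ν, t ∈ Icc a b → g t = 0 := by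
  rw [← ae_restrict_iff' measurableSet_Icc]
  rcases lt_or_ge b a with hab | hab
  · simp [Icc_eq_empty_of_lt hab]
  have hIic : ∀ c, ∫ t in Iic c, g t ∂(ν.restrict (Icc a b)) = 0 := by
    intro c
    rw [Measure.restrict_restrict measurableSet_Iic]
    rcases lt_or_ge c a with hca | hca
    · have : Iic c ∩ Icc a b = ∅ := by
        rw [eq_empty_iff_forall_notMem]
        rintro x ⟨h1, h2⟩
        exact absurd (h2.1.trans h1) (not_le.2 hca)
      rw [this, Measure.restrict_empty, integral_zero_measure]
    · have : Iic c ∩ Icc a b = Icc a (min b c) := by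
        ext x
        simp only [mem_inter_iff, mem_Iic, mem_Icc, le_min_iff]
        tauto
      rw [this]
      exact h0 _ ⟨le_min hab hca, min_le_left _ _⟩
  have huniv : ∫ t, g t ∂(ν.restrict (Icc a b)) = 0 := h0 b ⟨hab, le_rfl⟩
  have hall : ∀ s, MeasurableSet s → ∫ t in s, g t ∂(ν.restrict (Icc a b)) = 0 := by
    intro s hs
    induction s, hs using MeasurableSpace.induction_on_inter
      (borel_eq_generateFrom_Iic ℝ ▸ BorelSpace.measurable_eq) isPiSystem_Iic with
    | empty => simp
    | basic t ht =>
      obtain ⟨c, rfl⟩ := ht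
      exact hIic c
    | compl t ht ih =>
      have := integral_add_compl ht hg
      rwa [huniv, ih, zero_add] at this
    | iUnion f hd hf ih =>
      rw [integral_iUnion hf hd hg.integrableOn]
      simp [ih]
  exact Integrable.ae_eq_zero_of_forall_setIntegral_eq_zero hg fun s hs _ => hall s hs

/-- Every point of S other than a greatest or least element lies in an interval with rational end
points in S. There are countably many of these, and the excluded end points are not atoms. -/
theorem IsContinuousMeasure.ae_eq_zero {S : Set ℝ} {μ : Measure ℝ} (hμ : IsContinuousMeasure S μ)
    (hS : S.OrdConnected) {g : ℝ → ℂ} (hg : ∀ a ∈ S, ∀ b ∈ S, IntegrableOn g (Icc a b) μ)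
    (h0 : ∀ a ∈ S, ∀ b ∈ S, ∫ t in a..b, g t ∂μ = 0) : ∀ᵐ t ∂μ, g t = 0 := by
  have := hμ.nullSingletonClass
  have hrat : ∀ᵐ t ∂μ, ∀ p q : ℚ, (p : ℝ) ∈ S → (q : ℝ) ∈ S → t ∈ Icc (p : ℝ) q → g t = 0 := by
    refine ae_all_iff.2 fun p => ae_all_iff.2 fun q => ?_
    by_cases hp : (p : ℝ) ∈ S
    · by_cases hq : (q : ℝ) ∈ S
      · have := ae_eq_zero_of_integral_Icc_eq_zero (hg p hp q hq) fun c hc => by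
          have := h0 p hp c (hS.out hp hq hc)
          rwa [intervalIntegral.integral_of_le hc.1, ← integral_Icc_eq_integral_Ioc] at this
        filter_upwards [this] with t ht _ _ using ht
      · exact ae_of_all _ fun t _ h => absurd h hq
    · exact ae_of_all _ fun t h => absurd h hp
  have hcar : ∀ᵐ t ∂μ, t ∈ S := by
    rw [ae_iff]
    exact hμ.carried
  have hmax : ∀ᵐ t ∂μ, ¬IsGreatest S t := by
    rw [ae_iff]
    simp only [not_not]
    exact Set.Subsingleton.measure_zero (fun x hx y hy => hx.unique hy) μ
  have hmin : ∀ᵐ t ∂μ, ¬IsLeast S t := by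
    rw [ae_iff]
    simp only [not_not]
    exact Set.Subsingleton.measure_zero (fun x hx y hy => hx.unique hy) μ
  filter_upwards [hrat, hcar, hmax, hmin] with t ht htS hM hm
  have hM' : ∃ y ∈ S, t < y := by
    by_contra! hcon
    exact hM ⟨htS, fun y hy => hcon y hy⟩
  have hm' : ∃ y ∈ S, y < t := by
    by_contra! hcon
    exact hm ⟨htS, fun y hy => hcon y hy⟩
  obtain ⟨y, hy, hty⟩ := hM'
  obtain ⟨x, hx, hxt⟩ := hm'
  obtain ⟨p, hp1, hp2⟩ := exists_rat_btwn hxt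
  obtain ⟨q, hq1, hq2⟩ := exists_rat_btwn hty
  exact ht p q (hS.out hx htS ⟨hp1.le, hp2.le⟩) (hS.out htS hy ⟨hq1.le, hq2.le⟩)
    ⟨hp2.le, hq1.le⟩

/-! ### Determination of the parameters -/

theorem mul_jMat_apply (X : Mat2) (i k : Fin 2) :
    (X * jMat) i k = X i k * (![-1, 1] : Fin 2 → ℂ) k := by
  fin_cases k <;> simp [jMat, Matrix.mul_apply, Fin.sum_univ_two]

namespace IsArovSolution

variable {S : Set ℝ} {𝔄 : ℂ → ℝ → Mat2} {μ : Measure ℝ} {𝔞 : ℝ → ℂ}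

theorem isContinuousMeasure (hs : IsArovSolution S μ 𝔞 𝔄) : IsContinuousMeasure S μ :=
  ⟨hs.system.carried, hs.system.continuous, hs.system.finite⟩

/-- The positive matrix A has determinant 1 - |𝔞|². -/
theorem ae_norm_le_one (hs : IsArovSolution S μ 𝔞 𝔄) : ∀ᵐ t ∂μ, ‖𝔞 t‖ ≤ 1 := by
  filter_upwards [hs.system.nonneg] with t ht
  have hdet := (Complex.le_def.1 ht.det_nonneg).1
  rw [Matrix.det_fin_two] at hdet
  have hval : coeffA 𝔞 t 0 0 * coeffA 𝔞 t 1 1 - coeffA 𝔞 t 0 1 * coeffA 𝔞 t 1 0 =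
      ((1 - ‖𝔞 t‖ ^ 2 : ℝ) : ℂ) := by
    have hsq : star (𝔞 t) * 𝔞 t = ((‖𝔞 t‖ ^ 2 : ℝ) : ℂ) := by
      rw [mul_comm, star_def, mul_conj, normSq_eq_norm_sq]
    rw [ofReal_sub, ← hsq]
    simp [coeffA]
  rw [hval, ofReal_re, zero_re] at hdet
  exact (sq_le_one_iff₀ (norm_nonneg _)).1 (by linarith)

theorem integrableOn_param (hs : IsArovSolution S μ 𝔞 𝔄) :
    ∀ a ∈ S, ∀ b ∈ S, IntegrableOn 𝔞 (Icc a b) μ := fun a ha b hb =>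
  (hs.system.locInt_P a ha b hb 1 0).neg.congr (ae_of_all _ fun t => by simp [coeffA])

theorem integrableOn_solution (hs : IsArovSolution S μ 𝔞 𝔄) (z : ℂ) (i k : Fin 2) :
    ∀ a ∈ S, ∀ b ∈ S, IntegrableOn (fun t => (𝔄 z t * coeffM 𝔞 z t) i k) (Icc a b) μ :=
  fun a ha b hb => (hs.solves z).1 a ha b hb i k

theorem increment_eq (hs : IsArovSolution S μ 𝔞 𝔄) (h0 : (0 : ℝ) ∈ S) (z : ℂ) {a b : ℝ}
    (ha : a ∈ S) (hb : b ∈ S) (i k : Fin 2) :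
    (𝔄 z b * jMat) i k - (𝔄 z a * jMat) i k =
      ∫ t in a..b, (𝔄 z t * coeffM 𝔞 z t) i k ∂μ := by
  have hF := fun {s t : ℝ} (hs' : s ∈ S) (ht : t ∈ S) =>
    IsContinuousMeasure.intervalIntegrable (hs.integrableOn_solution z i k) hs' ht
  have key : ∀ t ∈ S, (𝔄 z t * jMat) i k =
      jMat i k + ∫ ξ in (0 : ℝ)..t, (𝔄 z ξ * coeffM 𝔞 z ξ) i k ∂μ := fun t ht =>
    congrFun (congrFun ((hs.solves z).2 t ht) i) k
  rw [key a ha, key b hb, ← intervalIntegral.integral_interval_sub_left (hF h0 hb) (hF h0 ha)]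
  ring

/-- The (0,0) entry of the system at z = i decouples because 𝔄₁₂(i) = 0, leaving d(e^m) = e^m dμ. -/
theorem exp_logDiag_sub (hs : IsArovSolution S μ 𝔞 𝔄) (h : IsArovFamily S 𝔄) {a b : ℝ}
    (ha : a ∈ S) (hb : b ∈ S) :
    (Real.exp (logDiag 𝔄 b) : ℂ) - Real.exp (logDiag 𝔄 a) =
      ∫ t in a..b, (Real.exp (logDiag 𝔄 t) : ℂ) ∂μ := by
  have hinc := hs.increment_eq h.zero_mem I ha hb 0 0
  have hI : ∫ t in a..b, (𝔄 I t * coeffM 𝔞 I t) 0 0 ∂μ =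
      -∫ t in a..b, (Real.exp (logDiag 𝔄 t) : ℂ) ∂μ := by
    rw [← intervalIntegral.integral_neg]
    refine intervalIntegral.integral_congr fun t ht => ?_
    have htS := h.ordConnected.uIcc_subset ha hb ht
    simp only [Matrix.mul_apply, Fin.sum_univ_two]
    rw [(coeffM_apply 𝔞 I t).1, (h.gauge t htS).1, h.apply_I_zero_zero htS, I_mul_I]
    ring
  rw [hI, mul_jMat_apply, mul_jMat_apply, h.apply_I_zero_zero ha, h.apply_I_zero_zero hb] at hinc
  simp only [Matrix.cons_val_zero] at hinc
  linear_combination -hinc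

theorem offDiag_entry_sub (hs : IsArovSolution S μ 𝔞 𝔄) (h : IsArovFamily S 𝔄) {a b : ℝ}
    (ha : a ∈ S) (hb : b ∈ S) :
    𝔄 I b 1 0 - 𝔄 I a 1 0 =
      ∫ t in a..b, (𝔄 I t 1 0 - 2 * 𝔞 t * (Real.exp (-logDiag 𝔄 t) : ℂ)) ∂μ := by
  have hinc := hs.increment_eq h.zero_mem I ha hb 1 0
  have hI : ∫ t in a..b, (𝔄 I t * coeffM 𝔞 I t) 1 0 ∂μ =
      -∫ t in a..b, (𝔄 I t 1 0 - 2 * 𝔞 t * (Real.exp (-logDiag 𝔄 t) : ℂ)) ∂μ := by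
    rw [← intervalIntegral.integral_neg]
    refine intervalIntegral.integral_congr fun t ht => ?_
    have htS := h.ordConnected.uIcc_subset ha hb ht
    simp only [Matrix.mul_apply, Fin.sum_univ_two]
    rw [(coeffM_apply 𝔞 I t).1, (coeffM_apply 𝔞 I t).2.2.1, h.apply_I_one_one htS, I_mul_I]
    ring
  rw [hI, mul_jMat_apply, mul_jMat_apply] at hinc
  simp only [Matrix.cons_val_zero] at hinc
  linear_combination -hinc

end IsArovSolution

/-! ### Integration of the equations at i -/

theorem exists_forall_norm_sub_lt_of_continuousOn {E : Type*} [SeminormedAddCommGroup E]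
    {f : ℝ → E} {a b : ℝ} (hf : ContinuousOn f (Icc a b)) {η : ℝ} (hη : 0 < η) :
    ∃ r > 0, ∀ s ∈ Icc a b, ∀ t ∈ Icc a b, s ≤ t → t - s < r → ‖f t - f s‖ < η := by
  obtain ⟨r, hr, h⟩ := Metric.uniformContinuousOn_iff.1
    (isCompact_Icc.uniformContinuousOn_of_continuous hf) η hη
  refine ⟨r, hr, fun s hs t ht hst hlt => ?_⟩
  rw [← dist_eq_norm]
  exact h t ht s hs (by rwa [Real.dist_eq, abs_of_nonneg (by linarith)])

theorem IsContinuousMeasure.norm_integral_le_of_ae {S : Set ℝ} {μ : Measure ℝ}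
    (hμ : IsContinuousMeasure S μ) {a b : ℝ} (ha : a ∈ S) (hb : b ∈ S) (hab : a ≤ b) {f : ℝ → ℂ}
    {B : ℝ} (hB : ∀ᵐ t ∂μ, t ∈ Icc a b → ‖f t‖ ≤ B) :
    ‖∫ t in a..b, f t ∂μ‖ ≤ B * μ.real (Icc a b) := by
  have := hμ.nullSingletonClass
  rw [intervalIntegral.integral_of_le hab, ← integral_Icc_eq_integral_Ioc]
  exact norm_setIntegral_le_of_norm_le_const_ae' (hμ.finite a ha b hb) hB

theorem IsContinuousMeasure.integrableOn_of_continuousOn {S : Set ℝ} {μ : Measure ℝ}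
    (hμ : IsContinuousMeasure S μ) (hS : S.OrdConnected) {f : ℝ → ℂ} (hf : ContinuousOn f S) :
    ∀ a ∈ S, ∀ b ∈ S, IntegrableOn f (Icc a b) μ := by
  intro a ha b hb
  have hc := hf.mono (hS.out ha hb)
  obtain ⟨B, hB⟩ := isCompact_Icc.exists_bound_of_continuousOn hc
  exact hμ.integrableOn_of_norm_le ha hb (hc.aemeasurable measurableSet_Icc) hB

namespace IsArovSolution

variable {S : Set ℝ} {𝔄 : ℂ → ℝ → Mat2} {μ : Measure ℝ} {𝔞 : ℝ → ℂ}

theorem continuousOn_exp_neg_logDiag (h : IsArovFamily S 𝔄) :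
    ContinuousOn (fun t => (Real.exp (-logDiag 𝔄 t) : ℂ)) S :=
  (Complex.continuous_ofReal.comp Real.continuous_exp).comp_continuousOn h.continuousOn_logDiag.neg

theorem continuousOn_exp_neg_two_mul_logDiag (h : IsArovFamily S 𝔄) :
    ContinuousOn (fun t => (Real.exp (-2 * logDiag 𝔄 t) : ℂ)) S :=
  (Complex.continuous_ofReal.comp Real.continuous_exp).comp_continuousOn
    (continuousOn_const.mul h.continuousOn_logDiag)

/-- Freezing e^m at s in d(e^m) = e^m dμ gives |p - ν| ≤ pν, where p = e^d - 1, d is the increment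
of m and ν the measure of [s,t]. For d ≤ 1/4 this forces pν ≤ 8d², and |p - d| ≤ d² supplies the
ninth d². -/
theorem abs_logDiag_sub_measure_le (hs : IsArovSolution S μ 𝔞 𝔄) (h : IsArovFamily S 𝔄) {s t : ℝ}
    (hsS : s ∈ S) (ht : t ∈ S) (hst : s ≤ t) (hsmall : logDiag 𝔄 t - logDiag 𝔄 s ≤ 1 / 4) :
    |logDiag 𝔄 t - logDiag 𝔄 s - μ.real (Icc s t)| ≤ 9 * (logDiag 𝔄 t - logDiag 𝔄 s) ^ 2 := by
  have hμ := hs.isContinuousMeasure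
  have hexpc : ContinuousOn (fun ξ => (Real.exp (logDiag 𝔄 ξ) : ℂ)) S :=
    (Complex.continuous_ofReal.comp Real.continuous_exp).comp_continuousOn h.continuousOn_logDiag
  have hsub := h.ordConnected.out hsS ht
  have hinc := hs.exp_logDiag_sub h hsS ht
  have hint : IntervalIntegrable (fun ξ => (Real.exp (logDiag 𝔄 ξ) : ℂ)) μ s t :=
    IsContinuousMeasure.intervalIntegrable (hμ.integrableOn_of_continuousOn h.ordConnected hexpc)
      hsS ht
  have hintc : IntervalIntegrable (fun _ => (Real.exp (logDiag 𝔄 s) : ℂ)) μ s t :=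
    IsContinuousMeasure.intervalIntegrable
      (hμ.integrableOn_of_continuousOn h.ordConnected continuousOn_const) hsS ht
  have hbound := hμ.norm_integral_le hsS ht hst
    (f := fun ξ => (Real.exp (logDiag 𝔄 ξ) : ℂ) - Real.exp (logDiag 𝔄 s))
    (B := Real.exp (logDiag 𝔄 t) - Real.exp (logDiag 𝔄 s)) fun ξ hξ => by
      have h1 := Real.exp_le_exp.2 (h.monotoneOn_logDiag hsS (hsub hξ) hξ.1)
      have h2 := Real.exp_le_exp.2 (h.monotoneOn_logDiag (hsub hξ) ht hξ.2)
      rw [← ofReal_sub, norm_real, Real.norm_of_nonneg (by linarith)]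
      linarith
  rw [intervalIntegral.integral_sub hint hintc, ← hinc, hμ.integral_const hst, ← ofReal_sub,
    ← ofReal_mul, ← ofReal_sub, norm_real, Real.norm_eq_abs] at hbound
  have hd0 : 0 ≤ logDiag 𝔄 t - logDiag 𝔄 s := sub_nonneg.2 (h.monotoneOn_logDiag hsS ht hst)
  have hν0 : 0 ≤ μ.real (Icc s t) := measureReal_nonneg
  set d := logDiag 𝔄 t - logDiag 𝔄 s with hd
  set ν := μ.real (Icc s t)
  have hexp : Real.exp (logDiag 𝔄 t) = Real.exp (logDiag 𝔄 s) * Real.exp d := by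
    rw [← Real.exp_add, hd, add_sub_cancel]
  have hpos := Real.exp_pos (logDiag 𝔄 s)
  have hp := abs_le.1 (Real.abs_exp_sub_one_sub_id_le (x := d)
    (by rw [abs_of_nonneg hd0]; linarith))
  have hpd := Real.add_one_le_exp d
  obtain ⟨p, hpdef⟩ : ∃ p, p = Real.exp d - 1 := ⟨_, rfl⟩
  have h1 : |p - ν| ≤ p * ν := by
    refine le_of_mul_le_mul_left ?_ hpos
    rw [← abs_of_pos hpos, ← abs_mul, abs_of_pos hpos]
    calc _ = _ := by rw [hexp, hpdef]; congr 1; ring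
      _ ≤ _ := hbound
      _ = _ := by rw [hexp, hpdef]; ring
  rw [abs_le] at h1 ⊢
  have hp1 : p ≤ 2 * d := by nlinarith
  have hp2 : p ≤ 1 / 2 := by linarith
  have hν : ν ≤ 2 * p := by nlinarith
  have hpν : p * ν ≤ 8 * d ^ 2 := by nlinarith
  constructor <;> nlinarith

theorem measure_Icc (hs : IsArovSolution S μ 𝔞 𝔄) (h : IsArovFamily S 𝔄) {a b : ℝ}
    (ha : a ∈ S) (hb : b ∈ S) (hab : a ≤ b) :
    μ.real (Icc a b) = logDiag 𝔄 b - logDiag 𝔄 a := by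
  have hμ := hs.isContinuousMeasure
  have hsub := h.ordConnected.out ha hb
  have hone := hμ.integrableOn_of_continuousOn h.ordConnected (f := fun _ => (1 : ℂ))
    continuousOn_const
  have key := eq_of_increments_le (g := logDiag 𝔄)
    (Φ := fun t => (logDiag 𝔄 t : ℂ) - ∫ _ in a..t, (1 : ℂ) ∂μ) hab ?_
  · simp only [intervalIntegral.integral_same, hμ.integral_const hab, sub_zero, mul_one] at key
    have := congrArg re key
    simp only [sub_re, ofReal_re] at this
    linarith
  intro ε hε
  obtain ⟨r, hr, hr'⟩ := exists_forall_norm_sub_lt_of_continuousOn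
    (h.continuousOn_logDiag.mono hsub) (η := min (1 / 4) (ε / 9)) (by positivity)
  refine ⟨r, hr, fun s hsI t ht hst hlt => ?_⟩
  have hd0 : 0 ≤ logDiag 𝔄 t - logDiag 𝔄 s :=
    sub_nonneg.2 (h.monotoneOn_logDiag (hsub hsI) (hsub ht) hst)
  have hd := hr' s hsI t ht hst hlt
  rw [Real.norm_of_nonneg hd0] at hd
  have h1 := hd.le.trans (min_le_left _ _)
  have h2 := hd.le.trans (min_le_right _ _)
  have hbound := hs.abs_logDiag_sub_measure_le h (hsub hsI) (hsub ht) hst h1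
  have hsplit := intervalIntegral.integral_interval_sub_left
    (IsContinuousMeasure.intervalIntegrable hone ha (hsub ht))
    (IsContinuousMeasure.intervalIntegrable hone ha (hsub hsI))
  have hinc : (logDiag 𝔄 t : ℂ) - ∫ _ in a..t, (1 : ℂ) ∂μ -
      ((logDiag 𝔄 s : ℂ) - ∫ _ in a..s, (1 : ℂ) ∂μ) =
      ((logDiag 𝔄 t - logDiag 𝔄 s - μ.real (Icc s t) : ℝ) : ℂ) := by
    rw [hμ.integral_const hst] at hsplit
    push_cast
    linear_combination -hsplit
  rw [hinc, norm_real, Real.norm_eq_abs]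
  refine hbound.trans ?_
  nlinarith

theorem distrib_eq (hs : IsArovSolution S μ 𝔞 𝔄) (h : IsArovFamily S 𝔄) {t : ℝ} (ht : t ∈ S) :
    distrib μ t = logDiag 𝔄 t := by
  have hnull := hs.isContinuousMeasure.nullSingletonClass
  have hIco : ∀ a b : ℝ, μ.real (Ico a b) = μ.real (Icc a b) := fun a b =>
    measureReal_congr Ico_ae_eq_Icc
  rw [distrib, hIco, hIco]
  split_ifs with h0
  · rw [hs.measure_Icc h h.zero_mem ht h0, h.logDiag_zero, sub_zero]
  · rw [hs.measure_Icc h ht h.zero_mem (not_le.1 h0).le, h.logDiag_zero]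
    ring

theorem integrableOn_param_mul (hs : IsArovSolution S μ 𝔞 𝔄) (hS : S.OrdConnected) {f : ℝ → ℂ}
    (hf : ContinuousOn f S) : ∀ a ∈ S, ∀ b ∈ S, IntegrableOn (fun t => 2 * 𝔞 t * f t) (Icc a b) μ :=
  fun a ha b hb => IntegrableOn.mul_continuousOn ((hs.integrableOn_param a ha b hb).const_mul 2)
    (hf.mono (hS.out ha hb)) isCompact_Icc

/-- A discrete product rule for κ = -𝔄₂₁(i)e^{-m}. The terms on the right are products of
oscillations over [s,t] with the increment of m, or second-order remainders of the exponential, so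
all are negligible. -/
theorem offDiag_increment_eq (hs : IsArovSolution S μ 𝔞 𝔄) (h : IsArovFamily S 𝔄) {s t : ℝ}
    (hsS : s ∈ S) (ht : t ∈ S) (hst : s ≤ t) :
    offDiag 𝔄 t - offDiag 𝔄 s - ∫ ξ in s..t, 2 * 𝔞 ξ * (Real.exp (-2 * logDiag 𝔄 ξ) : ℂ) ∂μ =
      (∫ ξ in s..t, (-(Real.exp (-logDiag 𝔄 t) : ℂ) * (𝔄 I ξ 1 0 - 𝔄 I s 1 0) +
        2 * 𝔞 ξ * (Real.exp (-logDiag 𝔄 ξ) : ℂ) *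
          ((Real.exp (-logDiag 𝔄 t) : ℂ) - Real.exp (-logDiag 𝔄 ξ))) ∂μ) +
      (Real.exp (-logDiag 𝔄 t) : ℂ) * 𝔄 I s 1 0 *
        ((Real.exp (logDiag 𝔄 t - logDiag 𝔄 s) - 1 - (logDiag 𝔄 t - logDiag 𝔄 s) : ℝ) : ℂ) := by
  have hμ := hs.isContinuousMeasure
  have hT := h.continuousOn_entry I 1 0
  have hE := continuousOn_exp_neg_logDiag h
  have hconst := hμ.integral_const hst (𝔄 I s 1 0)
  rw [hs.measure_Icc h hsS ht hst] at hconst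
  have hii : ∀ {f : ℝ → ℂ}, ContinuousOn f S → IntervalIntegrable f μ s t := fun hf =>
    IsContinuousMeasure.intervalIntegrable (hμ.integrableOn_of_continuousOn h.ordConnected hf)
      hsS ht
  have hia : ∀ {f : ℝ → ℂ}, ContinuousOn f S →
      IntervalIntegrable (fun ξ => 2 * 𝔞 ξ * f ξ) μ s t := fun hf =>
    IsContinuousMeasure.intervalIntegrable (hs.integrableOn_param_mul h.ordConnected hf) hsS ht
  have hinc := hs.offDiag_entry_sub h hsS ht
  rw [intervalIntegral.integral_sub (hii hT) (hia hE)] at hinc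
  have hsplit : ∫ ξ in s..t, (-(Real.exp (-logDiag 𝔄 t) : ℂ) * (𝔄 I ξ 1 0 - 𝔄 I s 1 0) +
        2 * 𝔞 ξ * (Real.exp (-logDiag 𝔄 ξ) : ℂ) *
          ((Real.exp (-logDiag 𝔄 t) : ℂ) - Real.exp (-logDiag 𝔄 ξ))) ∂μ =
      -(Real.exp (-logDiag 𝔄 t) : ℂ) *
          ((∫ ξ in s..t, 𝔄 I ξ 1 0 ∂μ) - ∫ ξ in s..t, 𝔄 I s 1 0 ∂μ) +
        ((Real.exp (-logDiag 𝔄 t) : ℂ) *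
          (∫ ξ in s..t, 2 * 𝔞 ξ * (Real.exp (-logDiag 𝔄 ξ) : ℂ) ∂μ) -
        ∫ ξ in s..t, 2 * 𝔞 ξ * (Real.exp (-2 * logDiag 𝔄 ξ) : ℂ) ∂μ) := by
    have hE2 := continuousOn_exp_neg_two_mul_logDiag h
    rw [← intervalIntegral.integral_sub (hii hT) (hii continuousOn_const),
      ← intervalIntegral.integral_const_mul, ← intervalIntegral.integral_const_mul,
      ← intervalIntegral.integral_sub ((hia hE).const_mul _) (hia hE2),
      ← intervalIntegral.integral_add (((hii hT).sub (hii continuousOn_const)).const_mul _)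
        (((hia hE).const_mul _).sub (hia hE2))]
    refine intervalIntegral.integral_congr fun ξ _ => ?_
    have : Real.exp (-2 * logDiag 𝔄 ξ) = Real.exp (-logDiag 𝔄 ξ) * Real.exp (-logDiag 𝔄 ξ) := by
      rw [← Real.exp_add]; congr 1; ring
    simp only [this, ofReal_mul]
    ring
  have hexp : (Real.exp (-logDiag 𝔄 s) : ℂ) =
      Real.exp (-logDiag 𝔄 t) * Real.exp (logDiag 𝔄 t - logDiag 𝔄 s) := by
    rw [← ofReal_mul, ← Real.exp_add]; congr 2; ring
  rw [hsplit, hconst, offDiag, offDiag, hexp]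
  push_cast
  push_cast at hinc
  linear_combination -(cexp (-(logDiag 𝔄 t : ℂ))) * hinc

theorem offDiag_sub (hs : IsArovSolution S μ 𝔞 𝔄) (h : IsArovFamily S 𝔄) {a b : ℝ}
    (ha : a ∈ S) (hb : b ∈ S) (hab : a ≤ b) :
    offDiag 𝔄 b - offDiag 𝔄 a =
      ∫ ξ in a..b, 2 * 𝔞 ξ * (Real.exp (-2 * logDiag 𝔄 ξ) : ℂ) ∂μ := by
  have hμ := hs.isContinuousMeasure
  have hsub := h.ordConnected.out ha hb
  have hT := (h.continuousOn_entry I 1 0).mono hsub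
  have hE := (continuousOn_exp_neg_logDiag h).mono hsub
  have hint := hs.integrableOn_param_mul h.ordConnected (continuousOn_exp_neg_two_mul_logDiag h)
  obtain ⟨M₁, hM₁⟩ := isCompact_Icc.exists_bound_of_continuousOn hT
  obtain ⟨M₂, hM₂⟩ := isCompact_Icc.exists_bound_of_continuousOn hE
  have hM₁0 : 0 ≤ M₁ := (norm_nonneg _).trans (hM₁ a ⟨le_rfl, hab⟩)
  have hM₂0 : 0 ≤ M₂ := (norm_nonneg _).trans (hM₂ a ⟨le_rfl, hab⟩)
  have key := eq_of_increments_le (g := logDiag 𝔄) (Φ := fun t => offDiag 𝔄 t -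
    ∫ ξ in a..t, 2 * 𝔞 ξ * (Real.exp (-2 * logDiag 𝔄 ξ) : ℂ) ∂μ) hab ?_
  · simp only [intervalIntegral.integral_same, sub_zero] at key
    linear_combination key
  intro ε hε
  -- The first two summands bound the two parts of the integrand, the third the exponential
  -- remainder; the 1 ensures K > 0.
  set K := M₂ + 2 * M₂ + M₂ * M₁ + 1 with hK
  have hK0 : 0 < K := by positivity
  set η := min 1 (ε / K) with hη
  have hη0 : 0 < η := lt_min one_pos (by positivity)
  obtain ⟨r₁, hr₁, h₁⟩ := exists_forall_norm_sub_lt_of_continuousOn hT hη0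
  obtain ⟨r₂, hr₂, h₂⟩ := exists_forall_norm_sub_lt_of_continuousOn hE hη0
  obtain ⟨r₃, hr₃, h₃⟩ := exists_forall_norm_sub_lt_of_continuousOn
    (h.continuousOn_logDiag.mono hsub) hη0
  refine ⟨min r₁ (min r₂ r₃), lt_min hr₁ (lt_min hr₂ hr₃), fun s hsI t ht hst hlt => ?_⟩
  obtain ⟨hlt₁, hlt₂, hlt₃⟩ : t - s < r₁ ∧ t - s < r₂ ∧ t - s < r₃ := by
    simpa only [lt_min_iff] using hlt
  have hd0 : 0 ≤ logDiag 𝔄 t - logDiag 𝔄 s :=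
    sub_nonneg.2 (h.monotoneOn_logDiag (hsub hsI) (hsub ht) hst)
  have hd := h₃ s hsI t ht hst hlt₃
  rw [Real.norm_of_nonneg hd0] at hd
  have hsplit := intervalIntegral.integral_interval_sub_left
    (IsContinuousMeasure.intervalIntegrable hint ha (hsub ht))
    (IsContinuousMeasure.intervalIntegrable hint ha (hsub hsI))
  have hinc := hs.offDiag_increment_eq h (hsub hsI) (hsub ht) hst
  have hb₁ := hμ.norm_integral_le_of_ae (hsub hsI) (hsub ht) hst
    (f := fun ξ => -(Real.exp (-logDiag 𝔄 t) : ℂ) * (𝔄 I ξ 1 0 - 𝔄 I s 1 0) +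
        2 * 𝔞 ξ * (Real.exp (-logDiag 𝔄 ξ) : ℂ) *
          ((Real.exp (-logDiag 𝔄 t) : ℂ) - Real.exp (-logDiag 𝔄 ξ)))
    (B := M₂ * η + 2 * 1 * M₂ * η) (by
      filter_upwards [hs.ae_norm_le_one] with ξ h1 hξ
      have hξI : ξ ∈ Icc a b := ⟨hsI.1.trans hξ.1, hξ.2.trans ht.2⟩
      have e1 := (h₁ s hsI ξ hξI hξ.1 (by linarith [hξ.2])).le
      have e2 := (h₂ ξ hξI t ht hξ.2 (by linarith [hξ.1])).le
      refine (norm_add_le _ _).trans (add_le_add ?_ ?_)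
      · rw [norm_mul, norm_neg]
        exact mul_le_mul (hM₂ t ht) e1 (norm_nonneg _) hM₂0
      · rw [norm_mul, norm_mul, norm_mul, Complex.norm_ofNat]
        have := hM₂ ξ hξI
        gcongr)
  rw [hs.measure_Icc h (hsub hsI) (hsub ht) hst] at hb₁
  have hb₂ : ‖(Real.exp (-logDiag 𝔄 t) : ℂ) * 𝔄 I s 1 0 *
      ((Real.exp (logDiag 𝔄 t - logDiag 𝔄 s) - 1 - (logDiag 𝔄 t - logDiag 𝔄 s) : ℝ) : ℂ)‖ ≤
      M₂ * M₁ * (logDiag 𝔄 t - logDiag 𝔄 s) ^ 2 := by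
    rw [norm_mul, norm_mul]
    have e1 := Real.abs_exp_sub_one_sub_id_le (x := logDiag 𝔄 t - logDiag 𝔄 s)
      (by rw [abs_of_nonneg hd0]; exact hd.le.trans (min_le_left _ _))
    rw [← Real.norm_eq_abs, ← norm_real] at e1
    have e2 := hM₁ s hsI
    have e3 := hM₂ t ht
    gcongr
  have heq : offDiag 𝔄 t - (∫ ξ in a..t, 2 * 𝔞 ξ * (Real.exp (-2 * logDiag 𝔄 ξ) : ℂ) ∂μ) -
      (offDiag 𝔄 s - ∫ ξ in a..s, 2 * 𝔞 ξ * (Real.exp (-2 * logDiag 𝔄 ξ) : ℂ) ∂μ) =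
      offDiag 𝔄 t - offDiag 𝔄 s -
        ∫ ξ in s..t, 2 * 𝔞 ξ * (Real.exp (-2 * logDiag 𝔄 ξ) : ℂ) ∂μ := by
    rw [← hsplit]
    ring
  simp only [heq, hinc]
  refine (norm_add_le _ _).trans ((add_le_add hb₁ hb₂).trans ?_)
  have hηK : η * K ≤ ε := (le_div_iff₀ hK0).1 (min_le_right _ _)
  generalize logDiag 𝔄 t - logDiag 𝔄 s = d at hd0 hd
  calc (M₂ * η + 2 * 1 * M₂ * η) * d + M₂ * M₁ * d ^ 2
      ≤ (M₂ * η + 2 * 1 * M₂ * η) * d + M₂ * M₁ * (η * d) := by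
        rw [sq]; gcongr
    _ ≤ η * K * d := by rw [hK]; nlinarith [mul_nonneg hη0.le hd0]
    _ ≤ ε * d := by gcongr

theorem integral_congr_distrib (hs : IsArovSolution S μ 𝔞 𝔄) (h : IsArovFamily S 𝔄) {t : ℝ}
    (ht : t ∈ S) : EqOn (fun l => 2 * 𝔞 l * (Real.exp (-2 * logDiag 𝔄 l) : ℂ))
      (fun l => 2 * 𝔞 l * (Real.exp (-2 * distrib μ l) : ℂ)) (uIcc 0 t) := fun l hl => by
  simp only [hs.distrib_eq h (h.ordConnected.uIcc_subset h.zero_mem ht hl)]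

theorem kappa_eq (hs : IsArovSolution S μ 𝔞 𝔄) (h : IsArovFamily S 𝔄) {t : ℝ} (ht : t ∈ S) :
    kappa μ 𝔞 t = offDiag 𝔄 t := by
  rw [kappa, ← intervalIntegral.integral_congr (hs.integral_congr_distrib h ht)]
  rcases le_total 0 t with h0 | h0
  · rw [← hs.offDiag_sub h h.zero_mem ht h0, h.offDiag_zero, sub_zero]
  · rw [intervalIntegral.integral_symm, ← hs.offDiag_sub h ht h.zero_mem h0, h.offDiag_zero]
    ring

theorem intervalIntegrable_kappa (hs : IsArovSolution S μ 𝔞 𝔄) (h : IsArovFamily S 𝔄) {t : ℝ}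
    (ht : t ∈ S) :
    IntervalIntegrable (fun l => 2 * 𝔞 l * (Real.exp (-2 * distrib μ l) : ℂ)) μ 0 t :=
  (IsContinuousMeasure.intervalIntegrable
    (hs.integrableOn_param_mul h.ordConnected (continuousOn_exp_neg_two_mul_logDiag h))
    h.zero_mem ht).congr ((hs.integral_congr_distrib h ht).mono uIoc_subset_uIcc)

theorem apply_I_eq (hs : IsArovSolution S μ 𝔞 𝔄) (h : IsArovFamily S 𝔄) {t : ℝ} (ht : t ∈ S) :
    𝔄 I t = !![(Real.exp (distrib μ t) : ℂ), 0;
      -(Real.exp (distrib μ t) : ℂ) * kappa μ 𝔞 t, (Real.exp (-distrib μ t) : ℂ)] := by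
  rw [hs.kappa_eq h ht, hs.distrib_eq h ht, neg_mul, ← IsArovFamily.apply_I_one_zero,
    ← h.apply_I_zero_zero ht, ← h.apply_I_one_one ht, ← (h.gauge t ht).1]
  exact Matrix.eta_fin_two _

/-! ### The Radon–Nikodym derivative at i -/

theorem coeffA_add_coeffB (𝔞 : ℝ → ℂ) (t : ℝ) :
    coeffA 𝔞 t + coeffB 𝔞 t = !![1, 0; -2 * 𝔞 t, 1] := by
  ext i k
  fin_cases i <;> fin_cases k <;> simp [coeffA, coeffB]
  ring

theorem jMat_mul_jMat : jMat * jMat = 1 := by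
  simp [jMat, Matrix.one_fin_two]

theorem hasRNDeriv (hs : IsArovSolution S μ 𝔞 𝔄) (h0 : (0 : ℝ) ∈ S) :
    HasRNDeriv S μ (𝔄 I) fun t => 𝔄 I t * coeffM 𝔞 I t * jMat := by
  refine ⟨fun a ha b hb i k => ?_, fun a ha b hb => ?_⟩
  · simp only [mul_jMat_apply]
    exact (hs.integrableOn_solution I i k a ha b hb).mul_const _
  · ext i k
    have hinc := hs.increment_eq h0 I ha hb i k
    rw [mul_jMat_apply, mul_jMat_apply] at hinc
    simp only [Matrix.sub_apply, matIntegral, Matrix.of_apply, mul_jMat_apply,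
      intervalIntegral.integral_mul_const, ← hinc]
    fin_cases k <;> simp
    ring

theorem ae_eq_of_hasRNDeriv (hμ : IsContinuousMeasure S μ) (hS : S.OrdConnected)
    {F D D' : ℝ → Mat2} (hD : HasRNDeriv S μ F D) (hD' : HasRNDeriv S μ F D') :
    ∀ᵐ t ∂μ, D t = D' t := by
  have hentry : ∀ᵐ t ∂μ, ∀ i k, D t i k - D' t i k = 0 := by
    refine ae_all_iff.2 fun i => ae_all_iff.2 fun k => hμ.ae_eq_zero hS
      (fun a ha b hb => (hD.1 a ha b hb i k).sub (hD'.1 a ha b hb i k)) fun a ha b hb => ?_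
    rw [intervalIntegral.integral_sub
      (IsContinuousMeasure.intervalIntegrable (fun a ha b hb => hD.1 a ha b hb i k) ha hb)
      (IsContinuousMeasure.intervalIntegrable (fun a ha b hb => hD'.1 a ha b hb i k) ha hb),
      sub_eq_zero]
    exact congrFun (congrFun ((hD.2 a ha b hb).symm.trans (hD'.2 a ha b hb)) i) k
  filter_upwards [hentry] with t ht
  ext i k
  exact sub_eq_zero.1 (ht i k)

/-- By uniqueness of densities D agrees a.e. with 𝔄(izA - B)j at z = i, where izA - B = -(A + B);
then j² = 1 gives the formula. -/
theorem ae_eq_neg_inv_mul (hs : IsArovSolution S μ 𝔞 𝔄) (h : IsArovFamily S 𝔄) {D : ℝ → Mat2}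
    (hD : HasRNDeriv S μ (𝔄 I) D) :
    ∀ᵐ t ∂μ, coeffA 𝔞 t + coeffB 𝔞 t = -((𝔄 I t)⁻¹ * D t * jMat) := by
  have hcar : ∀ᵐ t ∂μ, t ∈ S := by
    rw [ae_iff]
    exact hs.isContinuousMeasure.carried
  filter_upwards [hcar, ae_eq_of_hasRNDeriv hs.isContinuousMeasure h.ordConnected hD
    (hs.hasRNDeriv h.zero_mem)] with t ht hDt
  have hinv : (𝔄 I t)⁻¹ * 𝔄 I t = 1 :=
    Matrix.nonsing_inv_mul _ (by rw [h.det I t ht]; exact isUnit_one)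
  have hprod : (𝔄 I t)⁻¹ * (𝔄 I t * coeffM 𝔞 I t * jMat) * jMat = coeffM 𝔞 I t := by
    rw [mul_assoc (𝔄 I t), ← mul_assoc (𝔄 I t)⁻¹, hinv, one_mul, mul_assoc, jMat_mul_jMat, mul_one]
  rw [hDt, hprod, coeffM, I_mul_I, neg_one_smul]
  abel

end IsArovSolution

theorem IsArovFamily.antitoneOn_apply_I_one_one {S : Set ℝ} {𝔄 : ℂ → ℝ → Mat2}
    (h : IsArovFamily S 𝔄) : AntitoneOn (fun t => (𝔄 I t 1 1).re) S := fun s hs t ht hst => by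
  simp only [h.apply_I_one_one hs, h.apply_I_one_one ht, ofReal_re]
  exact Real.exp_le_exp.2 (neg_le_neg (h.monotoneOn_logDiag hs ht hst))

end Arov

end

/-! ### Assembly of the theorem -/

theorem theorem1p1 (S : Set ℝ) (hS : S.OrdConnected) (h0 : (0 : ℝ) ∈ S)
    (𝔄 : ℂ → ℝ → Arov.Mat2)
    (hmono : Arov.IsJMonotonic Arov.jMat S 𝔄)
    (hcont : Arov.IsContinuousFamily S 𝔄)
    (hgauge : Arov.InArovGauge S 𝔄)
    (hdet : ∀ z, ∀ ℓ ∈ S, (𝔄 z ℓ).det = 1)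
    (hinit : ∀ z, 𝔄 z 0 = 1) :
    -- the family solves a canonical system in Arov gauge
    (∃ (μ : MeasureTheory.Measure ℝ) (𝔞 : ℝ → ℂ), Arov.IsArovSolution S μ 𝔞 𝔄) ∧
    -- the (2,2) entry at `i` is decreasing
    AntitoneOn (fun ℓ => (𝔄 Complex.I ℓ 1 1).re) S ∧
    -- the parameters of any such system are determined as follows
    ∀ (μ : MeasureTheory.Measure ℝ) (𝔞 : ℝ → ℂ), Arov.IsArovSolution S μ 𝔞 𝔄 →
      (∀ ℓ ∈ S, Arov.distrib μ ℓ = Real.log (𝔄 Complex.I ℓ 0 0).re ∧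
        Arov.distrib μ ℓ = -Real.log (𝔄 Complex.I ℓ 1 1).re) ∧
      (∃ D, Arov.HasRNDeriv S μ (𝔄 Complex.I) D) ∧
      (∀ D, Arov.HasRNDeriv S μ (𝔄 Complex.I) D →
        ∀ᵐ ℓ ∂μ,
          Arov.coeffA 𝔞 ℓ + Arov.coeffB 𝔞 ℓ = !![1, 0; -2 * 𝔞 ℓ, 1] ∧
          !![1, 0; -2 * 𝔞 ℓ, 1] = -((𝔄 Complex.I ℓ)⁻¹ * D ℓ * Arov.jMat)) ∧
      (∀ᵐ ℓ ∂μ, ‖𝔞 ℓ‖ ≤ 1) ∧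
      (∀ ℓ ∈ S,
        IntervalIntegrable
          (fun l => 2 * 𝔞 l * (Real.exp (-2 * Arov.distrib μ l) : ℂ)) μ 0 ℓ ∧
        𝔄 Complex.I ℓ =
          !![(Real.exp (Arov.distrib μ ℓ) : ℂ), 0;
             -(Real.exp (Arov.distrib μ ℓ) : ℂ) * Arov.kappa μ 𝔞 ℓ,
             (Real.exp (-Arov.distrib μ ℓ) : ℂ)]) := by
  have h : Arov.IsArovFamily S 𝔄 := ⟨hS, h0, hmono, hcont, hgauge, hdet, hinit⟩
  refine ⟨?_, h.antitoneOn_apply_I_one_one, fun μ 𝔞 hs => ⟨fun ℓ hℓ => ⟨hs.distrib_eq h hℓ, ?_⟩,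
    ⟨_, hs.hasRNDeriv h0⟩, fun D hD => ?_, hs.ae_norm_le_one,
    fun ℓ hℓ => ⟨hs.intervalIntegrable_kappa h hℓ, hs.apply_I_eq h hℓ⟩⟩⟩
  · obtain ⟨μ, 𝔞, hp⟩ := h.exists_isParameter
    exact ⟨μ, 𝔞, hp.isArovSolution h⟩
  · rw [hs.distrib_eq h hℓ, h.apply_I_one_one hℓ, Complex.ofReal_re, Real.log_exp, neg_neg]
  · filter_upwards [hs.ae_eq_neg_inv_mul h hD] with ℓ hℓ
    have hsum := Arov.IsArovSolution.coeffA_add_coeffB 𝔞 ℓ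
    exact ⟨hsum, hsum.symm.trans hℓ⟩
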